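/- Let $\mathbb T=\mathbb R/\mathbb Z$, let $V:\mathbb R^3\times\mathbb R^3\to[0,\infty)$ be smooth and compactly supported with $V(x,y)=V(y,x)$, let $\beta>0$, and for $N\ge 1$ let $V_N$ be the periodization on $\mathbb T^3\times\mathbb T^3$ of $N^{6\beta}V(N^\beta x,N^\beta y)$. Let $$H_N=\sum_{j=1}^N(-\Delta_{x_j})+\frac1{N^2}\sum_{1\le i<j<l\le N}V_N(x_i-x_j,x_i-x_l)\quad\text{on }L^2((\mathbb T^{3})^{N}),$$ and let $\psi_N\in C(\mathbb R,L^2((\mathbb T^{3})^{N}))$ be a solution of $i\partial_t\psi_N=H_N\psi_N$ (tested against trigonometric polynomials, i.e. $\psi_N(t)=e^{-itH_N}\psi_N(0)$) such that $\psi_N(t)$ is invariant under permutations of the $N$ particles for all $t$, and $\|\psi_N(0)\|_{L^2}=1$. For $1\le k\le N$ let $\gamma_N^{(k)}(t)=\operatorname{Tr}_{k+1,\dots,N}|\psi_N(t)\rangle\langle\psi_N(t)|$ be the $k$-particle marginals (they solve the BBGKY hierarchy associated with $H_N$), and put $\gamma_N^{(k)}=0$ for $k>N$. Write $S^{(1,k)}=\prod_{j=1}^k(1-\Delta_{x_j})^{1/2}$.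 For each $k\ge1$ let $\mathcal L^1_k$ be the space of trace class operators on $L^2((\mathbb T^{3})^{k})$ with the metric $d_k(\gamma,\tilde\gamma)=\sum_{i\ge1}2^{-i}|\operatorname{Tr}J_i^{(k)}(\gamma-\tilde\gamma)|$, where $\{J^{(k)}_i\}_{i\ge1}$ is any sequence of compact operators of norm at most $1$ that is dense in the unit ball of the space of compact operators. Let $C([0,T],\mathcal L^1_k)$ be the space of $d_k$-continuous paths with the metric $\hat d_k(\gamma,\tilde\gamma)=\sup_{t\in[0,T]}d_k(\gamma(t),\tilde\gamma(t))$, and let $\tau_{prod}$ be the product topology on $\bigoplus_{k\ge1}C([0,T],\mathcal L^1_k)$, understood as the full product of these spaces. Let $T\in(0,\infty)$ and assume that there are finite constants $C,E\ge0$ such that 1. (a priori bound) for every $k\ge1$ there is $N_0(k)$ with $\sup_{t\in[0,T]}\operatorname{Tr}S^{(1,k)}\gamma_N^{(k)}(t)S^{(1,k)}\le C^k$ for all $N\ge\max(N_0(k),k)$; 2. (finite energy per particle) $\frac1N\langle\psi_N(0),H_N\psi_N(0)\rangle\le E$ for all $N\ge1$, the left side being understood as a quadratic form. Then $\Gamma_N=\{\gamma_N^{(k)}\}_{k\ge1}$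 belongs to $\bigoplus_{k\ge1}C([0,T],\mathcal L^1_k)$, the sequence $\{\Gamma_N\}$ is relatively compact with respect to $\tau_{prod}$, and for every limit point $\Gamma=\{\gamma^{(k)}\}_{k\ge1}$ of the sequence as $N\to\infty$, every $k\ge1$ and every $t\in[0,T]$, $\gamma^{(k)}(t)$ is a nonnegative trace class operator with trace at most $1$ which is symmetric (its kernel is invariant under permutations of $x_1,\dots,x_k$ and under permutations of $x_1',\dots,x_k'$), and $$\sup_{t\in[0,T]}\operatorname{Tr}S^{(1,k)}\gamma^{(k)}(t)S^{(1,k)}\le C^k .$$ -/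

import Mathlib

open MeasureTheory Set Filter Topology UnitAddTorus
open scoped ENNReal NNReal ContDiff

/-! ### Trace class operators and the metric attached to a dense sequence of compact operators -/

noncomputable section TraceClass

variable {ι : Type*} {H : Type*} [NormedAddCommGroup H] [InnerProductSpace ℂ H] [CompleteSpace H]

/-- `A` is trace class: `Tr |A| = ∑ ⟨b_i, |A| b_i⟩ < ∞`, where `|A| = (A* A)^{1/2}`.
The terms are nonnegative and the sum does not depend on the Hilbert basis `b`. -/
def IsTraceClass (b : HilbertBasis ι ℂ H) (A : H →L[ℂ] H) : Prop :=
  Summable fun i => (inner ℂ (b i) (CFC.abs A (b i))).re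

/-- The trace `Tr A = ∑ ⟨b_i, A b_i⟩` (absolutely convergent for trace class `A`). -/
def opTrace (b : HilbertBasis ι ℂ H) (A : H →L[ℂ] H) : ℂ :=
  ∑' i, inner ℂ (b i) (A (b i))

/-- Parseval: the Hilbert-Schmidt norm of an operator equals the one of its adjoint. -/
theorem tsum_enorm_sq_adjoint (b : HilbertBasis ι ℂ H) (B : H →L[ℂ] H) :
    ∑' i, ‖B (b i)‖ₑ ^ 2 = ∑' i, ‖ContinuousLinearMap.adjoint B (b i)‖ₑ ^ 2 := by
  have key : ∀ x : H, ‖x‖ₑ ^ 2 = ∑' j, ‖inner ℂ (b j) x‖ₑ ^ 2 := by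
    intro x
    have h1 := b.hasSum_inner_mul_inner x x
    have h2 : HasSum (fun j => ‖inner ℂ (b j) x‖ ^ 2) (‖x‖ ^ 2) := by
      have h3 := Complex.hasSum_re h1
      rw [← inner_self_eq_norm_sq (𝕜 := ℂ) x]
      change HasSum _ (inner ℂ x x).re
      convert h3 using 2 with j
      rw [← inner_conj_symm x (b j), mul_comm, Complex.mul_conj, Complex.normSq_eq_norm_sq,
        Complex.ofReal_re]
    have h4 := h2.tsum_eq
    have h5 : ENNReal.ofReal (∑' j, ‖inner ℂ (b j) x‖ ^ 2)
        = ∑' j, ENNReal.ofReal (‖inner ℂ (b j) x‖ ^ 2) :=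
      ENNReal.ofReal_tsum_of_nonneg (fun _ => sq_nonneg _) h2.summable
    rw [h4] at h5
    simpa [ENNReal.ofReal_pow, ofReal_norm] using h5
  simp_rw [key]
  rw [ENNReal.tsum_comm]
  refine tsum_congr fun j => tsum_congr fun i => ?_
  rw [ContinuousLinearMap.adjoint_inner_right, ← ofReal_norm, ← ofReal_norm, norm_inner_symm]

/-- Polar factorization `A = U |A|` with a contraction `U`. -/
theorem exists_polar (A : H →L[ℂ] H) :
    ∃ U : H →L[ℂ] H, ‖U‖ ≤ 1 ∧ A = U ∘L CFC.abs A := by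
  set P : H →L[ℂ] H := CFC.abs A with hP
  have hPsa : ContinuousLinearMap.adjoint P = P := by
    have : IsSelfAdjoint P := (CFC.abs_nonneg A).isSelfAdjoint
    exact this
  have hnorm : ∀ x, ‖A x‖ = ‖P x‖ := by
    intro x
    have h := CFC.abs_mul_abs A
    rw [← hP] at h
    have h' : P (P x) = ContinuousLinearMap.adjoint A (A x) := congrArg (fun B => B x) h
    have e1 : inner ℂ (P x) (P x) = inner ℂ (A x) (A x) := by
      calc inner ℂ (P x) (P x) = inner ℂ (ContinuousLinearMap.adjoint P x) (P x) := by rw [hPsa]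
        _ = inner ℂ x (P (P x)) := ContinuousLinearMap.adjoint_inner_left _ _ _
        _ = inner ℂ (A x) (A x) := by rw [h', ContinuousLinearMap.adjoint_inner_right]
    rw [inner_self_eq_norm_sq_to_K, inner_self_eq_norm_sq_to_K] at e1
    have e2 : ‖P x‖ ^ 2 = ‖A x‖ ^ 2 := by exact_mod_cast e1
    exact ((sq_eq_sq₀ (norm_nonneg _) (norm_nonneg _)).1 e2).symm
  let K : Submodule ℂ H := (LinearMap.range P.toLinearMap).topologicalClosure
  have hmem : ∀ x, P x ∈ K := fun x => Submodule.le_topologicalClosure _ ⟨x, rfl⟩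
  have : CompleteSpace K := (Submodule.isClosed_topologicalClosure _).completeSpace_coe
  let e : H →ₗ[ℂ] K := P.toLinearMap.codRestrict K hmem
  have hd : DenseRange e := by
    intro y
    rw [Topology.IsInducing.subtypeVal.closure_eq_preimage_closure_image]
    have hy := y.2
    have hs : (Subtype.val '' range e : Set H) = (LinearMap.range P.toLinearMap : Set H) := by
      ext z
      constructor
      · rintro ⟨_, ⟨x, rfl⟩, rfl⟩
        exact ⟨x, rfl⟩
      · rintro ⟨x, rfl⟩
        exact ⟨e x, ⟨x, rfl⟩, rfl⟩
    change (y : H) ∈ closure _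
    have hy' : (y : H) ∈ closure (LinearMap.range P.toLinearMap : Set H) := hy
    rw [← hs] at hy'
    exact hy'
  have hb : ∀ x, ‖A.toLinearMap x‖ ≤ 1 * ‖e x‖ := by
    intro x
    rw [one_mul]
    exact (hnorm x).le
  refine ⟨(A.toLinearMap.extendOfNorm e) ∘L K.orthogonalProjectionOnto, ?_, ?_⟩
  · refine (ContinuousLinearMap.opNorm_comp_le _ _).trans ?_
    have h1 := LinearMap.opNorm_extendOfNorm_le (f := A.toLinearMap) hd zero_le_one hb
    have h2 := K.orthogonalProjectionOnto_norm_le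
    exact mul_le_one₀ h1 (norm_nonneg _) h2
  · ext x
    have h1 : K.orthogonalProjectionOnto (P x) = e x := by
      have := K.orthogonalProjectionOnto_mem_subspace_eq_self (e x)
      simpa [e] using this
    have h2 := LinearMap.extendOfNorm_eq (f := A.toLinearMap) hd ⟨1, hb⟩ x
    simp only [ContinuousLinearMap.comp_apply]
    rw [h1, h2]
    rfl

/-- The duality between bounded and trace class operators: `|Tr (J A)| ≤ C_A ‖J‖`. -/
theorem IsTraceClass.pairing {b : HilbertBasis ι ℂ H} {A : H →L[ℂ] H} (hA : IsTraceClass b A) :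
    ∃ C : ℝ, 0 ≤ C ∧ ∀ J : H →L[ℂ] H,
      (Summable fun i => inner ℂ (b i) ((J ∘L A) (b i))) ∧ ‖opTrace b (J ∘L A)‖ ≤ C * ‖J‖ := by
  obtain ⟨U, hU, hAU⟩ := exists_polar A
  set P : H →L[ℂ] H := CFC.abs A with hP
  set R : H →L[ℂ] H := CFC.sqrt P with hR
  have hP0 : (0 : H →L[ℂ] H) ≤ P := CFC.abs_nonneg A
  have hRR : R * R = P := CFC.sqrt_mul_sqrt_self P hP0
  have hRsa : ContinuousLinearMap.adjoint R = R := by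
    have : IsSelfAdjoint R := (CFC.sqrt_nonneg P).isSelfAdjoint
    exact this
  have hRn : ∀ x, (inner ℂ x (P x)).re = ‖R x‖ ^ 2 := by
    intro x
    have e1 : P x = R (R x) := by rw [← hRR]; rfl
    have e2 : inner ℂ x (R (R x)) = inner ℂ (R x) (R x) := by
      conv_rhs => rw [← ContinuousLinearMap.adjoint_inner_right, hRsa]
    rw [e1, e2]
    exact inner_self_eq_norm_sq (𝕜 := ℂ) (R x)
  have hsR : Summable fun i => ‖R (b i)‖ ^ 2 := by
    refine Summable.congr hA fun i => ?_
    exact hRn (b i)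
  set τ : ℝ := ∑' i, ‖R (b i)‖ ^ 2 with hτ
  have hτ0 : 0 ≤ τ := tsum_nonneg fun _ => sq_nonneg _
  have hτE : ∑' i, ‖R (b i)‖ₑ ^ 2 = ENNReal.ofReal τ := by
    rw [hτ, ENNReal.ofReal_tsum_of_nonneg (fun _ => sq_nonneg _) hsR]
    simp [ENNReal.ofReal_pow, ofReal_norm]
  refine ⟨τ, hτ0, fun J => ?_⟩
  set Q : H →L[ℂ] H := ContinuousLinearMap.adjoint (J ∘L U ∘L R) with hQ
  have hQE : ∑' i, ‖Q (b i)‖ₑ ^ 2 ≤ ENNReal.ofReal (‖J‖ ^ 2 * τ) := by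
    rw [hQ, ← tsum_enorm_sq_adjoint, ENNReal.ofReal_mul (sq_nonneg _), ← hτE,
      ← ENNReal.tsum_mul_left]
    refine ENNReal.tsum_le_tsum fun i => ?_
    have : ‖(J ∘L U ∘L R) (b i)‖ ≤ ‖J‖ * ‖R (b i)‖ := by
      calc ‖J (U (R (b i)))‖ ≤ ‖J‖ * ‖U (R (b i))‖ := J.le_opNorm _
        _ ≤ ‖J‖ * (‖U‖ * ‖R (b i)‖) := by gcongr; exact U.le_opNorm _
        _ ≤ ‖J‖ * (1 * ‖R (b i)‖) := by gcongr
        _ = ‖J‖ * ‖R (b i)‖ := by rw [one_mul]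
    rw [← ofReal_norm, ← ofReal_norm, ← ENNReal.ofReal_pow (norm_nonneg _),
      ← ENNReal.ofReal_pow (norm_nonneg _), ← ENNReal.ofReal_mul (sq_nonneg _), ← mul_pow]
    exact ENNReal.ofReal_le_ofReal (pow_le_pow_left₀ (norm_nonneg _) this 2)
  have hfin : ∀ s : Finset ι, ∑ i ∈ s, ‖Q (b i)‖ ^ 2 ≤ ‖J‖ ^ 2 * τ := by
    intro s
    have h1 := (ENNReal.sum_le_tsum (f := fun i => ‖Q (b i)‖ₑ ^ 2) s).trans hQE
    have h2 : ∑ i ∈ s, ‖Q (b i)‖ₑ ^ 2 = ENNReal.ofReal (∑ i ∈ s, ‖Q (b i)‖ ^ 2) := by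
      rw [ENNReal.ofReal_sum_of_nonneg fun _ _ => sq_nonneg _]
      simp [ENNReal.ofReal_pow, ofReal_norm]
    rw [h2] at h1
    exact (ENNReal.ofReal_le_ofReal_iff (by positivity)).1 h1
  have hterm : ∀ i, inner ℂ (b i) ((J ∘L A) (b i)) = inner ℂ (Q (b i)) (R (b i)) := by
    intro i
    have e1 : (J ∘L A) (b i) = (J ∘L U ∘L R) (R (b i)) := by
      have : A (b i) = U (R (R (b i))) := by
        rw [hAU]
        change U (P (b i)) = _
        rw [← hRR]; rfl
      simp [this]
    rw [e1, hQ, ContinuousLinearMap.adjoint_inner_left]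
  have hsum : ∀ s : Finset ι,
      ∑ i ∈ s, ‖inner ℂ (b i) ((J ∘L A) (b i))‖ ≤ τ * ‖J‖ := by
    intro s
    calc ∑ i ∈ s, ‖inner ℂ (b i) ((J ∘L A) (b i))‖
        ≤ ∑ i ∈ s, ‖Q (b i)‖ * ‖R (b i)‖ := by
          refine Finset.sum_le_sum fun i _ => ?_
          rw [hterm]; exact norm_inner_le_norm _ _
      _ ≤ τ * ‖J‖ := by
          refine abs_le_of_sq_le_sq' ?_ (by positivity) |>.2
          calc (∑ i ∈ s, ‖Q (b i)‖ * ‖R (b i)‖) ^ 2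
              ≤ (∑ i ∈ s, ‖Q (b i)‖ ^ 2) * ∑ i ∈ s, ‖R (b i)‖ ^ 2 :=
                Finset.sum_mul_sq_le_sq_mul_sq _ _ _
            _ ≤ (‖J‖ ^ 2 * τ) * τ := by
                refine mul_le_mul (hfin s) (hsR.sum_le_tsum s fun _ _ => sq_nonneg _)
                  (Finset.sum_nonneg fun _ _ => sq_nonneg _) (by positivity)
            _ = (τ * ‖J‖) ^ 2 := by ring
  have hS : Summable fun i => ‖inner ℂ (b i) ((J ∘L A) (b i))‖ :=
    summable_of_sum_le (fun _ => norm_nonneg _) hsum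
  refine ⟨hS.of_norm, ?_⟩
  exact (norm_tsum_le_tsum_norm hS).trans (hS.tsum_le_of_sum_le hsum)

/-- A sequence of compact operators in the unit ball of the space of compact operators on `H`
which is dense in this unit ball. -/
structure TestFamily (H : Type*) [NormedAddCommGroup H] [InnerProductSpace ℂ H] where
  op : ℕ → H →L[ℂ] H
  compact : ∀ i, IsCompactOperator (op i)
  norm_le : ∀ i, ‖op i‖ ≤ 1
  dense : ∀ K : H →L[ℂ] H, IsCompactOperator K → ‖K‖ ≤ 1 → K ∈ closure (range op)

/-- The space of trace class operators on `H`, to be equipped with the metric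
`d(A, B) = ∑_i 2^{-i} |Tr J_i (A - B)|` attached to the family `J`. -/
@[ext] structure TraceClassOp (b : HilbertBasis ι ℂ H) (J : TestFamily H) where
  op : H →L[ℂ] H
  isTraceClass : IsTraceClass b op

theorem opTrace_comp_sub {b : HilbertBasis ι ℂ H} {A B : H →L[ℂ] H} (hA : IsTraceClass b A)
    (hB : IsTraceClass b B) (J : H →L[ℂ] H) :
    opTrace b (J ∘L (A - B)) = opTrace b (J ∘L A) - opTrace b (J ∘L B) := by
  obtain ⟨_, _, h1⟩ := hA.pairing
  obtain ⟨_, _, h2⟩ := hB.pairing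
  unfold opTrace
  rw [← (h1 J).1.tsum_sub (h2 J).1]
  refine tsum_congr fun i => ?_
  simp

theorem summable_pairing {b : HilbertBasis ι ℂ H} {A B : H →L[ℂ] H} (hA : IsTraceClass b A)
    (hB : IsTraceClass b B) (J : TestFamily H) :
    Summable fun i : ℕ => (1 / 2 : ℝ) ^ (i + 1) * ‖opTrace b (J.op i ∘L (A - B))‖ := by
  obtain ⟨C, hC, h1⟩ := hA.pairing
  obtain ⟨D, hD, h2⟩ := hB.pairing
  have hg : Summable fun i : ℕ => (1 / 2 : ℝ) ^ (i + 1) * (C + D) :=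
    ((summable_nat_add_iff 1).2 summable_geometric_two).mul_right _
  refine hg.of_nonneg_of_le (fun i => by positivity) fun i => ?_
  refine mul_le_mul_of_nonneg_left ?_ (by positivity)
  rw [opTrace_comp_sub hA hB]
  refine (norm_sub_le _ _).trans (add_le_add ?_ ?_)
  · exact ((h1 _).2).trans (mul_le_of_le_one_right hC (J.norm_le i))
  · exact ((h2 _).2).trans (mul_le_of_le_one_right hD (J.norm_le i))

/-- Trace class operators are separated by the traces against a dense family of compact operators
in the unit ball. -/
theorem eq_of_pairing_eq {b : HilbertBasis ι ℂ H} {A B : H →L[ℂ] H} (hA : IsTraceClass b A)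
    (hB : IsTraceClass b B) (J : TestFamily H)
    (h : ∀ i, opTrace b (J.op i ∘L (A - B)) = 0) : A = B := by
  obtain ⟨C, hC, h1⟩ := hA.pairing
  obtain ⟨D, hD, h2⟩ := hB.pairing
  have hdist : ∀ K L : H →L[ℂ] H,
      ‖opTrace b (K ∘L (A - B)) - opTrace b (L ∘L (A - B))‖ ≤ (C + D) * ‖K - L‖ := by
    have hlin : ∀ {X : H →L[ℂ] H}, IsTraceClass b X → ∀ K L : H →L[ℂ] H,
        opTrace b (K ∘L X) - opTrace b (L ∘L X) = opTrace b ((K - L) ∘L X) := by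
      intro X hX K L
      obtain ⟨_, _, h3⟩ := hX.pairing
      unfold opTrace
      rw [← (h3 K).1.tsum_sub (h3 L).1]
      refine tsum_congr fun i => ?_
      simp
    intro K L
    rw [opTrace_comp_sub hA hB, opTrace_comp_sub hA hB, sub_sub_sub_comm, hlin hA, hlin hB, add_mul]
    exact (norm_sub_le _ _).trans (add_le_add (h1 _).2 (h2 _).2)
  have hall : ∀ K : H →L[ℂ] H, IsCompactOperator K → ‖K‖ ≤ 1 → opTrace b (K ∘L (A - B)) = 0 := by
    intro K hK hK1
    refine norm_le_zero_iff.1 (le_of_forall_pos_le_add fun ε hε => ?_)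
    obtain ⟨_, ⟨i, rfl⟩, hi⟩ := Metric.mem_closure_iff.1 (J.dense K hK hK1) (ε / (C + D + 1))
      (by positivity)
    have h3 := hdist K (J.op i)
    rw [h i, sub_zero] at h3
    rw [dist_eq_norm] at hi
    calc _ ≤ (C + D) * ‖K - J.op i‖ := h3
      _ ≤ (C + D + 1) * (ε / (C + D + 1)) := by
          refine mul_le_mul (by linarith) hi.le (norm_nonneg _) (by positivity)
      _ = 0 + ε := by field_simp; ring
  have hmat : ∀ m n, inner ℂ (b m) ((A - B) (b n)) = 0 := by
    classical
    intro m n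
    set K : H →L[ℂ] H := InnerProductSpace.rankOne ℂ (b n) (b m) with hK
    have hKc : IsCompactOperator K := by
      have : IsCompactOperator (innerSL ℂ (b m) : H →L[ℂ] ℂ) :=
        isCompactOperator_of_locallyCompactSpace_dom _
      exact this.clm_comp (ContinuousLinearMap.toSpanSingleton ℂ (b n))
    have hK1 : ‖K‖ ≤ 1 := by
      simp [hK, b.orthonormal.1]
    have h3 := hall K hKc hK1
    unfold opTrace at h3
    rw [tsum_eq_single n] at h3
    · simpa [hK, inner_smul_right, b.orthonormal.1] using h3
    · intro i hi
      simp [hK, b.orthonormal.2 hi]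
  have hD0 : ∀ n, (A - B) (b n) = 0 := by
    intro n
    apply b.repr.injective
    ext m
    rw [b.repr_apply_apply, hmat m n]
    simp
  have h4 : A - B = 0 := by
    refine ContinuousLinearMap.ext_on (s := range b) ?_ ?_
    · rw [dense_iff_closure_eq, ← Submodule.topologicalClosure_coe, b.dense_span]; rfl
    · rintro _ ⟨n, rfl⟩
      simpa using hD0 n
  exact sub_eq_zero.1 h4

instance (b : HilbertBasis ι ℂ H) (J : TestFamily H) : MetricSpace (TraceClassOp b J) where
  dist A B := ∑' i : ℕ, (1 / 2 : ℝ) ^ (i + 1) * ‖opTrace b (J.op i ∘L (A.op - B.op))‖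
  dist_self A := by simp [opTrace]
  dist_comm A B := by
    refine tsum_congr fun i => ?_
    rw [opTrace_comp_sub A.2 B.2, opTrace_comp_sub B.2 A.2, norm_sub_rev]
  dist_triangle A B D := by
    rw [← (summable_pairing A.2 B.2 J).tsum_add (summable_pairing B.2 D.2 J)]
    refine (summable_pairing A.2 D.2 J).tsum_le_tsum (fun i => ?_)
      ((summable_pairing A.2 B.2 J).add (summable_pairing B.2 D.2 J))
    rw [← mul_add, opTrace_comp_sub A.2 B.2, opTrace_comp_sub B.2 D.2, opTrace_comp_sub A.2 D.2]
    exact mul_le_mul_of_nonneg_left (norm_sub_le_norm_sub_add_norm_sub _ _ _) (by positivity)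
  eq_of_dist_eq_zero {A B} h := by
    refine TraceClassOp.ext (eq_of_pairing_eq A.2 B.2 J fun i => ?_)
    have h1 := (hasSum_zero_iff_of_nonneg (fun i => by positivity)).1
      (h ▸ (summable_pairing A.2 B.2 J).hasSum)
    have h2 := congrFun h1 i
    simpa using h2

end TraceClass

/-! ### Bosons on the torus -/

attribute [local instance] instMeasureSpaceUnitAddCircle

noncomputable section Bosons

/-- The configuration space `(𝕋³)^n` of `n` particles, `𝕋 = ℝ/ℤ`; the coordinate `(j, a)` is the
`a`-th coordinate of the `j`-th particle. -/
abbrev Config (n : ℕ) : Type := UnitAddTorus (Fin n × Fin 3)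

/-- `L²((𝕋³)^n)` with respect to the Haar probability measure. -/
abbrev L2 (n : ℕ) : Type := Lp ℂ 2 (volume : Measure (Config n))

/-- The Fourier basis `e_m(x) = exp(2πi m·x)` of `L²((𝕋³)^n)`. -/
abbrev torusBasis (n : ℕ) : HilbertBasis (Fin n × Fin 3 → ℤ) ℂ (L2 n) := mFourierBasis

/-- The position of the `j`-th particle. -/
def pos {n : ℕ} (x : Config n) (j : Fin n) : UnitAddTorus (Fin 3) := fun a => x (j, a)

/-- The eigenvalue `4π²|m_j|²` of `-Δ_{x_j}` on the Fourier mode `e_m`. -/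
def laplaceEigen {n : ℕ} (m : Fin n × Fin 3 → ℤ) (j : Fin n) : ℝ :=
  ∑ a, (2 * Real.pi * (m (j, a) : ℝ)) ^ 2

/-- The representative in `[0,1)³` of a point of `𝕋³`. -/
def torusRep (x : UnitAddTorus (Fin 3)) : Fin 3 → ℝ := fun a => (AddCircle.equivIco 1 0 (x a) : ℝ)

/-- The periodization on `𝕋³ × 𝕋³` of `V_N(x, y) = N^{6β} V(N^β x, N^β y)`. -/
def scaledPotential (V : (Fin 3 → ℝ) → (Fin 3 → ℝ) → ℝ) (β : ℝ) (N : ℕ)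
    (x y : UnitAddTorus (Fin 3)) : ℝ :=
  ∑' q : (Fin 3 → ℤ) × (Fin 3 → ℤ), (N : ℝ) ^ (6 * β) *
    V (fun a => (N : ℝ) ^ β * (torusRep x a + q.1 a)) (fun a => (N : ℝ) ^ β * (torusRep y a + q.2 a))

/-- The interaction `N^{-2} ∑_{i<j<l} V_N(x_i - x_j, x_i - x_l)`. -/
def interaction (V : (Fin 3 → ℝ) → (Fin 3 → ℝ) → ℝ) (β : ℝ) (N : ℕ) (x : Config N) : ℝ :=
  1 / (N : ℝ) ^ 2 * ∑ i, ∑ j, ∑ l, if i < j ∧ j < l then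
    scaledPotential V β N (pos x i - pos x j) (pos x i - pos x l) else 0

/-- `ψ ∈ C(ℝ, L²)` solves `i ∂_t ψ = H_N ψ`, `H_N = ∑_j -Δ_{x_j} + N^{-2} ∑ V_N(x_i-x_j, x_i-x_l)`,
that is, `ψ(t) = e^{-itH_N} ψ(0)`. The equation is tested against the trigonometric polynomials
(a core for `H_N`), i.e. it holds for every Fourier coefficient. -/
structure IsSchrodingerSolution (V : (Fin 3 → ℝ) → (Fin 3 → ℝ) → ℝ) (β : ℝ) (N : ℕ)
    (ψ : ℝ → L2 N) : Prop where
  continuous : Continuous ψ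
  equation : ∀ (m : Fin N × Fin 3 → ℤ) (t : ℝ),
    HasDerivAt (fun s => mFourierCoeff (ψ s) m)
      (-Complex.I * (((∑ j, laplaceEigen m j : ℝ) : ℂ) * mFourierCoeff (ψ t) m
        + mFourierCoeff (fun x => (interaction V β N x : ℂ) * ψ t x) m)) t

/-- The energy `⟨ψ, H_N ψ⟩ ∈ [0, ∞]`, as a quadratic form. -/
def energy (V : (Fin 3 → ℝ) → (Fin 3 → ℝ) → ℝ) (β : ℝ) (N : ℕ) (ψ : L2 N) : ℝ≥0∞ :=
  (∑' m : Fin N × Fin 3 → ℤ, ENNReal.ofReal ((∑ j, laplaceEigen m j) * ‖mFourierCoeff ψ m‖ ^ 2))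
    + ∫⁻ x, ENNReal.ofReal (interaction V β N x * ‖ψ x‖ ^ 2)

/-- The action of a permutation of the particles on configurations. -/
def permConfig {n : ℕ} (σ : Equiv.Perm (Fin n)) (x : Config n) : Config n :=
  fun p => x (σ p.1, p.2)

theorem measurePreserving_permConfig {n : ℕ} (σ : Equiv.Perm (Fin n)) :
    MeasurePreserving (permConfig σ) (volume : Measure (Config n)) volume := by
  have : IsProbabilityMeasure (volume : Measure UnitAddCircle) :=
    inferInstanceAs (IsProbabilityMeasure AddCircle.haarAddCircle)
  have h := volume_measurePreserving_piCongrLeft (fun _ : Fin n × Fin 3 => UnitAddCircle)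
    (Equiv.prodCongr σ⁻¹ (Equiv.refl (Fin 3)))
  convert h using 1
  ext x p
  set e : Fin n × Fin 3 ≃ Fin n × Fin 3 := Equiv.prodCongr σ⁻¹ (Equiv.refl (Fin 3)) with he
  obtain ⟨q, rfl⟩ := e.surjective p
  refine Eq.trans ?_ (Equiv.piCongrLeft_apply_apply (fun _ => UnitAddCircle) e x q).symm
  simp [permConfig, he]

/-- The unitary `(Θ_σ f)(x_1, …, x_n) = f(x_{σ(1)}, …, x_{σ(n)})`. -/
def permOp {n : ℕ} (σ : Equiv.Perm (Fin n)) : L2 n →L[ℂ] L2 n :=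
  (Lp.compMeasurePreservingₗᵢ ℂ (permConfig σ) (measurePreserving_permConfig σ)).toContinuousLinearMap

/-- `ψ ∈ L²_s`: `ψ` is invariant under permutations of the particles. -/
def IsBosonic {n : ℕ} (ψ : L2 n) : Prop := ∀ σ : Equiv.Perm (Fin n), permOp σ ψ = ψ

/-- A density operator is (bosonic) symmetric: its kernel `γ(x, x')` is invariant under permutations
of `x = (x_1, …, x_n)` and under permutations of `x' = (x'_1, …, x'_n)`. -/
def IsSymmetricOp {n : ℕ} (γ : L2 n →L[ℂ] L2 n) : Prop :=
  ∀ σ : Equiv.Perm (Fin n), permOp σ ∘L γ = γ ∧ γ ∘L permOp σ = γ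

/-- The configuration `(x, z)` of `N` particles, the first `k` of them at `x`. -/
def joinConfig (N k : ℕ) (x : Config k) (z : Config (N - k)) : Config N := fun p =>
  if h : p.1.1 < k then x (⟨p.1.1, h⟩, p.2) else z (⟨p.1.1 - k, by omega⟩, p.2)

open Classical in
/-- The slice `ψ(·, z) ∈ L²((𝕋³)^k)`, defined for almost every `z` (and `0` otherwise). -/
def slice {N : ℕ} (k : ℕ) (ψ : L2 N) (z : Config (N - k)) : L2 k :=
  if h : MemLp (fun x => ψ (joinConfig N k x z)) 2 volume then h.toLp else 0

/-- The `k`-particle marginal `Tr_{k+1,…,N} |ψ⟩⟨ψ| = ∫ |ψ(·, z)⟩⟨ψ(·, z)| dz` (for `k ≤ N`), the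
operator with kernel `∫ ψ(x, z) conj ψ(x', z) dz`. -/
def marginal {N : ℕ} (k : ℕ) (ψ : L2 N) : L2 k →L[ℂ] L2 k :=
  ∫ z : Config (N - k), InnerProductSpace.rankOne ℂ (slice k ψ z) (slice k ψ z)

/-- The eigenvalue `∏_j (1 + 4π²|m_j|²)^{1/2}` of `S^{(1,k)} = ∏_j ⟨∇_{x_j}⟩` on `e_m`. -/
def sobolevWeight {k : ℕ} (m : Fin k × Fin 3 → ℤ) : ℝ :=
  ∏ j, Real.sqrt (1 + laplaceEigen m j)

/-- `Tr S^{(1,k)} γ S^{(1,k)} = ∑_m ⟨S^{(1,k)} e_m, γ S^{(1,k)} e_m⟩ ∈ [0, ∞]`, for `γ ≥ 0`. -/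
def kineticTrace {k : ℕ} (γ : L2 k →L[ℂ] L2 k) : ℝ≥0∞ :=
  ∑' m : Fin k × Fin 3 → ℤ, ENNReal.ofReal
    (inner ℂ ((sobolevWeight m : ℂ) • torusBasis k m)
      (γ ((sobolevWeight m : ℂ) • torusBasis k m))).re

/-- The trace class operators on `L²((𝕋³)^k)` with the metric
`d_k(A, B) = ∑_i 2^{-i} |Tr J_i (A - B)|`. -/
abbrev TraceClassSpace (k : ℕ) (J : TestFamily (L2 k)) : Type := TraceClassOp (torusBasis k) J

/-- `⊕_{k ≥ 1} C([0,T], 𝓛¹_k)` with the product topology, where `C([0,T], 𝓛¹_k)` consists of the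
`d_k`-continuous paths with the metric `sup_t d_k(γ(t), γ'(t))`. -/
abbrev HierarchySpace (T : ℝ) (J : ∀ k : ℕ+, TestFamily (L2 k)) : Type :=
  ∀ k : ℕ+, C(Icc (0 : ℝ) T, TraceClassSpace k (J k))

end Bosons

/-! Fix `k`. Relative compactness in the product topology follows from Tychonoff once each sequence
of paths satisfies Arzelà–Ascoli: values in a fixed compact set and equicontinuity in time. The
properties of limit points are closed conditions on matrix elements and pass to the limit.

Compact values. Each marginal is positive with trace at most one. Compact operators are norm limits
of finite matrices and `|Tr JA| ≤ ‖J‖` on such operators (`IsSubdensity.pairing_le`), so convergence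
of every matrix element implies convergence in `d_k` (`tendsto_dist_of_matrix`). Together with weak
limits along ultrafilters this makes the set of these operators compact (`isCompact_subdensity`).

Equicontinuity. By the above it suffices to bound, uniformly in `N`, the Lipschitz constant of each
matrix element between Fourier modes `m`, `n`. It equals `⟨ψ, Oψ⟩` with `O = |e_n⟩⟨e_m| ⊗ 1`. The
kinetic part of its derivative is a fixed frequency difference times the element itself. Triples not
meeting the first `k` particles commute with `O`, so at most `kN²` triples remain against the
prefactor `N⁻²`, and each must contribute `O(1)`. Since the potential is nonnegative, `|⟨ψ, V_N Oψ⟩|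
≤ (⟨ψ, V_N ψ⟩ + ⟨Oψ, V_N Oψ⟩)/2`. The first expectation is controlled by energy conservation,
permutation symmetry and the energy per particle (`integral_triplePotential_le_of_energy`). For the
second, `Oψ` has a fixed momentum in the particle `i < k`. Momentum conservation then leaves one
free frequency in `ℤ³`, and a Schur test with weight `(1 - Δ_j)(1 - Δ_l)` closes because `∑ (1 +
4π²|ξ|²)⁻²` converges in dimension three and `∫∫ V_N` does not depend on `N`
(`integral_triplePotential_mul_le`). Thus only the a priori bounds for `k = 1, 2` enter the
equicontinuity; the bound for general `k` is used for the limit points.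

Energy conservation needs no operator domains. The autocorrelation `s ↦ ⟨ψ(t), ψ(t+s)⟩` is
independent of `t` by unitarity, and when the kinetic energy at time `t` is finite its derivative at
`0` is `-i` times the energy (`IsWeakSolution.energy_const`). -/

/-! ### Positive operators of trace at most one -/

noncomputable section PositiveTraceClass

set_option linter.unusedSectionVars false

variable {ι : Type*} {H : Type*} [NormedAddCommGroup H] [InnerProductSpace ℂ H] [CompleteSpace H]

/-- Positive operators with `Tr A ≤ 1`. -/
def IsSubdensity (b : HilbertBasis ι ℂ H) (A : H →L[ℂ] H) : Prop :=
  A.IsPositive ∧ ∀ s : Finset ι, ∑ i ∈ s, (inner ℂ (b i) (A (b i))).re ≤ 1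

theorem IsSubdensity.isTraceClass {b : HilbertBasis ι ℂ H} {A : H →L[ℂ] H}
    (hA : IsSubdensity b A) : IsTraceClass b A := by
  unfold IsTraceClass
  rw [CFC.abs_of_nonneg A ((ContinuousLinearMap.nonneg_iff_isPositive A).2 hA.1)]
  exact summable_of_sum_le (fun i => hA.1.re_inner_nonneg_right (b i)) hA.2

theorem isSubdensity_zero (b : HilbertBasis ι ℂ H) : IsSubdensity b (0 : H →L[ℂ] H) :=
  ⟨ContinuousLinearMap.isPositive_zero, fun s => by simp⟩

/-- With `R = √A`, the trace is `∑ ⟨(JR)* b_i, R b_i⟩`. Cauchy–Schwarz bounds it by the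
Hilbert–Schmidt norms of `JR` and `R`, at most `‖J‖` and `1`. A constant common to all subdensities
makes norm approximation of `J` uniform over whole families. -/
theorem IsSubdensity.pairing_le {b : HilbertBasis ι ℂ H} {A : H →L[ℂ] H}
    (hA : IsSubdensity b A) (J : H →L[ℂ] H) :
    (Summable fun i => inner ℂ (b i) ((J ∘L A) (b i))) ∧ ‖opTrace b (J ∘L A)‖ ≤ ‖J‖ := by
  set R : H →L[ℂ] H := CFC.sqrt A with hR
  have hP0 : (0 : H →L[ℂ] H) ≤ A := (ContinuousLinearMap.nonneg_iff_isPositive A).2 hA.1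
  have hRR : R * R = A := CFC.sqrt_mul_sqrt_self A hP0
  have hRsa : ContinuousLinearMap.adjoint R = R := by
    have : IsSelfAdjoint R := (CFC.sqrt_nonneg A).isSelfAdjoint
    exact this
  have hRn : ∀ x, (inner ℂ x (A x)).re = ‖R x‖ ^ 2 := by
    intro x
    have e1 : A x = R (R x) := by rw [← hRR]; rfl
    have e2 : inner ℂ x (R (R x)) = inner ℂ (R x) (R x) := by
      conv_rhs => rw [← ContinuousLinearMap.adjoint_inner_right, hRsa]
    rw [e1, e2]
    exact inner_self_eq_norm_sq (𝕜 := ℂ) (R x)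
  have hfR : ∀ s : Finset ι, ∑ i ∈ s, ‖R (b i)‖ ^ 2 ≤ 1 := fun s => by
    simpa only [hRn] using hA.2 s
  have hτE : ∑' i, ‖R (b i)‖ₑ ^ 2 ≤ 1 := by
    refine ENNReal.summable.tsum_le_of_sum_le fun s => ?_
    have h2 : ∑ i ∈ s, ‖R (b i)‖ₑ ^ 2 = ENNReal.ofReal (∑ i ∈ s, ‖R (b i)‖ ^ 2) := by
      rw [ENNReal.ofReal_sum_of_nonneg fun _ _ => sq_nonneg _]
      simp [ENNReal.ofReal_pow, ofReal_norm]
    rw [h2]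
    exact ENNReal.ofReal_le_one.2 (hfR s)
  set Q : H →L[ℂ] H := ContinuousLinearMap.adjoint (J ∘L R) with hQ
  have hQE : ∑' i, ‖Q (b i)‖ₑ ^ 2 ≤ ENNReal.ofReal (‖J‖ ^ 2) := by
    rw [hQ, ← tsum_enorm_sq_adjoint, ← mul_one (ENNReal.ofReal _)]
    refine le_trans ?_ (mul_le_mul_right hτE _)
    rw [← ENNReal.tsum_mul_left]
    refine ENNReal.tsum_le_tsum fun i => ?_
    rw [← ofReal_norm, ← ofReal_norm, ← ENNReal.ofReal_pow (norm_nonneg _),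
      ← ENNReal.ofReal_pow (norm_nonneg _), ← ENNReal.ofReal_mul (sq_nonneg _), ← mul_pow]
    exact ENNReal.ofReal_le_ofReal (pow_le_pow_left₀ (norm_nonneg _) (J.le_opNorm _) 2)
  have hfin : ∀ s : Finset ι, ∑ i ∈ s, ‖Q (b i)‖ ^ 2 ≤ ‖J‖ ^ 2 := by
    intro s
    have h1 := (ENNReal.sum_le_tsum (f := fun i => ‖Q (b i)‖ₑ ^ 2) s).trans hQE
    have h2 : ∑ i ∈ s, ‖Q (b i)‖ₑ ^ 2 = ENNReal.ofReal (∑ i ∈ s, ‖Q (b i)‖ ^ 2) := by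
      rw [ENNReal.ofReal_sum_of_nonneg fun _ _ => sq_nonneg _]
      simp [ENNReal.ofReal_pow, ofReal_norm]
    rw [h2] at h1
    exact (ENNReal.ofReal_le_ofReal_iff (by positivity)).1 h1
  have hterm : ∀ i, inner ℂ (b i) ((J ∘L A) (b i)) = inner ℂ (Q (b i)) (R (b i)) := by
    intro i
    have e1 : (J ∘L A) (b i) = (J ∘L R) (R (b i)) := by
      rw [← hRR]; rfl
    rw [e1, hQ, ContinuousLinearMap.adjoint_inner_left]
  have hsum : ∀ s : Finset ι, ∑ i ∈ s, ‖inner ℂ (b i) ((J ∘L A) (b i))‖ ≤ ‖J‖ := by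
    intro s
    calc ∑ i ∈ s, ‖inner ℂ (b i) ((J ∘L A) (b i))‖
        ≤ ∑ i ∈ s, ‖Q (b i)‖ * ‖R (b i)‖ := by
          refine Finset.sum_le_sum fun i _ => ?_
          rw [hterm]; exact norm_inner_le_norm _ _
      _ ≤ ‖J‖ := by
          refine abs_le_of_sq_le_sq' ?_ (by positivity) |>.2
          calc (∑ i ∈ s, ‖Q (b i)‖ * ‖R (b i)‖) ^ 2
              ≤ (∑ i ∈ s, ‖Q (b i)‖ ^ 2) * ∑ i ∈ s, ‖R (b i)‖ ^ 2 :=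
                Finset.sum_mul_sq_le_sq_mul_sq _ _ _
            _ ≤ ‖J‖ ^ 2 * 1 := mul_le_mul (hfin s) (hfR s)
                  (Finset.sum_nonneg fun _ _ => sq_nonneg _) (by positivity)
            _ = ‖J‖ ^ 2 := mul_one _
  have hS : Summable fun i => ‖inner ℂ (b i) ((J ∘L A) (b i))‖ :=
    summable_of_sum_le (fun _ => norm_nonneg _) hsum
  refine ⟨hS.of_norm, ?_⟩
  exact (norm_tsum_le_tsum_norm hS).trans (hS.tsum_le_of_sum_le hsum)

/-- Matrix elements are traces against rank-one operators. This carries trace bounds over to matrix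
elements, and lets traces against finite matrices be computed from them. -/
theorem opTrace_rankOne_comp (b : HilbertBasis ι ℂ H) (A : H →L[ℂ] H) (f g : H) :
    opTrace b (InnerProductSpace.rankOne ℂ g f ∘L A) = inner ℂ f (A g) := by
  have h := b.tsum_inner_mul_inner (ContinuousLinearMap.adjoint A f) g
  rw [ContinuousLinearMap.adjoint_inner_left] at h
  rw [← h]
  refine tsum_congr fun i => ?_
  simp [ContinuousLinearMap.adjoint_inner_left]

theorem IsSubdensity.norm_inner_le {b : HilbertBasis ι ℂ H} {A : H →L[ℂ] H}
    (hA : IsSubdensity b A) (f g : H) : ‖inner ℂ f (A g)‖ ≤ ‖f‖ * ‖g‖ := by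
  rw [← opTrace_rankOne_comp b]
  refine (hA.pairing_le _).2.trans ?_
  rw [InnerProductSpace.norm_rankOne, mul_comm]

/-- The orthogonal projection to the span of finitely many basis vectors. -/
def finProj (b : HilbertBasis ι ℂ H) (F : Finset ι) : H →L[ℂ] H :=
  ∑ i ∈ F, InnerProductSpace.rankOne ℂ (b i) (b i)

theorem finProj_apply (b : HilbertBasis ι ℂ H) (F : Finset ι) (x : H) :
    finProj b F x = ∑ i ∈ F, inner ℂ (b i) x • b i := by
  simp [finProj]

theorem norm_finProj_apply_le (b : HilbertBasis ι ℂ H) (F : Finset ι) (x : H) :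
    ‖finProj b F x‖ ≤ ‖x‖ := by
  classical
  refine abs_le_of_sq_le_sq' ?_ (norm_nonneg _) |>.2
  have h : ‖∑ i ∈ F, inner ℂ (b i) x • b i‖ ^ 2 = ∑ i ∈ F, ‖inner ℂ (b i) x‖ ^ 2 := by
    rw [← inner_self_eq_norm_sq (𝕜 := ℂ), b.orthonormal.inner_sum, map_sum]
    refine Finset.sum_congr rfl fun i _ => ?_
    rw [RCLike.conj_mul]
    norm_cast
  rw [finProj_apply, h]
  exact b.orthonormal.sum_inner_products_le x

theorem tendsto_finProj (b : HilbertBasis ι ℂ H) (x : H) :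
    Tendsto (fun F => finProj b F x) atTop (𝓝 x) := by
  have h := b.hasSum_repr x
  simp only [b.repr_apply_apply] at h
  simpa only [finProj_apply] using! h

/-- Compact operators are norm limits of finite matrices. -/
theorem IsCompactOperator.exists_matrix_approx (b : HilbertBasis ι ℂ H) {K : H →L[ℂ] H}
    (hK : IsCompactOperator K) {ε : ℝ} (hε : 0 < ε) :
    ∃ (S : Finset (ι × ι)) (c : ι × ι → ℂ),
      ‖K - ∑ p ∈ S, c p • InnerProductSpace.rankOne ℂ (b p.1) (b p.2)‖ ≤ ε := by
  -- Truncation on the left: finitely many centres approximate the image of the unit ball, and one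
  -- `F` works for all centres. The three errors of size `ε / 6` are the distance to a centre, the
  -- truncation of the centre, and the truncated distance.
  obtain ⟨F, hF⟩ : ∃ F, ‖K - finProj b F ∘L K‖ ≤ ε / 2 := by
    have hc := hK.isCompact_closure_image_closedBall 1
    obtain ⟨t, ht, hcov⟩ := Metric.totallyBounded_iff.1
      (hc.totallyBounded.subset subset_closure) (ε / 6) (by positivity)
    have hev : ∀ᶠ F in atTop, ∀ y ∈ t, ‖finProj b F y - y‖ ≤ ε / 6 := by
      rw [Set.Finite.eventually_all ht]
      intro y _
      have := (tendsto_iff_norm_sub_tendsto_zero.1 (tendsto_finProj b y)).eventually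
        (Iio_mem_nhds (show (0 : ℝ) < ε / 6 by positivity))
      exact this.mono fun F hF => le_of_lt hF
    obtain ⟨F, hF⟩ := hev.exists
    refine ⟨F, ContinuousLinearMap.opNorm_le_of_unit_norm (by positivity) fun x hx => ?_⟩
    have hmem : K x ∈ K '' Metric.closedBall 0 1 := ⟨x, by simp [hx], rfl⟩
    obtain ⟨y, hy, hxy⟩ := mem_iUnion₂.1 (hcov hmem)
    rw [Metric.mem_ball, dist_eq_norm] at hxy
    have e : (K - finProj b F ∘L K) x
        = (K x - y) - (finProj b F y - y) - finProj b F (K x - y) := by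
      simp only [sub_apply, ContinuousLinearMap.comp_apply, map_sub]
      abel
    rw [e]
    calc _ ≤ ‖K x - y‖ + ‖finProj b F y - y‖ + ‖finProj b F (K x - y)‖ :=
          (norm_sub_le _ _).trans (add_le_add_left (norm_sub_le _ _) _)
      _ ≤ ε / 6 + ε / 6 + ε / 6 :=
          add_le_add (add_le_add hxy.le (hF y hy)) ((norm_finProj_apply_le _ _ _).trans hxy.le)
      _ = ε / 2 := by ring
  -- What remains is `∑ m ∈ F, |b m⟩⟨K* b m|`; truncating the finitely many vectors `K* b m` costs
  -- the other `ε / 2`.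
  obtain ⟨G, hG⟩ : ∃ G, ∑ m ∈ F, ‖ContinuousLinearMap.adjoint K (b m)
      - finProj b G (ContinuousLinearMap.adjoint K (b m))‖ ≤ ε / 2 := by
    have h : Tendsto (fun G => ∑ m ∈ F, ‖ContinuousLinearMap.adjoint K (b m)
      - finProj b G (ContinuousLinearMap.adjoint K (b m))‖) atTop (𝓝 (∑ m ∈ F, 0)) := by
      refine tendsto_finsetSum _ fun m _ => ?_
      have := tendsto_iff_norm_sub_tendsto_zero.1
        (tendsto_finProj b (ContinuousLinearMap.adjoint K (b m)))
      exact this.congr fun G => norm_sub_rev _ _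
    rw [Finset.sum_const_zero] at h
    obtain ⟨G, hG⟩ := (h.eventually (Iio_mem_nhds (show (0 : ℝ) < ε / 2 by positivity))).exists
    exact ⟨G, le_of_lt hG⟩
  refine ⟨F ×ˢ G, fun p => inner ℂ (b p.1) (K (b p.2)), ?_⟩
  have e : K - ∑ p ∈ F ×ˢ G, (inner ℂ (b p.1) (K (b p.2)) : ℂ) •
        InnerProductSpace.rankOne ℂ (b p.1) (b p.2)
      = (K - finProj b F ∘L K) + ∑ m ∈ F, InnerProductSpace.rankOne ℂ (b m)
        (ContinuousLinearMap.adjoint K (b m)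
          - finProj b G (ContinuousLinearMap.adjoint K (b m))) := by
    ext x
    simp only [map_sub, Finset.sum_sub_distrib, Finset.sum_product, finProj_apply]
    have h1 : (finProj b F ∘L K) x = (∑ m ∈ F, InnerProductSpace.rankOne ℂ (b m)
        (ContinuousLinearMap.adjoint K (b m))) x := by
      simp [finProj_apply, ContinuousLinearMap.adjoint_inner_left]
    rw [add_apply, sub_apply, sub_apply, sub_apply, h1, sub_add_sub_cancel]
    congr 1
    simp only [FunLike.coe_sum, Finset.sum_apply, smul_apply,
      InnerProductSpace.rankOne_apply, sum_inner, Finset.sum_smul, inner_smul_left,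
      inner_conj_symm, ContinuousLinearMap.adjoint_inner_right, smul_smul]
  rw [e]
  refine (norm_add_le _ _).trans ?_
  calc _ ≤ ε / 2 + ε / 2 := by
        refine add_le_add hF ((norm_sum_le _ _).trans (le_trans ?_ hG))
        refine Finset.sum_le_sum fun m _ => ?_
        rw [InnerProductSpace.norm_rankOne, b.orthonormal.1, one_mul]
    _ = ε := by ring

theorem IsSubdensity.opTrace_sub {b : HilbertBasis ι ℂ H} {A : H →L[ℂ] H}
    (hA : IsSubdensity b A) (K L : H →L[ℂ] H) :
    opTrace b ((K - L) ∘L A) = opTrace b (K ∘L A) - opTrace b (L ∘L A) := by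
  unfold opTrace
  rw [← (hA.pairing_le K).1.tsum_sub (hA.pairing_le L).1]
  exact tsum_congr fun i => by simp

theorem IsSubdensity.opTrace_sum {b : HilbertBasis ι ℂ H} {A : H →L[ℂ] H}
    (hA : IsSubdensity b A) (S : Finset (ι × ι)) (c : ι × ι → ℂ) :
    opTrace b ((∑ p ∈ S, c p • InnerProductSpace.rankOne ℂ (b p.1) (b p.2)) ∘L A)
      = ∑ p ∈ S, c p * inner ℂ (b p.2) (A (b p.1)) := by
  simp_rw [← opTrace_rankOne_comp b A]
  unfold opTrace
  simp_rw [← tsum_mul_left]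
  rw [← Summable.tsum_finsetSum fun p _ => ((hA.pairing_le _).1.mul_left _)]
  refine tsum_congr fun i => ?_
  simp

/-- On positive operators of trace at most one, traces against compact operators are controlled
by matrix elements. -/
theorem tendsto_opTrace_sub {α : Type*} {l : Filter α} {b : HilbertBasis ι ℂ H}
    {A B : α → H →L[ℂ] H} (hA : ∀ a, IsSubdensity b (A a)) (hB : ∀ a, IsSubdensity b (B a))
    (h : ∀ m n, Tendsto (fun a => inner ℂ (b m) (A a (b n)) - inner ℂ (b m) (B a (b n))) l (𝓝 0))
    {K : H →L[ℂ] H} (hK : IsCompactOperator K) :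
    Tendsto (fun a => opTrace b (K ∘L A a) - opTrace b (K ∘L B a)) l (𝓝 0) := by
  rw [Metric.tendsto_nhds]
  intro ε hε
  -- Replacing `K` by the finite matrix costs at most `ε / 4` in each trace, uniformly in the index,
  -- by `IsSubdensity.pairing_le`.
  obtain ⟨S, c, hS⟩ := hK.exists_matrix_approx b (ε := ε / 4) (by positivity)
  set K' := ∑ p ∈ S, c p • InnerProductSpace.rankOne ℂ (b p.1) (b p.2) with hK'
  have h1 : Tendsto (fun a => opTrace b (K' ∘L A a) - opTrace b (K' ∘L B a)) l (𝓝 0) := by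
    have : Tendsto (fun a => ∑ p ∈ S, c p * (inner ℂ (b p.2) (A a (b p.1))
        - inner ℂ (b p.2) (B a (b p.1)))) l (𝓝 (∑ p ∈ S, c p * 0)) :=
      tendsto_finsetSum _ fun p _ => (h _ _).const_mul _
    simp only [mul_zero, Finset.sum_const_zero] at this
    refine this.congr fun a => ?_
    rw [hK', (hA a).opTrace_sum, (hB a).opTrace_sum, ← Finset.sum_sub_distrib]
    simp_rw [mul_sub]
  filter_upwards [Metric.tendsto_nhds.1 h1 (ε / 2) (by positivity)] with a ha
  rw [dist_zero_right] at ha ⊢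
  have h2 := (hA a).opTrace_sub K K'
  have h3 := (hB a).opTrace_sub K K'
  have h4 := ((hA a).pairing_le (K - K')).2.trans hS
  have h5 := ((hB a).pairing_le (K - K')).2.trans hS
  rw [h2] at h4
  rw [h3] at h5
  calc _ = ‖(opTrace b (K' ∘L A a) - opTrace b (K' ∘L B a))
        + (opTrace b (K ∘L A a) - opTrace b (K' ∘L A a))
        - (opTrace b (K ∘L B a) - opTrace b (K' ∘L B a))‖ := by congr 1; ring
    _ ≤ _ + _ + _ := (norm_sub_le _ _).trans (add_le_add_left (norm_add_le _ _) _)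
    _ < ε / 2 + ε / 4 + ε / 4 := by linarith
    _ = ε := by ring

/-- Each term of the series defining the metric tends to zero, and the terms are dominated by `2 ·
2^{-(i+1)}`. All later convergence and continuity statements for the metric reduce to scalar matrix
elements through this lemma; two moving families are allowed so that it also yields equicontinuity.
-/
theorem tendsto_dist_of_matrix {α : Type*} {l : Filter α} {b : HilbertBasis ι ℂ H}
    {J : TestFamily H} {A B : α → TraceClassOp b J} (hA : ∀ a, IsSubdensity b (A a).op)
    (hB : ∀ a, IsSubdensity b (B a).op)
    (h : ∀ m n, Tendsto (fun a => inner ℂ (b m) ((A a).op (b n)) - inner ℂ (b m) ((B a).op (b n)))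
      l (𝓝 0)) :
    Tendsto (fun a => dist (A a) (B a)) l (𝓝 0) := by
  have h0 : (0 : ℝ) = ∑' i : ℕ, (1 / 2 : ℝ) ^ (i + 1) * 0 := by simp
  rw [h0]
  refine tendsto_tsum_of_dominated_convergence (bound := fun i : ℕ => (1 / 2 : ℝ) ^ (i + 1) * 2)
    (((summable_nat_add_iff 1).2 summable_geometric_two).mul_right _) (fun i => ?_)
    (Eventually.of_forall fun a i => ?_)
  · refine Tendsto.const_mul _ ?_
    have := (tendsto_opTrace_sub hA hB h (J.compact i)).norm
    rw [norm_zero] at this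
    refine this.congr fun a => ?_
    rw [opTrace_comp_sub (A a).2 (B a).2]
  · rw [norm_mul, norm_norm, Real.norm_of_nonneg (by positivity), opTrace_comp_sub (A a).2 (B a).2]
    refine mul_le_mul_of_nonneg_left ((norm_sub_le _ _).trans ?_) (by positivity)
    have h1 := ((hA a).pairing_le (J.op i)).2.trans (J.norm_le i)
    have h2 := ((hB a).pairing_le (J.op i)).2.trans (J.norm_le i)
    linarith

/-- A bounded operator as a weak limit along an ultrafilter. -/
theorem exists_weak_limit {α : Type*} (f : Ultrafilter α) (A : α → H →L[ℂ] H)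
    (h : ∀ᶠ a in (f : Filter α), ∀ x y, ‖inner ℂ x (A a y)‖ ≤ ‖x‖ * ‖y‖) :
    ∃ B : H →L[ℂ] H, ∀ x y, Tendsto (fun a => inner ℂ x (A a y)) f (𝓝 (inner ℂ x (B y))) := by
  -- The values stay in a compact disc, so the ultrafilter has a limit there. Placing the operator
  -- in the left slot makes the limit form conjugate-linear in `x` and linear in `y`; the slots are
  -- exchanged at the end by conjugation.
  have hlim : ∀ x y, ∃ z : ℂ, ‖z‖ ≤ ‖x‖ * ‖y‖ ∧ Tendsto (fun a => inner ℂ (A a x) y) f (𝓝 z) := by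
    intro x y
    have hc := isCompact_closedBall (0 : ℂ) (‖x‖ * ‖y‖)
    obtain ⟨z, hz, hz'⟩ := hc.ultrafilter_le_nhds (f.map fun a => inner ℂ (A a x) y) (by
      rw [le_principal_iff]
      change ∀ᶠ a in (f : Filter α), _
      filter_upwards [h] with a ha
      rw [mem_closedBall_zero_iff, ← norm_inner_symm, mul_comm]
      exact ha y x)
    exact ⟨z, by simpa using hz, hz'⟩
  choose z hz hlim using hlim
  let Bl : H →ₗ⋆[ℂ] H →ₗ[ℂ] ℂ := LinearMap.mk₂'ₛₗ (starRingEnd ℂ) (RingHom.id ℂ) z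
    (fun x x' y => tendsto_nhds_unique (hlim _ _)
      (((hlim x y).add (hlim x' y)).congr fun a => by simp))
    (fun c x y => tendsto_nhds_unique (hlim _ _)
      (((hlim x y).const_mul (starRingEnd ℂ c)).congr fun a => by simp [mul_comm]))
    (fun x y y' => tendsto_nhds_unique (hlim _ _)
      (((hlim x y).add (hlim x y')).congr fun a => by simp))
    (fun c x y => tendsto_nhds_unique (hlim _ _)
      (((hlim x y).const_mul c).congr fun a => by simp))
  let Bc : H →L⋆[ℂ] H →L[ℂ] ℂ := Bl.mkContinuous₂ 1 fun x y => by
    rw [one_mul]; exact hz x y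
  refine ⟨InnerProductSpace.continuousLinearMapOfBilin Bc, fun x y => ?_⟩
  have h1 := ((hlim y x).star).congr (f₂ := fun a => inner ℂ x (A a y)) fun a => inner_conj_symm _ _
  have h2 : inner ℂ (InnerProductSpace.continuousLinearMapOfBilin Bc y) x = z y x :=
    InnerProductSpace.continuousLinearMapOfBilin_apply Bc y x
  rw [← inner_conj_symm, h2]
  exact h1

/-- The set of positive operators of trace at most one whose matrix lies in a closed set is compact
with respect to the metric `d`. -/
theorem isCompact_subdensity (b : HilbertBasis ι ℂ H) (J : TestFamily H) {Q : Set (ι → ι → ℂ)}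
    (hQ : IsClosed Q) : IsCompact {A : TraceClassOp b J | IsSubdensity b A.op ∧
      (fun m n => inner ℂ (b m) (A.op (b n))) ∈ Q} := by
  rw [isCompact_iff_ultrafilter_le_nhds]
  intro f hf
  rw [le_principal_iff] at hf
  have hfS : ∀ᶠ A : TraceClassOp b J in (f : Filter _), IsSubdensity b A.op ∧
      (fun m n => inner ℂ (b m) (A.op (b n))) ∈ Q := hf
  obtain ⟨B, hB⟩ := exists_weak_limit f (fun A : TraceClassOp b J => A.op)
    (hfS.mono fun A hA x y => hA.1.norm_inner_le x y)
  have hBsub : IsSubdensity b B := by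
    constructor
    · rw [ContinuousLinearMap.isPositive_def']
      refine ⟨?_, fun x => ?_⟩
      · rw [ContinuousLinearMap.isSelfAdjoint_iff_isSymmetric]
        intro x y
        change inner ℂ (B x) y = inner ℂ x (B y)
        rw [← inner_conj_symm]
        refine tendsto_nhds_unique (((hB y x).star).congr' ?_) (hB x y)
        filter_upwards [hfS] with A hA
        have : inner ℂ (A.op x) y = inner ℂ x (A.op y) := hA.1.1.isSymmetric x y
        rw [← this]
        exact inner_conj_symm _ _
      · rw [ContinuousLinearMap.reApplyInnerSelf_apply, ← inner_re_symm]
        refine ge_of_tendsto ((Complex.continuous_re.tendsto _).comp (hB x x)) ?_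
        filter_upwards [hfS] with A hA
        exact hA.1.1.re_inner_nonneg_right x
    · intro s
      refine le_of_tendsto (tendsto_finsetSum s fun i _ =>
        (Complex.continuous_re.tendsto _).comp (hB (b i) (b i))) ?_
      filter_upwards [hfS] with A hA
      exact hA.1.2 s
  refine ⟨⟨B, hBsub.isTraceClass⟩, ⟨hBsub, ?_⟩, ?_⟩
  · exact hQ.mem_of_tendsto (tendsto_pi_nhds.2 fun m => tendsto_pi_nhds.2 fun n =>
      hB (b m) (b n)) (hfS.mono fun A hA => hA.2)
  · have hres : Tendsto (fun A : {A : TraceClassOp b J // IsSubdensity b A.op} =>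
        dist A.1 (⟨B, hBsub.isTraceClass⟩ : TraceClassOp b J))
        (comap Subtype.val (f : Filter (TraceClassOp b J))) (𝓝 0) := by
      refine tendsto_dist_of_matrix (fun A => A.2) (fun _ => hBsub) fun m n => ?_
      have := ((hB (b m) (b n)).comp (tendsto_comap (f := Subtype.val)
        (α := {A : TraceClassOp b J // IsSubdensity b A.op}))).sub_const (inner ℂ (b m) (B (b n)))
      rw [sub_self] at this
      exact this
    rw [← tendsto_iff_dist_tendsto_zero] at hres
    have hmap : map Subtype.val (comap (Subtype.val :
        {A : TraceClassOp b J // IsSubdensity b A.op} → _) (f : Filter (TraceClassOp b J))) = f := by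
      rw [map_comap, inf_eq_left, le_principal_iff]
      filter_upwards [hfS] with A hA
      exact ⟨⟨A, hA.1⟩, rfl⟩
    rw [Tendsto, hmap] at hres
    exact hres

end PositiveTraceClass

/-! ### Weak solutions of `i ∂_t ψ = (Λ + W) ψ` with `Λ` diagonal and `W` bounded symmetric -/

noncomputable section Dynamics

set_option linter.unusedSectionVars false

variable {ι : Type*} {H : Type*} [NormedAddCommGroup H] [InnerProductSpace ℂ H] [CompleteSpace H]

theorem HilbertBasis.ext_inner (b : HilbertBasis ι ℂ H) {x y : H}
    (h : ∀ i, inner ℂ (b i) x = inner ℂ (b i) y) : x = y := by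
  apply b.repr.injective
  ext i
  simpa only [b.repr_apply_apply] using h i

theorem HilbertBasis.hasSum_norm_sq (b : HilbertBasis ι ℂ H) (x : H) :
    HasSum (fun i => ‖inner ℂ (b i) x‖ ^ 2) (‖x‖ ^ 2) := by
  have h := Complex.hasSum_re (b.hasSum_inner_mul_inner x x)
  rw [← inner_self_eq_norm_sq (𝕜 := ℂ) x]
  refine h.congr_fun fun i => ?_
  rw [← inner_conj_symm x (b i), mul_comm, Complex.mul_conj, Complex.normSq_eq_norm_sq,
    Complex.ofReal_re]

theorem HilbertBasis.hasSum_conj_mul (b : HilbertBasis ι ℂ H) (x y : H) :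
    HasSum (fun i => starRingEnd ℂ (inner ℂ (b i) x) * inner ℂ (b i) y) (inner ℂ x y) := by
  simpa only [inner_conj_symm] using b.hasSum_inner_mul_inner x y

/-- The operator multiplying the `i`-th coefficient by `a i`, where `|a i| ≤ 1`. -/
def diagOp (b : HilbertBasis ι ℂ H) (a : ι → ℂ) (ha : ∀ i, ‖a i‖ ≤ 1) : H →L[ℂ] H :=
  have hle : ∀ x i, ‖a i * b.repr x i‖ ^ 2 ≤ ‖b.repr x i‖ ^ 2 := fun x i => by
    rw [norm_mul]
    exact pow_le_pow_left₀ (by positivity) (mul_le_of_le_one_left (norm_nonneg _) (ha i)) 2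
  have hsum : ∀ x, HasSum (fun i => ‖b.repr x i‖ ^ 2) (‖x‖ ^ 2) := fun x => by
    simpa only [b.repr_apply_apply] using b.hasSum_norm_sq x
  have hmem : ∀ x, Memℓp (fun i => a i * b.repr x i) 2 := fun x => by
    rw [memℓp_gen_iff (by norm_num)]
    refine Summable.of_nonneg_of_le (fun i => by positivity) (fun i => ?_) (hsum x).summable
    simpa using hle x i
  LinearMap.mkContinuous
    { toFun := fun x => b.repr.symm ⟨fun i => a i * b.repr x i, hmem x⟩
      map_add' := fun x y => by
        rw [← map_add]
        congr 1
        ext i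
        simp only [map_add, lp.coeFn_add, Pi.add_apply, mul_add]
      map_smul' := fun c x => by
        rw [RingHom.id_apply, ← map_smul]
        congr 1
        ext i
        simp [mul_left_comm] } 1 fun x => by
    rw [one_mul, LinearMap.coe_mk, AddHom.coe_mk]
    refine abs_le_of_sq_le_sq' ?_ (norm_nonneg _) |>.2
    refine hasSum_le (fun i => hle x i) ?_ (hsum x)
    have h := b.hasSum_norm_sq (b.repr.symm ⟨fun i => a i * b.repr x i, hmem x⟩)
    simpa only [← b.repr_apply_apply, LinearIsometryEquiv.apply_symm_apply] using h

variable {b : HilbertBasis ι ℂ H} {a : ι → ℂ}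

theorem inner_diagOp (ha : ∀ i, ‖a i‖ ≤ 1) (x : H) (i : ι) :
    inner ℂ (b i) (diagOp b a ha x) = a i * inner ℂ (b i) x := by
  rw [← b.repr_apply_apply, ← b.repr_apply_apply]
  simp [diagOp]

theorem norm_diagOp_apply_le (ha : ∀ i, ‖a i‖ ≤ 1) (x : H) : ‖diagOp b a ha x‖ ≤ ‖x‖ := by
  refine abs_le_of_sq_le_sq' ?_ (norm_nonneg _) |>.2
  refine hasSum_le (fun i => ?_) (b.hasSum_norm_sq _) (b.hasSum_norm_sq x)
  rw [inner_diagOp, norm_mul]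
  exact pow_le_pow_left₀ (by positivity) (mul_le_of_le_one_left (norm_nonneg _) (ha i)) 2

/-- Strong, not norm, continuity. Split into the moving multiplier on the fixed vector `f t₀`,
handled by dominated convergence of the coefficients with bound `2² ‖c_i‖²`, and a contraction
applied to `f t - f t₀`. -/
theorem continuous_diagOp {a : ℝ → ι → ℂ} (ha : ∀ t i, ‖a t i‖ ≤ 1)
    (hac : ∀ i, Continuous fun t => a t i) {f : ℝ → H} (hf : Continuous f) :
    Continuous fun t => diagOp b (a t) (ha t) (f t) := by
  rw [continuous_iff_continuousAt]
  intro t₀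
  have h1 : Tendsto (fun t => diagOp b (a t) (ha t) (f t₀)) (𝓝 t₀)
      (𝓝 (diagOp b (a t₀) (ha t₀) (f t₀))) := by
    rw [tendsto_iff_norm_sub_tendsto_zero]
    have hs : ∀ t, HasSum (fun i => ‖a t i - a t₀ i‖ ^ 2 * ‖inner ℂ (b i) (f t₀)‖ ^ 2)
        (‖diagOp b (a t) (ha t) (f t₀) - diagOp b (a t₀) (ha t₀) (f t₀)‖ ^ 2) := fun t => by
      refine (b.hasSum_norm_sq _).congr_fun fun i => ?_
      rw [inner_sub_right, inner_diagOp, inner_diagOp, ← sub_mul, norm_mul, mul_pow]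
    have h2 : Tendsto (fun t => ∑' i, ‖a t i - a t₀ i‖ ^ 2 * ‖inner ℂ (b i) (f t₀)‖ ^ 2) (𝓝 t₀)
        (𝓝 (∑' i : ι, 0)) := by
      refine tendsto_tsum_of_dominated_convergence
        (bound := fun i => 4 * ‖inner ℂ (b i) (f t₀)‖ ^ 2)
        ((b.hasSum_norm_sq (f t₀)).summable.mul_left 4) (fun i => ?_)
        (Eventually.of_forall fun t i => ?_)
      · have h3 : Continuous fun t => ‖a t i - a t₀ i‖ ^ 2 * ‖inner ℂ (b i) (f t₀)‖ ^ 2 := by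
          have := hac i
          fun_prop
        have h4 := h3.tendsto t₀
        simpa using h4
      · rw [Real.norm_of_nonneg (by positivity)]
        refine mul_le_mul_of_nonneg_right ?_ (by positivity)
        calc ‖a t i - a t₀ i‖ ^ 2 ≤ (1 + 1) ^ 2 := by
              refine pow_le_pow_left₀ (norm_nonneg _) ((norm_sub_le _ _).trans ?_) 2
              exact add_le_add (ha t i) (ha t₀ i)
          _ = 4 := by norm_num
    rw [tsum_zero] at h2
    simp_rw [fun t => (hs t).tsum_eq] at h2
    have h3 := (Real.continuous_sqrt.tendsto 0).comp h2
    rw [Real.sqrt_zero] at h3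
    exact h3.congr fun t => Real.sqrt_sq (norm_nonneg _)
  have h2 : Tendsto (fun t => diagOp b (a t) (ha t) (f t - f t₀)) (𝓝 t₀) (𝓝 0) := by
    refine squeeze_zero_norm (fun t => norm_diagOp_apply_le (ha t) _) ?_
    exact tendsto_iff_norm_sub_tendsto_zero.1 (hf.tendsto t₀)
  have h3 := h1.add h2
  rw [add_zero] at h3
  refine h3.congr fun t => ?_
  rw [map_sub]
  abel

variable (b) in
/-- The free propagator `e^{-itΛ}`. -/
def freeProp (lam : ι → ℝ) (t : ℝ) : H →L[ℂ] H :=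
  diagOp b (fun i => Complex.exp ((-(lam i * t) : ℝ) * Complex.I)) fun _ =>
    (Complex.norm_exp_ofReal_mul_I _).le

variable {lam : ι → ℝ}

theorem inner_freeProp (t : ℝ) (x : H) (i : ι) : inner ℂ (b i) (freeProp b lam t x)
    = Complex.exp ((-(lam i * t) : ℝ) * Complex.I) * inner ℂ (b i) x :=
  inner_diagOp _ x i

theorem freeProp_zero (x : H) : freeProp b lam 0 x = x :=
  b.ext_inner fun i => by rw [inner_freeProp]; simp

theorem inner_freeProp_freeProp (t : ℝ) (x y : H) :
    inner ℂ (freeProp b lam t x) (freeProp b lam t y) = inner ℂ x y := by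
  refine (b.hasSum_conj_mul _ _).unique ((b.hasSum_conj_mul x y).congr_fun fun i => ?_)
  rw [inner_freeProp, inner_freeProp, map_mul, mul_mul_mul_comm, ← Complex.normSq_eq_conj_mul_self,
    Complex.normSq_eq_norm_sq, Complex.norm_exp_ofReal_mul_I]
  simp

theorem continuous_freeProp {f : ℝ → H} (hf : Continuous f) {r : ℝ → ℝ} (hr : Continuous r) :
    Continuous fun t => freeProp b lam (r t) (f t) :=
  continuous_diagOp _ (fun _ => by fun_prop) hf

/-- Termwise differentiation, legitimate exactly because `lam i * w i` dominates the derivatives.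
With `w i` the squared coefficients of a state, this hypothesis says that its kinetic energy is
finite. -/
theorem hasDerivAt_tsum_exp (hlam : ∀ i, 0 ≤ lam i) {w : ι → ℝ} (hw : ∀ i, 0 ≤ w i)
    (h0 : Summable fun i => Complex.exp ((-(lam i * (0 : ℝ)) : ℝ) * Complex.I) * (w i : ℂ))
    (hs : Summable fun i => lam i * w i) :
    HasDerivAt (fun s : ℝ => ∑' i, Complex.exp ((-(lam i * s) : ℝ) * Complex.I) * (w i : ℂ))
      (-Complex.I * (∑' i, lam i * w i : ℝ)) 0 := by
  have e3 : -Complex.I * (∑' i, lam i * w i : ℝ)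
      = ∑' i, Complex.exp ((-(lam i * (0 : ℝ)) : ℝ) * Complex.I) * ((-lam i : ℝ) * Complex.I)
        * (w i : ℂ) := by
    rw [Complex.ofReal_tsum, ← tsum_mul_left]
    refine tsum_congr fun i => ?_
    simp
    ring
  rw [e3]
  refine hasDerivAt_tsum (u := fun i => lam i * w i)
    (g := fun i (s : ℝ) => Complex.exp ((-(lam i * s) : ℝ) * Complex.I) * (w i : ℂ))
    (g' := fun i (s : ℝ) => Complex.exp ((-(lam i * s) : ℝ) * Complex.I)
      * ((-lam i : ℝ) * Complex.I) * (w i : ℂ)) hs (fun i s => ?_)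
    (fun i s => ?_) h0 0
  · have h2 : HasDerivAt (fun t : ℝ => -(lam i * t)) (-lam i) s := by
      simpa using (hasDerivAt_id s).const_mul (-lam i)
    exact (h2.ofReal_comp.mul_const Complex.I).cexp.mul_const _
  · rw [norm_mul, norm_mul, Complex.norm_exp_ofReal_mul_I, one_mul, norm_mul,
      Complex.norm_real, norm_neg, Complex.norm_I, mul_one, Complex.norm_real,
      Real.norm_of_nonneg (hlam i), Real.norm_of_nonneg (hw i)]

/-- `ψ` solves `i ∂_t ψ = (Λ + W) ψ` coefficientwise. -/
structure IsWeakSolution (b : HilbertBasis ι ℂ H) (lam : ι → ℝ) (W : H →L[ℂ] H)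
    (ψ : ℝ → H) : Prop where
  continuous : Continuous ψ
  equation : ∀ i t, HasDerivAt (fun s => inner ℂ (b i) (ψ s))
    (-Complex.I * ((lam i : ℂ) * inner ℂ (b i) (ψ t) + inner ℂ (b i) (W (ψ t)))) t

namespace IsWeakSolution

variable {W : H →L[ℂ] H} {ψ φ : ℝ → H}

theorem shift (hψ : IsWeakSolution b lam W ψ) (s : ℝ) :
    IsWeakSolution b lam W fun t => ψ (t + s) where
  continuous := hψ.continuous.comp (by fun_prop)
  equation i t := (hψ.equation i (t + s)).comp_add_const t s

/-- The interaction picture `e^{itΛ} ψ(t)` is continuously differentiable. -/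
theorem hasDerivAt_interaction (hψ : IsWeakSolution b lam W ψ) (t : ℝ) :
    HasDerivAt (fun t => freeProp b lam (-t) (ψ t))
      (-Complex.I • freeProp b lam (-t) (W (ψ t))) t := by
  set h : ℝ → H := fun r => -Complex.I • freeProp b lam (-r) (W (ψ r)) with hh
  have hc : Continuous h :=
    (continuous_freeProp (W.continuous.comp hψ.continuous) continuous_neg).const_smul _
  have hG : ∀ t, HasDerivAt (fun t => ψ 0 + ∫ r in (0 : ℝ)..t, h r) (h t) t := fun t =>
    (hc.integral_hasStrictDerivAt 0 t).hasDerivAt.const_add (ψ 0)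
  have hchi : ∀ i t, HasDerivAt (fun t => inner ℂ (b i) (freeProp b lam (-t) (ψ t)))
      (inner ℂ (b i) (h t)) t := by
    intro i t
    have h1 : HasDerivAt (fun t : ℝ => Complex.exp ((-(lam i * -t) : ℝ) * Complex.I))
        (Complex.exp ((-(lam i * -t) : ℝ) * Complex.I) * (lam i * Complex.I)) t := by
      refine HasDerivAt.cexp ?_
      have h2 : HasDerivAt (fun t : ℝ => -(lam i * -t)) (lam i) t := by
        have := (hasDerivAt_id t).const_mul (lam i)
        simpa using this
      exact h2.ofReal_comp.mul_const Complex.I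
    have h3 := h1.mul (hψ.equation i t)
    simp only [inner_freeProp]
    refine h3.congr_deriv ?_
    rw [hh, inner_smul_right, inner_freeProp]
    ring
  -- The unbounded `Λ` has cancelled, so the right-hand side `h` is norm continuous and has a norm
  -- differentiable primitive. Both sides agree at time `0` and have the same coefficientwise
  -- derivatives, which upgrades the weak equation to a strong one.
  have heq : (fun t => freeProp b lam (-t) (ψ t)) = fun t => ψ 0 + ∫ r in (0 : ℝ)..t, h r := by
    funext t
    refine b.ext_inner fun i => ?_
    have hd : ∀ t, HasDerivAt (fun t => inner ℂ (b i) (freeProp b lam (-t) (ψ t))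
        - inner ℂ (b i) (ψ 0 + ∫ r in (0 : ℝ)..t, h r)) 0 t := fun t => by
      have h1 := HasDerivAt.inner ℂ (hasDerivAt_const t (b i)) (hG t)
      refine ((hchi i t).sub h1).congr_deriv ?_
      simp
    have h2 := is_const_of_deriv_eq_zero (fun t => (hd t).differentiableAt)
      (fun t => (hd t).deriv) t 0
    simp only [neg_zero, freeProp_zero, intervalIntegral.integral_same, add_zero, sub_self] at h2
    exact sub_eq_zero.1 h2
  rw [heq]
  exact hG t

/-- In the interaction picture the two terms of the derivative cancel by symmetry of `W`. Allowing
two solutions matters: a solution and its time shift give the autocorrelation used for energy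
conservation. -/
theorem inner_const (hψ : IsWeakSolution b lam W ψ) (hφ : IsWeakSolution b lam W φ)
    (hW : ∀ x y, inner ℂ (W x) y = inner ℂ x (W y)) (s t : ℝ) :
    inner ℂ (ψ s) (φ s) = inner ℂ (ψ t) (φ t) := by
  have hd : ∀ t, HasDerivAt (fun t => inner ℂ (ψ t) (φ t)) 0 t := fun t => by
    have h := HasDerivAt.inner ℂ (hψ.hasDerivAt_interaction t) (hφ.hasDerivAt_interaction t)
    simp only [inner_freeProp_freeProp, inner_smul_left, inner_smul_right, hW] at h
    refine h.congr_deriv ?_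
    simp
  exact is_const_of_deriv_eq_zero (fun t => (hd t).differentiableAt) (fun t => (hd t).deriv) s t

theorem norm_const (hψ : IsWeakSolution b lam W ψ)
    (hW : ∀ x y, inner ℂ (W x) y = inner ℂ x (W y)) (s t : ℝ) : ‖ψ s‖ = ‖ψ t‖ := by
  have h := hψ.inner_const hψ hW s t
  rw [inner_self_eq_norm_sq_to_K, inner_self_eq_norm_sq_to_K] at h
  have h' : ‖ψ s‖ ^ 2 = ‖ψ t‖ ^ 2 := by exact_mod_cast h
  exact (sq_eq_sq₀ (norm_nonneg _) (norm_nonneg _)).1 h'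

/-- Undoing the free flow gives `⟨ψ(t), ψ(t+s)⟩ = ⟨h s, η s - η 0⟩ + ⟨h s, ψ t⟩`. The first term
produces the interaction energy, the second the kinetic energy. -/
theorem hasDerivAt_autocorrelation (hψ : IsWeakSolution b lam W ψ) (hlam : ∀ i, 0 ≤ lam i) {t : ℝ}
    (hs : Summable fun i => lam i * ‖inner ℂ (b i) (ψ t)‖ ^ 2) :
    HasDerivAt (fun s => inner ℂ (ψ t) (ψ (t + s)))
      (-Complex.I * ((∑' i, lam i * ‖inner ℂ (b i) (ψ t)‖ ^ 2 : ℝ)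
        + inner ℂ (ψ t) (W (ψ t)))) 0 := by
  set η : ℝ → H := fun s => freeProp b lam (-s) (ψ (s + t)) with hη
  have hη0 : η 0 = ψ t := by simp [hη, freeProp_zero]
  have hηd : HasDerivAt η (-Complex.I • W (ψ t)) 0 := by
    have := (hψ.shift t).hasDerivAt_interaction 0
    simpa only [neg_zero, freeProp_zero, zero_add] using this
  set h : ℝ → H := fun s => freeProp b lam (-s) (ψ t) with hh
  have hhc : Continuous h := continuous_freeProp continuous_const continuous_neg
  -- The second factor vanishes at `0`, so continuity of `h` replaces its differentiability, which
  -- may fail for states outside the domain of `Λ`.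
  have h1 : HasDerivAt (fun s => inner ℂ (h s) (η s - η 0))
      (inner ℂ (ψ t) (-Complex.I • W (ψ t))) 0 := by
    rw [hasDerivAt_iff_tendsto_slope] at hηd ⊢
    have hh0 : h 0 = ψ t := by simp [hh, freeProp_zero]
    have h2 := ((hhc.tendsto 0).mono_left (nhdsWithin_le_nhds (s := {0}ᶜ))).inner hηd (𝕜 := ℂ)
    rw [hh0] at h2
    refine h2.congr fun s => ?_
    simp only [slope, vsub_eq_sub, sub_self, inner_zero_right, sub_zero, inner_smul_right_eq_smul]
  have h2 : HasDerivAt (fun s => inner ℂ (h s) (ψ t))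
      (-Complex.I * (∑' i, lam i * ‖inner ℂ (b i) (ψ t)‖ ^ 2 : ℝ)) 0 := by
    have e1 : ∀ s, HasSum (fun i => Complex.exp ((-(lam i * s) : ℝ) * Complex.I)
        * (‖inner ℂ (b i) (ψ t)‖ ^ 2 : ℝ)) (inner ℂ (h s) (ψ t)) := fun s => by
      refine (b.hasSum_conj_mul (h s) (ψ t)).congr_fun fun i => ?_
      rw [hh, inner_freeProp, map_mul, mul_assoc, ← Complex.normSq_eq_conj_mul_self,
        Complex.normSq_eq_norm_sq, ← Complex.exp_conj]
      congr 2
      simp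
    have e2 : (fun s => inner ℂ (h s) (ψ t)) = fun s => ∑' i,
        Complex.exp ((-(lam i * s) : ℝ) * Complex.I) * (‖inner ℂ (b i) (ψ t)‖ ^ 2 : ℝ) :=
      funext fun s => (e1 s).tsum_eq.symm
    rw [e2]
    exact hasDerivAt_tsum_exp hlam (fun i => sq_nonneg _) (e1 0).summable hs
  have h3 := h1.add h2
  refine (h3.congr_deriv ?_).congr_of_eventuallyEq (Eventually.of_forall fun s => ?_)
  · rw [inner_smul_right]; ring
  · simp only [hη0, inner_sub_right, Pi.add_apply]
    rw [sub_add_cancel, hη, hh, inner_freeProp_freeProp, add_comm]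

/-- Conservation of the energy, for solutions of finite kinetic energy. -/
theorem energy_const (hψ : IsWeakSolution b lam W ψ) (hlam : ∀ i, 0 ≤ lam i)
    (hW : ∀ x y, inner ℂ (W x) y = inner ℂ x (W y)) {s t : ℝ}
    (hs : Summable fun i => lam i * ‖inner ℂ (b i) (ψ s)‖ ^ 2)
    (ht : Summable fun i => lam i * ‖inner ℂ (b i) (ψ t)‖ ^ 2) :
    (∑' i, lam i * ‖inner ℂ (b i) (ψ s)‖ ^ 2) + (inner ℂ (ψ s) (W (ψ s))).re
      = (∑' i, lam i * ‖inner ℂ (b i) (ψ t)‖ ^ 2) + (inner ℂ (ψ t) (W (ψ t))).re := by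
  have h1 := hψ.hasDerivAt_autocorrelation hlam hs
  have h2 := hψ.hasDerivAt_autocorrelation hlam ht
  -- The two autocorrelations coincide as functions of the lag, hence so do their derivatives at
  -- `0`.
  have h3 : (fun r => inner ℂ (ψ s) (ψ (s + r))) = fun r => inner ℂ (ψ t) (ψ (t + r)) :=
    funext fun r => hψ.inner_const (hψ.shift r) hW s t
  rw [h3] at h1
  have h4 := mul_left_cancel₀ (neg_ne_zero.2 Complex.I_ne_zero) (h1.unique h2)
  simpa using congrArg Complex.re h4

/-- The evolution of the expectation of an observable which changes the free energy by `c`. -/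
theorem hasDerivAt_expectation (hψ : IsWeakSolution b lam W ψ) {A : H →L[ℂ] H} {c : ℝ}
    (hA : ∀ t x, A (freeProp b lam t x)
      = Complex.exp ((c * t : ℝ) * Complex.I) • freeProp b lam t (A x)) (t : ℝ) :
    HasDerivAt (fun t => inner ℂ (ψ t) (A (ψ t)))
      (Complex.I * (c * inner ℂ (ψ t) (A (ψ t)) + inner ℂ (W (ψ t)) (A (ψ t))
        - inner ℂ (ψ t) (A (W (ψ t))))) t := by
  have h1 := hψ.hasDerivAt_interaction t
  have h2 : HasDerivAt (fun t => A (freeProp b lam (-t) (ψ t)))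
      (A (-Complex.I • freeProp b lam (-t) (W (ψ t)))) t :=
    (A.restrictScalars ℝ).hasFDerivAt.comp_hasDerivAt t h1
  have h3 := HasDerivAt.inner ℂ h1 h2
  have h4 : HasDerivAt (fun t : ℝ => Complex.exp ((c * t : ℝ) * Complex.I))
      (Complex.exp ((c * t : ℝ) * Complex.I) * (c * Complex.I)) t := by
    refine HasDerivAt.cexp ?_
    have h2 : HasDerivAt (fun t : ℝ => c * t) c t := by
      simpa using (hasDerivAt_id t).const_mul c
    exact h2.ofReal_comp.mul_const Complex.I
  -- The phase `e^{ict}` compensates the commutation of `A` with the free flow. The expectation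
  -- becomes a product of differentiable functions although `ψ` itself need not be differentiable in
  -- norm.
  have key : ∀ (t : ℝ) (x y : H), Complex.exp ((c * t : ℝ) * Complex.I)
      * inner ℂ (freeProp b lam (-t) x) (A (freeProp b lam (-t) y)) = inner ℂ x (A y) := by
    intro t x y
    rw [hA, inner_smul_right, inner_freeProp_freeProp, ← mul_assoc, ← Complex.exp_add]
    simp
  have h5 := h4.mul h3
  simp only [map_smul, inner_smul_left, inner_smul_right] at h5
  refine (h5.congr_deriv ?_).congr_of_eventuallyEq (Eventually.of_forall fun t => (key t _ _).symm)
  rw [← key t (ψ t) (ψ t), ← key t (W (ψ t)) (ψ t), ← key t (ψ t) (W (ψ t))]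
  simp only [map_neg, Complex.conj_I]
  ring

end IsWeakSolution

end Dynamics

/-! ### Marginals in Fourier variables -/

noncomputable section Marginals

theorem continuous_rankOne_self {H : Type*} [NormedAddCommGroup H] [InnerProductSpace ℂ H] :
    Continuous fun u : H => InnerProductSpace.rankOne ℂ u u := by
  have h1 : Continuous fun u : H => (ContinuousLinearMap.toSpanSingleton ℂ u : ℂ →L[ℂ] H) :=
    (ContinuousLinearMap.toSpanSingletonCLE (𝕜 := ℂ) (E := H)).continuous
  have h2 : Continuous fun u : H => innerSL ℂ u := (innerSL ℂ).continuous
  exact h1.clm_comp h2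

instance : IsProbabilityMeasure (volume : Measure UnitAddCircle) :=
  inferInstanceAs (IsProbabilityMeasure AddCircle.haarAddCircle)

theorem inner_torusBasis {n : ℕ} (m : Fin n × Fin 3 → ℤ) (f : L2 n) :
    inner ℂ (torusBasis n m) f = mFourierCoeff f m := by
  rw [← mFourierBasis_repr, HilbertBasis.repr_apply_apply]

/-- The reindexing `(x, z) ↦ joinConfig N k x z` with an arbitrary target. -/
def joinEquiv {N k : ℕ} (h : k ≤ N) (α : Type*) :
    (Fin k × Fin 3 → α) × (Fin (N - k) × Fin 3 → α) ≃ (Fin N × Fin 3 → α) where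
  toFun xz p := if h : p.1.1 < k then xz.1 (⟨p.1.1, h⟩, p.2)
    else xz.2 (⟨p.1.1 - k, by omega⟩, p.2)
  invFun q := (fun p => q (Fin.castLE h p.1, p.2), fun p => q (⟨p.1.1 + k, by omega⟩, p.2))
  left_inv xz := by
    ext p <;> simp
  right_inv q := by
    ext ⟨p, a⟩
    by_cases hp : p.1 < k
    · simp [hp]
    · have : p.1 - k + k = p.1 := by omega
      simp [hp, this]

/-- The coordinates of `N` particles, split into the first `k` and the others. -/
def coordEquiv {N k : ℕ} (h : k ≤ N) :
    (Fin k × Fin 3) ⊕ (Fin (N - k) × Fin 3) ≃ Fin N × Fin 3 :=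
  (Equiv.sumProdDistrib _ _ _).symm.trans
    ((finSumFinEquiv.trans (finCongr (by omega))).prodCongr (Equiv.refl _))

theorem joinEquiv_coordEquiv_inl {N k : ℕ} (h : k ≤ N) {α : Type*}
    (xz : (Fin k × Fin 3 → α) × (Fin (N - k) × Fin 3 → α)) (p : Fin k × Fin 3) :
    joinEquiv h α xz (coordEquiv h (Sum.inl p)) = xz.1 p := by
  simp [joinEquiv, coordEquiv]

theorem joinEquiv_coordEquiv_inr {N k : ℕ} (h : k ≤ N) {α : Type*}
    (xz : (Fin k × Fin 3 → α) × (Fin (N - k) × Fin 3 → α)) (p : Fin (N - k) × Fin 3) :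
    joinEquiv h α xz (coordEquiv h (Sum.inr p)) = xz.2 p := by
  simp [joinEquiv, coordEquiv]

theorem measurePreserving_joinConfig {N k : ℕ} (h : k ≤ N) :
    MeasurePreserving (fun zx : Config (N - k) × Config k => joinConfig N k zx.2 zx.1)
      volume volume := by
  have h1 := (volume_measurePreserving_piCongrLeft (fun _ : Fin N × Fin 3 => UnitAddCircle)
    (coordEquiv h)).comp ((volume_measurePreserving_sumPiEquivProdPi_symm
      (fun _ : (Fin k × Fin 3) ⊕ (Fin (N - k) × Fin 3) => UnitAddCircle)).comp
      (Measure.measurePreserving_swap (μ := (volume : Measure (Config (N - k))))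
        (ν := (volume : Measure (Config k)))))
  refine (congrArg (fun f => MeasurePreserving f volume volume) ?_).mpr h1
  funext zx p
  obtain ⟨q, rfl⟩ := (coordEquiv h).surjective p
  refine Eq.trans ?_ (Equiv.piCongrLeft_apply_apply (fun _ => UnitAddCircle) (coordEquiv h) _ q).symm
  change joinEquiv h UnitAddCircle (zx.2, zx.1) _ = _
  rcases q with q | q
  · rw [joinEquiv_coordEquiv_inl]; rfl
  · rw [joinEquiv_coordEquiv_inr]; rfl

theorem mFourier_joinEquiv {N k : ℕ} (h : k ≤ N) (m : Fin k × Fin 3 → ℤ)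
    (p : Fin (N - k) × Fin 3 → ℤ) (x : Config k) (z : Config (N - k)) :
    mFourier (joinEquiv h ℤ (m, p)) (joinConfig N k x z) = mFourier m x * mFourier p z := by
  change ∏ i, _ = (∏ i, _) * ∏ i, _
  have : joinConfig N k x z = joinEquiv h UnitAddCircle (x, z) := rfl
  rw [this, ← Equiv.prod_comp (coordEquiv h), Fintype.prod_sum_type]
  simp only [joinEquiv_coordEquiv_inl, joinEquiv_coordEquiv_inr]

/-! ### Slices of a wave function and the marginals built from them -/

section Slice

variable {N k : ℕ} (h : k ≤ N) (ψ : L2 N)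
include h

theorem memLp_joinConfig :
    MemLp (fun zx : Config (N - k) × Config k => ψ (joinConfig N k zx.2 zx.1)) 2 volume :=
  (Lp.memLp ψ).comp_measurePreserving (measurePreserving_joinConfig h)

theorem ae_memLp_slice :
    ∀ᵐ z : Config (N - k), MemLp (fun x => ψ (joinConfig N k x z)) 2 volume := by
  have hm := memLp_joinConfig h ψ
  have h1 := hm.1.prodMk_left
  have h2 := ((memLp_two_iff_integrable_sq_norm hm.1).1 hm).prod_right_ae
  filter_upwards [h1, h2] with z hz1 hz2
  exact (memLp_two_iff_integrable_sq_norm hz1).2 hz2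

theorem ae_coeFn_slice :
    ∀ᵐ z : Config (N - k), slice k ψ z =ᵐ[volume] fun x => ψ (joinConfig N k x z) := by
  filter_upwards [ae_memLp_slice h ψ] with z hz
  rw [slice, dif_pos hz]
  exact hz.coeFn_toLp

theorem ae_inner_slice (m : Fin k × Fin 3 → ℤ) :
    ∀ᵐ z : Config (N - k), inner ℂ (torusBasis k m) (slice k ψ z)
      = ∫ x, mFourier (-m) x * ψ (joinConfig N k x z) := by
  filter_upwards [ae_coeFn_slice h ψ] with z hz
  rw [inner_torusBasis]
  refine integral_congr_ae ?_
  filter_upwards [hz] with x hx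
  rw [hx, smul_eq_mul]

theorem integrable_joinConfig (m : Fin k × Fin 3 → ℤ) :
    Integrable (fun zx : Config (N - k) × Config k =>
      mFourier (-m) zx.2 * ψ (joinConfig N k zx.2 zx.1)) volume := by
  refine ((memLp_joinConfig h ψ).integrable (by norm_num)).bdd_mul (c := 1) ?_ ?_
  · exact ((mFourier (-m)).continuous.comp continuous_snd).aestronglyMeasurable
  · exact Eventually.of_forall fun zx => ((mFourier (-m)).norm_coe_le_norm _).trans
      mFourier_norm.le

theorem aestronglyMeasurable_inner_slice (m : Fin k × Fin 3 → ℤ) :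
    AEStronglyMeasurable (fun z : Config (N - k) => inner ℂ (torusBasis k m) (slice k ψ z))
      volume :=
  ((integrable_joinConfig h ψ m).1.integral_prod_right').congr
    ((ae_inner_slice h ψ m).mono fun _ hz => hz.symm)

/-- As an `L2`-valued map the slice is the pointwise limit of its finite Fourier truncations, whose
coefficients are measurable by Fubini. -/
theorem aestronglyMeasurable_slice :
    AEStronglyMeasurable (fun z : Config (N - k) => slice k ψ z) volume := by
  refine aestronglyMeasurable_of_tendsto_ae (atTop : Filter (Finset (Fin k × Fin 3 → ℤ)))
    (f := fun F z => finProj (torusBasis k) F (slice k ψ z)) (fun F => ?_)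
    (Eventually.of_forall fun z => tendsto_finProj _ _)
  simp only [finProj_apply]
  exact Finset.aestronglyMeasurable_fun_sum _ fun m _ =>
    (aestronglyMeasurable_inner_slice h ψ m).smul_const _

theorem memLp_slice : MemLp (fun z : Config (N - k) => slice k ψ z) 2 volume := by
  rw [memLp_two_iff_integrable_sq_norm (aestronglyMeasurable_slice h ψ)]
  have hm := memLp_joinConfig h ψ
  refine (((memLp_two_iff_integrable_sq_norm hm.1).1 hm).integral_prod_left).congr ?_
  filter_upwards [ae_coeFn_slice h ψ] with z hz
  have h1 : ‖slice k ψ z‖ ^ 2 = ∫ x, ‖slice k ψ z x‖ ^ 2 := by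
    rw [← inner_self_eq_norm_sq (𝕜 := ℂ), L2.inner_def, ← integral_re (L2.integrable_inner _ _)]
    simp_rw [inner_self_eq_norm_sq]
  rw [h1]
  refine integral_congr_ae ?_
  filter_upwards [hz] with x hx
  rw [hx]

theorem integrable_rankOne_slice : Integrable (fun z : Config (N - k) =>
    InnerProductSpace.rankOne ℂ (slice k ψ z) (slice k ψ z)) volume := by
  have hs := memLp_slice h ψ
  refine ((memLp_two_iff_integrable_sq_norm hs.1).1 hs).mono' ?_ ?_
  · exact continuous_rankOne_self.comp_aestronglyMeasurable hs.1
  · exact Eventually.of_forall fun z => by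
      rw [InnerProductSpace.norm_rankOne, sq]

theorem inner_marginal (f g : L2 k) : inner ℂ f (marginal k ψ g)
    = ∫ z : Config (N - k), inner ℂ f (slice k ψ z) * inner ℂ (slice k ψ z) g := by
  let L : (L2 k →L[ℂ] L2 k) →L[ℂ] ℂ :=
    (innerSL ℂ f) ∘L (ContinuousLinearMap.apply ℂ (L2 k) g)
  have h1 := L.integral_comp_comm (integrable_rankOne_slice h ψ)
  have h2 : L (marginal k ψ) = inner ℂ f (marginal k ψ g) := rfl
  rw [← h2, marginal, ← h1]
  refine integral_congr_ae (Eventually.of_forall fun z => ?_)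
  change inner ℂ f (InnerProductSpace.rankOne ℂ (slice k ψ z) (slice k ψ z) g) = _
  rw [InnerProductSpace.rankOne_apply, inner_smul_right, mul_comm]

theorem memLp_inner_slice (m : Fin k × Fin 3 → ℤ) :
    MemLp (fun z : Config (N - k) => inner ℂ (torusBasis k m) (slice k ψ z)) 2 volume := by
  refine (memLp_slice h ψ).of_le (aestronglyMeasurable_inner_slice h ψ m)
    (Eventually.of_forall fun z => ?_)
  refine (norm_inner_le_norm _ _).trans ?_
  rw [(torusBasis k).orthonormal.1, one_mul]

/-- Characters factor over the splitting of the particles, so Fubini identifies the Fourier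
coefficients in the traced-out variables with those of `ψ`. Parseval in these variables then
expresses marginals through the coefficients of `ψ`. -/
theorem mFourierCoeff_inner_slice (m : Fin k × Fin 3 → ℤ) (p : Fin (N - k) × Fin 3 → ℤ) :
    mFourierCoeff (fun z : Config (N - k) => inner ℂ (torusBasis k m) (slice k ψ z)) p
      = inner ℂ (torusBasis N (joinEquiv h ℤ (m, p))) ψ := by
  have hgen : ∀ F : Config N → ℂ, AEStronglyMeasurable F volume →
      ∫ q, F q = ∫ zx : Config (N - k) × Config k, F (joinConfig N k zx.2 zx.1) := fun F hF => by
    rw [← (measurePreserving_joinConfig h).map_eq] at hF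
    rw [← integral_map (measurePreserving_joinConfig h).aemeasurable hF,
      (measurePreserving_joinConfig h).map_eq]
  rw [inner_torusBasis, mFourierCoeff, mFourierCoeff]
  have hint : Integrable (fun zx : Config (N - k) × Config k =>
      mFourier (-p) zx.1 * (mFourier (-m) zx.2 * ψ (joinConfig N k zx.2 zx.1))) volume := by
    refine (integrable_joinConfig h ψ m).bdd_mul (c := 1) ?_ ?_
    · exact ((mFourier (-p)).continuous.comp continuous_fst).aestronglyMeasurable
    · exact Eventually.of_forall fun zx => ((mFourier (-p)).norm_coe_le_norm _).trans
        mFourier_norm.le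
  rw [hgen]
  · have h1 : ∀ zx : Config (N - k) × Config k,
        mFourier (-joinEquiv h ℤ (m, p)) (joinConfig N k zx.2 zx.1) • ψ (joinConfig N k zx.2 zx.1)
        = mFourier (-p) zx.1 * (mFourier (-m) zx.2 * ψ (joinConfig N k zx.2 zx.1)) := by
      intro zx
      rw [mFourier_neg, mFourier_joinEquiv, map_mul, ← mFourier_neg, ← mFourier_neg, smul_eq_mul]
      ring
    simp_rw [h1]
    refine Eq.trans ?_ (integral_prod _ hint).symm
    refine integral_congr_ae ?_
    filter_upwards [ae_inner_slice h ψ m] with z hz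
    rw [hz, smul_eq_mul, ← integral_const_mul]
  · exact (mFourier _).continuous.aestronglyMeasurable.smul (Lp.aestronglyMeasurable ψ)

/-- The matrix elements of the marginal in the Fourier basis. -/
theorem hasSum_marginal (m n : Fin k × Fin 3 → ℤ) :
    HasSum (fun p : Fin (N - k) × Fin 3 → ℤ =>
      starRingEnd ℂ (inner ℂ (torusBasis N (joinEquiv h ℤ (n, p))) ψ)
        * inner ℂ (torusBasis N (joinEquiv h ℤ (m, p))) ψ)
      (inner ℂ (torusBasis k m) (marginal k ψ (torusBasis k n))) := by
  set f := (memLp_inner_slice h ψ m).toLp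
  set g := (memLp_inner_slice h ψ n).toLp
  have hf := (memLp_inner_slice h ψ m).coeFn_toLp
  have hg := (memLp_inner_slice h ψ n).coeFn_toLp
  have h1 := hasSum_prod_mFourierCoeff g f
  have hfc : ∀ p, mFourierCoeff f p = inner ℂ (torusBasis N (joinEquiv h ℤ (m, p))) ψ := fun p => by
    rw [← mFourierCoeff_inner_slice]
    exact integral_congr_ae (hf.mono fun z hz => by simp only [f, hz])
  have hgc : ∀ p, mFourierCoeff g p = inner ℂ (torusBasis N (joinEquiv h ℤ (n, p))) ψ := fun p => by
    rw [← mFourierCoeff_inner_slice]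
    exact integral_congr_ae (hg.mono fun z hz => by simp only [g, hz])
  simp only [hfc, hgc] at h1
  convert h1 using 1
  rw [inner_marginal h]
  refine integral_congr_ae ?_
  filter_upwards [hf, hg] with z hz1 hz2
  simp only [f, g, hz1, hz2]
  rw [inner_conj_symm, mul_comm]

theorem isPositive_marginal : (marginal k ψ).IsPositive := by
  rw [ContinuousLinearMap.isPositive_def']
  refine ⟨?_, fun x => ?_⟩
  · rw [ContinuousLinearMap.isSelfAdjoint_iff_isSymmetric]
    intro x y
    change inner ℂ (marginal k ψ x) y = inner ℂ x (marginal k ψ y)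
    rw [← inner_conj_symm, inner_marginal h, inner_marginal h, ← integral_conj]
    refine integral_congr_ae (Eventually.of_forall fun z => ?_)
    simp only [map_mul, inner_conj_symm]
    rw [mul_comm]
  · rw [ContinuousLinearMap.reApplyInnerSelf_apply, ← inner_re_symm, inner_marginal h]
    have : ∀ z : Config (N - k), inner ℂ x (slice k ψ z) * inner ℂ (slice k ψ z) x
        = ((‖inner ℂ x (slice k ψ z)‖ ^ 2 : ℝ) : ℂ) := fun z => by
      rw [← inner_conj_symm (slice k ψ z) x, Complex.mul_conj, Complex.normSq_eq_norm_sq]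
    simp_rw [this]
    rw [integral_complex_ofReal]
    exact integral_nonneg fun z => sq_nonneg _

theorem hasSum_marginal_diag (m : Fin k × Fin 3 → ℤ) :
    HasSum (fun p : Fin (N - k) × Fin 3 → ℤ =>
      ‖inner ℂ (torusBasis N (joinEquiv h ℤ (m, p))) ψ‖ ^ 2)
      (inner ℂ (torusBasis k m) (marginal k ψ (torusBasis k m))).re := by
  refine (Complex.hasSum_re (hasSum_marginal h ψ m m)).congr_fun fun p => ?_
  rw [mul_comm, Complex.mul_conj, Complex.normSq_eq_norm_sq, Complex.ofReal_re]

theorem hasSum_norm_sq_join : HasSum (fun mp : (Fin k × Fin 3 → ℤ) × (Fin (N - k) × Fin 3 → ℤ) =>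
      ‖inner ℂ (torusBasis N (joinEquiv h ℤ mp)) ψ‖ ^ 2) (‖ψ‖ ^ 2) :=
  (joinEquiv h ℤ).hasSum_iff.2 ((torusBasis N).hasSum_norm_sq ψ)

theorem hasSum_trace_marginal : HasSum (fun m : Fin k × Fin 3 → ℤ =>
    (inner ℂ (torusBasis k m) (marginal k ψ (torusBasis k m))).re) (‖ψ‖ ^ 2) :=
  (hasSum_norm_sq_join h ψ).prod_fiberwise fun m => hasSum_marginal_diag h ψ m

theorem isSubdensity_marginal (hψ : ‖ψ‖ ≤ 1) : IsSubdensity (torusBasis k) (marginal k ψ) := by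
  refine ⟨isPositive_marginal h ψ, fun s => ?_⟩
  refine (sum_le_hasSum s (fun m _ => ?_) (hasSum_trace_marginal h ψ)).trans
    (pow_le_one₀ (norm_nonneg _) hψ)
  exact (isPositive_marginal h ψ).re_inner_nonneg_right _

/-- `Tr S γ S` in Fourier variables. -/
theorem kineticTrace_marginal : kineticTrace (marginal k ψ)
    = ∑' mp : (Fin k × Fin 3 → ℤ) × (Fin (N - k) × Fin 3 → ℤ),
      ENNReal.ofReal (sobolevWeight mp.1 ^ 2
        * ‖inner ℂ (torusBasis N (joinEquiv h ℤ mp)) ψ‖ ^ 2) := by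
  rw [ENNReal.tsum_prod', kineticTrace]
  refine tsum_congr fun m => ?_
  have h1 := (hasSum_marginal_diag h ψ m).mul_left (sobolevWeight m ^ 2)
  have h2 : (inner ℂ ((sobolevWeight m : ℂ) • torusBasis k m)
      (marginal k ψ ((sobolevWeight m : ℂ) • torusBasis k m))).re
      = sobolevWeight m ^ 2 * (inner ℂ (torusBasis k m) (marginal k ψ (torusBasis k m))).re := by
    rw [map_smul, inner_smul_left, inner_smul_right, Complex.conj_ofReal, Complex.re_ofReal_mul,
      Complex.re_ofReal_mul]
    ring
  rw [h2, ← h1.tsum_eq, ENNReal.ofReal_tsum_of_nonneg (fun _ => by positivity) h1.summable]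

end Slice

end Marginals

/-! ### Multiplication operators -/

noncomputable section Multiplication

instance : Measure.IsAddHaarMeasure (volume : Measure UnitAddCircle) :=
  inferInstanceAs (Measure.IsAddHaarMeasure AddCircle.haarAddCircle)

instance (n : ℕ) : Measure.IsAddHaarMeasure (volume : Measure (Config n)) :=
  inferInstanceAs (Measure.IsAddHaarMeasure (Measure.pi fun _ => volume))

/-- A Schur test for quadratic forms. -/
theorem norm_inner_le_of_schur {ι H : Type*} [NormedAddCommGroup H] [InnerProductSpace ℂ H]
    [CompleteSpace H] (b : HilbertBasis ι ℂ H) (A : H →L[ℂ] H) (f : H) {Q : Set ι}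
    (hf : ∀ q, q ∉ Q → inner ℂ (b q) f = 0) {κ : ι → ι → ℝ} {wt : ι → ℝ} {M B : ℝ}
    (hw : ∀ q, 0 < wt q) (hM0 : 0 ≤ M)
    (hκ : ∀ q ∈ Q, ∀ q' ∈ Q, ‖inner ℂ (b q) (A (b q'))‖ ≤ κ q q') (hκs : ∀ q q', κ q q' = κ q' q)
    (hM : ∀ q ∈ Q, ∀ S : Finset ι, (∀ q' ∈ S, q' ∈ Q) → ∑ q' ∈ S, κ q q' * (wt q')⁻¹ ≤ M)
    (hB : ∀ S : Finset ι, ∑ q ∈ S, wt q * ‖inner ℂ (b q) f‖ ^ 2 ≤ B) :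
    ‖inner ℂ f (A f)‖ ≤ M * B := by
  classical
  -- The form is continuous because `A` is bounded, so it suffices to treat finite truncations of
  -- `f`, with no double series to justify.
  have hlim : Tendsto (fun F => ‖inner ℂ (finProj b F f) (A (finProj b F f))‖) atTop
      (𝓝 ‖inner ℂ f (A f)‖) :=
    ((tendsto_finProj b f).inner ((A.continuous.tendsto f).comp (tendsto_finProj b f))).norm
  refine le_of_tendsto hlim (Eventually.of_forall fun F => ?_)
  set c : ι → ℂ := fun q => inner ℂ (b q) f with hc
  set S := F.filter (· ∈ Q) with hS
  have hSQ : ∀ q ∈ S, q ∈ Q := fun q hq => (Finset.mem_filter.1 hq).2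
  have e1 : finProj b F f = ∑ q ∈ S, c q • b q := by
    rw [finProj_apply, hS, Finset.sum_filter]
    refine Finset.sum_congr rfl fun q _ => ?_
    split_ifs with h
    · rfl
    · rw [hf q h, zero_smul]
  have e2 : inner ℂ (finProj b F f) (A (finProj b F f))
      = ∑ q ∈ S, ∑ q' ∈ S, starRingEnd ℂ (c q) * (c q' * inner ℂ (b q) (A (b q'))) := by
    rw [e1, map_sum, sum_inner]
    refine Finset.sum_congr rfl fun q _ => ?_
    rw [inner_sum]
    refine Finset.sum_congr rfl fun q' _ => ?_
    rw [map_smul, inner_smul_left, inner_smul_right]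
  have h1 : ∀ q ∈ S, ∀ q' ∈ S, ‖starRingEnd ℂ (c q) * (c q' * inner ℂ (b q) (A (b q')))‖
      ≤ (wt q * ‖c q‖ ^ 2 * (κ q q' * (wt q')⁻¹)
        + wt q' * ‖c q'‖ ^ 2 * (κ q' q * (wt q)⁻¹)) / 2 := by
    intro q hq q' hq'
    have h2 := hκ q (hSQ q hq) q' (hSQ q' hq')
    have hk0 : 0 ≤ κ q q' := (norm_nonneg _).trans h2
    rw [hκs q' q, norm_mul, norm_mul, RCLike.norm_conj]
    -- Arithmetic–geometric mean with weights `wt q / wt q'` and its inverse. After summation the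
    -- two halves agree by the symmetry of `κ`.
    have h3 : 2 * (‖c q‖ * ‖c q'‖) ≤ wt q * ‖c q‖ ^ 2 * (wt q')⁻¹
        + wt q' * ‖c q'‖ ^ 2 * (wt q)⁻¹ := by
      have hp := hw q
      have hp' := hw q'
      have h4 : wt q * ‖c q‖ ^ 2 * (wt q')⁻¹ + wt q' * ‖c q'‖ ^ 2 * (wt q)⁻¹ - 2 * (‖c q‖ * ‖c q'‖)
          = (wt q * ‖c q‖ - wt q' * ‖c q'‖) ^ 2 * (wt q)⁻¹ * (wt q')⁻¹ := by
        field_simp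
        ring
      have h5 : 0 ≤ (wt q * ‖c q‖ - wt q' * ‖c q'‖) ^ 2 * (wt q)⁻¹ * (wt q')⁻¹ := by positivity
      linarith
    calc ‖c q‖ * (‖c q'‖ * ‖inner ℂ (b q) (A (b q'))‖)
        = (‖c q‖ * ‖c q'‖) * ‖inner ℂ (b q) (A (b q'))‖ := by ring
      _ ≤ ((wt q * ‖c q‖ ^ 2 * (wt q')⁻¹ + wt q' * ‖c q'‖ ^ 2 * (wt q)⁻¹) / 2) * κ q q' :=
          mul_le_mul (by linarith) h2 (norm_nonneg _)
            (by have := hw q; have := hw q'; positivity)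
      _ = _ := by ring
  have h2 : ∑ q ∈ S, ∑ q' ∈ S, wt q * ‖c q‖ ^ 2 * (κ q q' * (wt q')⁻¹) ≤ M * B := by
    calc _ = ∑ q ∈ S, wt q * ‖c q‖ ^ 2 * ∑ q' ∈ S, κ q q' * (wt q')⁻¹ := by
          simp_rw [Finset.mul_sum]
      _ ≤ ∑ q ∈ S, wt q * ‖c q‖ ^ 2 * M := by
          refine Finset.sum_le_sum fun q hq => ?_
          exact mul_le_mul_of_nonneg_left (hM q (hSQ q hq) S hSQ)
            (mul_nonneg (hw q).le (sq_nonneg _))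
      _ = M * ∑ q ∈ S, wt q * ‖c q‖ ^ 2 := by rw [← Finset.sum_mul, mul_comm]
      _ ≤ M * B := mul_le_mul_of_nonneg_left (hB S) hM0
  have h3 : ∑ q ∈ S, ∑ q' ∈ S, wt q' * ‖c q'‖ ^ 2 * (κ q' q * (wt q)⁻¹)
      = ∑ q ∈ S, ∑ q' ∈ S, wt q * ‖c q‖ ^ 2 * (κ q q' * (wt q')⁻¹) := Finset.sum_comm
  calc _ ≤ ∑ q ∈ S, ∑ q' ∈ S, (wt q * ‖c q‖ ^ 2 * (κ q q' * (wt q')⁻¹)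
        + wt q' * ‖c q'‖ ^ 2 * (κ q' q * (wt q)⁻¹)) / 2 := by
        rw [e2]
        refine (norm_sum_le _ _).trans (Finset.sum_le_sum fun q hq => ?_)
        exact (norm_sum_le _ _).trans (Finset.sum_le_sum fun q' hq' => h1 q hq q' hq')
    _ ≤ M * B := by
        simp_rw [← Finset.sum_div, Finset.sum_add_distrib, h3]
        linarith

variable {n : ℕ}

/-- Multiplication by a bounded function. -/
def mulOp (g : Config n → ℂ) (hg : MemLp g ∞ volume) : L2 n →L[ℂ] L2 n :=
  (ContinuousLinearMap.mul ℂ ℂ).holderL volume ∞ 2 2 hg.toLp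

variable {g : Config n → ℂ} (hg : MemLp g ∞ volume)

theorem coeFn_mulOp (f : L2 n) : mulOp g hg f =ᵐ[volume] fun x => g x * f x := by
  refine (ContinuousLinearMap.coeFn_holder _ _ _).trans ?_
  filter_upwards [hg.coeFn_toLp] with x hx
  rw [hx]
  rfl

theorem integrable_mulOp {g : Config n → ℂ} (hg : MemLp g ∞ volume) (f h : L2 n) :
    Integrable (fun x => starRingEnd ℂ (f x) * (g x * h x)) volume := by
  refine (L2.integrable_inner (𝕜 := ℂ) f (mulOp g hg h)).congr ?_
  filter_upwards [coeFn_mulOp hg h] with x hx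
  rw [hx, RCLike.inner_apply, mul_comm]

theorem inner_mulOp (f h : L2 n) :
    inner ℂ f (mulOp g hg h) = ∫ x, starRingEnd ℂ (f x) * (g x * h x) := by
  rw [L2.inner_def]
  refine integral_congr_ae ?_
  filter_upwards [coeFn_mulOp hg h] with x hx
  rw [hx, RCLike.inner_apply, mul_comm]

theorem mulOp_comm {g' : Config n → ℂ} (hg' : MemLp g' ∞ volume) (f : L2 n) :
    mulOp g hg (mulOp g' hg' f) = mulOp g' hg' (mulOp g hg f) := by
  apply Lp.ext
  filter_upwards [coeFn_mulOp hg (mulOp g' hg' f), coeFn_mulOp hg' f, coeFn_mulOp hg f,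
    coeFn_mulOp hg' (mulOp g hg f)] with x h1 h2 h3 h4
  rw [h1, h2, h4, h3]
  ring

theorem inner_torusBasis_mulOp_torusBasis (q q' : Fin n × Fin 3 → ℤ) :
    inner ℂ (torusBasis n q) (mulOp g hg (torusBasis n q')) = mFourierCoeff g (q - q') := by
  rw [inner_torusBasis]
  refine integral_congr_ae ?_
  have h1 := coeFn_mFourierLp (d := Fin n × Fin 3) 2 q'
  rw [← coe_mFourierBasis] at h1
  filter_upwards [coeFn_mulOp hg (torusBasis n q'), h1] with x hx h1
  rw [hx, h1, show -(q - q') = -q + q' by abel, mFourier_add, smul_eq_mul, smul_eq_mul]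
  ring

/-- Multiplication by the Fourier monomial `e_r`. -/
def shiftOp (r : Fin n × Fin 3 → ℤ) : L2 n →L[ℂ] L2 n :=
  mulOp (mFourier r) (memLp_top_of_bound (mFourier r).continuous.aestronglyMeasurable 1
    (Eventually.of_forall fun x => ((mFourier r).norm_coe_le_norm x).trans mFourier_norm.le))

theorem inner_torusBasis_shiftOp (q r : Fin n × Fin 3 → ℤ) (f : L2 n) :
    inner ℂ (torusBasis n q) (shiftOp r f) = inner ℂ (torusBasis n (q - r)) f := by
  rw [inner_torusBasis, inner_torusBasis]
  refine integral_congr_ae ?_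
  filter_upwards [coeFn_mulOp (memLp_top_of_bound (mFourier r).continuous.aestronglyMeasurable 1
    (Eventually.of_forall fun x => ((mFourier r).norm_coe_le_norm x).trans mFourier_norm.le)) f]
    with x hx
  rw [shiftOp, hx, show -(q - r) = -q + r by abel, mFourier_add, smul_eq_mul, smul_eq_mul]
  ring

theorem inner_shiftOp_shiftOp (r : Fin n × Fin 3 → ℤ) (f h : L2 n) :
    inner ℂ (shiftOp r f) (shiftOp r h) = inner ℂ f h := by
  refine ((torusBasis n).hasSum_conj_mul _ _).unique ?_
  have h1 := (Equiv.subRight r).hasSum_iff.2 ((torusBasis n).hasSum_conj_mul f h)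
  refine h1.congr_fun fun q => ?_
  rw [inner_torusBasis_shiftOp, inner_torusBasis_shiftOp]
  rfl

section RealPotential

variable {v w : Config n → ℝ} (hv : MemLp (fun x => (v x : ℂ)) ∞ volume)

theorem inner_potential_left (f h : L2 n) :
    inner ℂ (mulOp _ hv f) h = inner ℂ f (mulOp _ hv h) := by
  rw [← inner_conj_symm, inner_mulOp, inner_mulOp, ← integral_conj]
  refine integral_congr_ae (Eventually.of_forall fun x => ?_)
  simp only [map_mul, Complex.conj_conj, Complex.conj_ofReal]
  ring

theorem integrable_potential {v : Config n → ℝ} (hv : MemLp (fun x => (v x : ℂ)) ∞ volume)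
    (f : L2 n) : Integrable (fun x => v x * ‖f x‖ ^ 2) volume := by
  refine (integrable_mulOp hv f f).re.congr (Eventually.of_forall fun x => ?_)
  change (starRingEnd ℂ (f x) * (v x * f x)).re = _
  rw [mul_left_comm, ← Complex.normSq_eq_conj_mul_self, ← Complex.ofReal_mul, Complex.ofReal_re,
    Complex.normSq_eq_norm_sq]

theorem inner_potential_self (f : L2 n) :
    inner ℂ f (mulOp _ hv f) = ((∫ x, v x * ‖f x‖ ^ 2 : ℝ) : ℂ) := by
  rw [inner_mulOp, ← integral_complex_ofReal]
  refine integral_congr_ae (Eventually.of_forall fun x => ?_)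
  change starRingEnd ℂ (f x) * (v x * f x) = _
  rw [mul_left_comm, ← Complex.normSq_eq_conj_mul_self, ← Complex.ofReal_mul,
    Complex.normSq_eq_norm_sq]

theorem norm_inner_potential_le (hv0 : ∀ x, 0 ≤ v x) (f h : L2 n) :
    ‖inner ℂ f (mulOp _ hv h)‖
      ≤ ((∫ x, v x * ‖f x‖ ^ 2) + ∫ x, v x * ‖h x‖ ^ 2) / 2 := by
  rw [inner_mulOp, ← integral_add (integrable_potential hv f) (integrable_potential hv h),
    ← integral_div]
  refine norm_integral_le_of_norm_le
    (((integrable_potential hv f).add (integrable_potential hv h)).div_const 2)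
    (Eventually.of_forall fun x => ?_)
  rw [norm_mul, norm_mul, RCLike.norm_conj, Complex.norm_real, Real.norm_of_nonneg (hv0 x)]
  nlinarith [mul_nonneg (hv0 x) (sq_nonneg (‖f x‖ - ‖h x‖))]

/-- The Fourier coefficients of a nonnegative function are bounded by its integral. -/
theorem norm_mFourierCoeff_le (hv0 : ∀ x, 0 ≤ v x) (hv : Integrable v volume)
    (q : Fin n × Fin 3 → ℤ) : ‖mFourierCoeff (fun x => (v x : ℂ)) q‖ ≤ ∫ x, v x := by
  refine norm_integral_le_of_norm_le hv (Eventually.of_forall fun x => ?_)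
  rw [norm_smul, Complex.norm_real, Real.norm_of_nonneg (hv0 x)]
  exact mul_le_of_le_one_left (hv0 x) (((mFourier (-q)).norm_coe_le_norm x).trans mFourier_norm.le)

end RealPotential

/-- The Fourier coefficients of a function invariant under translations by `h` vanish at
the frequencies which do not annihilate `h`. -/
theorem mFourierCoeff_eq_zero_of_invariant {g : Config n → ℂ} (h : Config n)
    (hinv : ∀ x, g (x + h) = g x) {q : Fin n × Fin 3 → ℤ} (hq : mFourier q h ≠ 1) :
    mFourierCoeff g q = 0 := by
  have hadd : ∀ x, mFourier (-q) (x + h) = mFourier (-q) x * mFourier (-q) h := fun x => by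
    simp only [mFourier, ContinuousMap.coe_mk, Pi.add_apply, fourier_apply, smul_add,
      AddCircle.toCircle_add, Circle.coe_mul, Finset.prod_mul_distrib]
  -- Translating the variable by `h` leaves `g` and Haar measure unchanged and multiplies the
  -- character by `e_{-q}(h)`.
  have h1 : mFourierCoeff g q = mFourier (-q) h * mFourierCoeff g q := by
    conv_lhs => rw [mFourierCoeff, ← integral_add_right_eq_self _ h]
    rw [mFourierCoeff, ← integral_const_mul]
    refine integral_congr_ae (Eventually.of_forall fun x => ?_)
    simp only [hadd, hinv, smul_eq_mul]
    ring
  have h2 : (mFourier (-q) h - 1) * mFourierCoeff g q = 0 := by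
    rw [sub_mul, one_mul, ← h1, sub_self]
  refine (mul_eq_zero.1 h2).resolve_left fun h3 => hq ?_
  rw [sub_eq_zero, mFourier_neg] at h3
  simpa using congrArg (starRingEnd ℂ) h3

end Multiplication

/-! ### The scaled potential -/

noncomputable section Potential

/-- A unit cube as a fundamental domain for integer translations. -/
theorem lintegral_cube_tsum_le {g : (Fin 3 → ℝ) → ℝ≥0∞} (hg : Measurable g) :
    ∫⁻ x in {x : Fin 3 → ℝ | ∀ i, x i ∈ Ioc (0 : ℝ) (0 + 1)},
      ∑' q : Fin 3 → ℤ, g (x + fun a => (q a : ℝ)) ≤ ∫⁻ x, g x := by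
  set I : Set (Fin 3 → ℝ) := {x : Fin 3 → ℝ | ∀ i, x i ∈ Ioc (0 : ℝ) (0 + 1)} with hI
  have hIm : MeasurableSet I := MeasurableSet.univ_pi' fun i => measurableSet_Ioc
  set D : (Fin 3 → ℤ) → Set (Fin 3 → ℝ) := fun q => (fun x => x - fun a => (q a : ℝ)) ⁻¹' I with hD
  have hDm : ∀ q, MeasurableSet (D q) := fun q => (measurable_id.sub_const _) hIm
  have hdisj : Pairwise (Function.onFun Disjoint D) := by
    intro q q' hne
    rw [Function.onFun, Set.disjoint_left]
    intro x hx hx'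
    refine hne (funext fun a => ?_)
    have h1 := hx a
    have h2 := hx' a
    simp only [Pi.sub_apply, mem_Ioc, zero_add] at h1 h2
    have h3 : (q a : ℝ) < q' a + 1 := by linarith
    have h4 : (q' a : ℝ) < q a + 1 := by linarith
    have h5 : q a < q' a + 1 := by exact_mod_cast h3
    have h6 : q' a < q a + 1 := by exact_mod_cast h4
    omega
  have hgm : ∀ q : Fin 3 → ℤ, AEMeasurable (fun x : Fin 3 → ℝ => g (x + fun a => (q a : ℝ)))
      (volume.restrict I) := fun q => (hg.comp (measurable_id.add_const _)).aemeasurable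
  rw [lintegral_tsum hgm]
  have h1 : ∀ q : Fin 3 → ℤ, ∫⁻ x in I, g (x + fun a => (q a : ℝ)) = ∫⁻ x in D q, g x := by
    intro q
    rw [← lintegral_indicator hIm, ← lintegral_indicator (hDm q),
      ← lintegral_add_right_eq_self ((D q).indicator g) (fun a => (q a : ℝ))]
    refine lintegral_congr fun x => ?_
    by_cases hx : x ∈ I
    · have : (x + fun a => (q a : ℝ)) ∈ D q := by simpa [hD] using hx
      rw [indicator_of_mem hx, indicator_of_mem this]
    · have : (x + fun a => (q a : ℝ)) ∉ D q := by simpa [hD] using hx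
      rw [indicator_of_notMem hx, indicator_of_notMem this]
  simp_rw [h1]
  rw [← lintegral_iUnion hDm hdisj]
  exact setLIntegral_le_lintegral _ _

theorem lintegral_comp_smul_fin_three {g : (Fin 3 → ℝ) → ℝ≥0∞} (hg : Measurable g) {s : ℝ}
    (hs : 0 < s) : ∫⁻ x, g (s • x) = ENNReal.ofReal ((s ^ 3)⁻¹) * ∫⁻ x, g x := by
  have h := Measure.map_addHaar_smul (volume : Measure (Fin 3 → ℝ)) hs.ne'
  rw [← lintegral_map hg (measurable_const_smul s), h, lintegral_smul_measure, smul_eq_mul,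
    abs_of_nonneg (by positivity)]
  simp

variable {V : (Fin 3 → ℝ) → (Fin 3 → ℝ) → ℝ}

theorem exists_support_bound (hV_supp : HasCompactSupport (Function.uncurry V)) :
    ∃ M : ℤ, ∀ x y, V x y ≠ 0 → (∀ a, |x a| ≤ M) ∧ ∀ a, |y a| ≤ M := by
  obtain ⟨R, hR⟩ := hV_supp.isBounded.exists_norm_le
  refine ⟨⌈R⌉, fun x y hxy => ?_⟩
  have h1 := (hR (x, y) (subset_tsupport _ hxy)).trans (Int.le_ceil R)
  rw [Prod.norm_def, max_le_iff] at h1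
  exact ⟨fun a => (norm_le_pi_norm x a).trans h1.1, fun a => (norm_le_pi_norm y a).trans h1.2⟩

variable {β : ℝ} {N : ℕ}

theorem one_le_natCast_rpow (hβ : 0 < β) (hN : 1 ≤ N) : (1 : ℝ) ≤ (N : ℝ) ^ β :=
  Real.one_le_rpow (by exact_mod_cast hN) hβ.le

theorem torusRep_mem (x : UnitAddTorus (Fin 3)) (a : Fin 3) : torusRep x a ∈ Ico (0 : ℝ) 1 := by
  have := (AddCircle.equivIco 1 0 (x a)).2
  simpa [torusRep] using this

/-- Only boundedly many lattice translates contribute to the periodization. -/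
theorem exists_box (hV_supp : HasCompactSupport (Function.uncurry V)) :
    ∃ B : Finset ((Fin 3 → ℤ) × (Fin 3 → ℤ)), ∀ (β : ℝ) (N : ℕ), 0 < β → 1 ≤ N → ∀ q, q ∉ B →
      ∀ x y : UnitAddTorus (Fin 3), V (fun a => (N : ℝ) ^ β * (torusRep x a + q.1 a))
        (fun a => (N : ℝ) ^ β * (torusRep y a + q.2 a)) = 0 := by
  obtain ⟨M, hM⟩ := exists_support_bound hV_supp
  -- Since `N ^ β ≥ 1`, the unscaled point `r + m` already has size at most `M`; as `r ∈ [0, 1)`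
  -- this leaves `-M - 1 ≤ m ≤ M`, whatever `β` and `N`.
  refine ⟨Finset.Icc (fun _ => -M - 1) (fun _ => M) ×ˢ Finset.Icc (fun _ => -M - 1) (fun _ => M),
    fun β N hβ hN q hq x y => ?_⟩
  by_contra hne
  have hs := one_le_natCast_rpow hβ hN
  obtain ⟨h1, h2⟩ := hM _ _ hne
  have key : ∀ (r : ℝ) (m : ℤ), r ∈ Ico (0 : ℝ) 1 → |(N : ℝ) ^ β * (r + m)| ≤ M →
      -M - 1 ≤ m ∧ m ≤ M := by
    intro r m hr h
    rw [abs_mul, abs_of_nonneg (by linarith)] at h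
    have h3 : |r + m| ≤ M := le_trans (le_mul_of_one_le_left (abs_nonneg _) hs) h
    rw [abs_le] at h3
    have h4 : ((-M - 1 : ℤ) : ℝ) ≤ m := by push_cast; linarith [hr.2, h3.1]
    have h5 : (m : ℝ) ≤ M := by linarith [hr.1, h3.2]
    exact ⟨by exact_mod_cast h4, by exact_mod_cast h5⟩
  refine hq (Finset.mem_product.2 ⟨Finset.mem_Icc.2 ⟨fun a => ?_, fun a => ?_⟩,
    Finset.mem_Icc.2 ⟨fun a => ?_, fun a => ?_⟩⟩)
  · exact (key _ _ (torusRep_mem x a) (h1 a)).1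
  · exact (key _ _ (torusRep_mem x a) (h1 a)).2
  · exact (key _ _ (torusRep_mem y a) (h2 a)).1
  · exact (key _ _ (torusRep_mem y a) (h2 a)).2

theorem measurable_torusRep : Measurable torusRep :=
  measurable_pi_lambda _ fun a =>
    measurable_subtype_coe.comp ((AddCircle.measurableEquivIco 1 0).measurable.comp
      (measurable_pi_apply a))

theorem scaledPotential_nonneg (hV_nonneg : ∀ x y, 0 ≤ V x y) (x y : UnitAddTorus (Fin 3)) :
    0 ≤ scaledPotential V β N x y :=
  tsum_nonneg fun _ => mul_nonneg (by positivity) (hV_nonneg _ _)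

theorem measurable_scaledPotential (hV : Measurable (Function.uncurry V))
    (hV_supp : HasCompactSupport (Function.uncurry V)) (hβ : 0 < β) (hN : 1 ≤ N) :
    Measurable fun p : UnitAddTorus (Fin 3) × UnitAddTorus (Fin 3) =>
      scaledPotential V β N p.1 p.2 := by
  obtain ⟨B, hB⟩ := exists_box hV_supp
  have : (fun p : UnitAddTorus (Fin 3) × UnitAddTorus (Fin 3) => scaledPotential V β N p.1 p.2)
      = fun p => ∑ q ∈ B, (N : ℝ) ^ (6 * β) *
        V (fun a => (N : ℝ) ^ β * (torusRep p.1 a + q.1 a))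
          (fun a => (N : ℝ) ^ β * (torusRep p.2 a + q.2 a)) := by
    funext p
    exact tsum_eq_sum fun q hq => by rw [hB β N hβ hN q hq, mul_zero]
  rw [this]
  refine Finset.measurable_sum _ fun q _ => Measurable.const_mul ?_ _
  have hm : Measurable fun p : UnitAddTorus (Fin 3) × UnitAddTorus (Fin 3) =>
      ((fun a => (N : ℝ) ^ β * (torusRep p.1 a + q.1 a) : Fin 3 → ℝ),
        (fun a => (N : ℝ) ^ β * (torusRep p.2 a + q.2 a) : Fin 3 → ℝ)) := by
    refine Measurable.prodMk (measurable_pi_lambda _ fun a => ?_)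
      (measurable_pi_lambda _ fun a => ?_)
    · exact (((measurable_pi_apply a).comp (measurable_torusRep.comp measurable_fst)).add_const
        _).const_mul _
    · exact (((measurable_pi_apply a).comp (measurable_torusRep.comp measurable_snd)).add_const
        _).const_mul _
  exact hV.comp hm

theorem exists_scaledPotential_le (hV : Continuous (Function.uncurry V))
    (hV_supp : HasCompactSupport (Function.uncurry V))
    (hβ : 0 < β) (hN : 1 ≤ N) : ∃ K : ℝ, ∀ x y, scaledPotential V β N x y ≤ K := by
  obtain ⟨B, hB⟩ := exists_box hV_supp
  obtain ⟨K, hK⟩ := hV.bounded_above_of_compact_support hV_supp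
  refine ⟨∑ _q ∈ B, (N : ℝ) ^ (6 * β) * K, fun x y => ?_⟩
  rw [scaledPotential, tsum_eq_sum (s := B) fun q hq => by rw [hB β N hβ hN q hq, mul_zero]]
  refine Finset.sum_le_sum fun q _ => mul_le_mul_of_nonneg_left ?_ (by positivity)
  exact (le_abs_self _).trans (hK (_, _))

theorem ofReal_scaledPotential (hV_supp : HasCompactSupport (Function.uncurry V))
    (hV_nonneg : ∀ x y, 0 ≤ V x y) (hβ : 0 < β) (hN : 1 ≤ N) (x y : UnitAddTorus (Fin 3)) :
    ENNReal.ofReal (scaledPotential V β N x y)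
      = ∑' q : (Fin 3 → ℤ) × (Fin 3 → ℤ), ENNReal.ofReal ((N : ℝ) ^ (6 * β) *
        V (fun a => (N : ℝ) ^ β * (torusRep x a + q.1 a))
          (fun a => (N : ℝ) ^ β * (torusRep y a + q.2 a))) := by
  obtain ⟨B, hB⟩ := exists_box hV_supp
  refine ENNReal.ofReal_tsum_of_nonneg (fun q => mul_nonneg (by positivity) (hV_nonneg _ _)) ?_
  exact summable_of_ne_finset_zero (s := B) fun q hq => by rw [hB β N hβ hN q hq, mul_zero]

/-- The periodization does not depend on the choice of representatives. -/
theorem ofReal_scaledPotential_coe (hV_supp : HasCompactSupport (Function.uncurry V))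
    (hV_nonneg : ∀ x y, 0 ≤ V x y) (hβ : 0 < β) (hN : 1 ≤ N) (x y : Fin 3 → ℝ) :
    ENNReal.ofReal (scaledPotential V β N (fun a => (x a : UnitAddCircle))
        (fun a => (y a : UnitAddCircle)))
      = ∑' (q : Fin 3 → ℤ) (r : Fin 3 → ℤ), ENNReal.ofReal ((N : ℝ) ^ (6 * β) *
        V ((N : ℝ) ^ β • (x + fun a => (q a : ℝ))) ((N : ℝ) ^ β • (y + fun a => (r a : ℝ)))) := by
  rw [ofReal_scaledPotential hV_supp hV_nonneg hβ hN, ENNReal.tsum_prod']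
  have hrep : ∀ (x : Fin 3 → ℝ) (a : Fin 3),
      torusRep (fun a => (x a : UnitAddCircle)) a = x a - ⌊x a⌋ := by
    intro x a
    have h := AddCircle.coe_equivIco_mk_apply (p := (1 : ℝ)) (x a)
    rw [div_one, mul_one] at h
    exact h
  rw [← (Equiv.subRight fun a => -⌊x a⌋).tsum_eq]
  refine tsum_congr fun q => ?_
  rw [← (Equiv.subRight fun a => -⌊y a⌋).tsum_eq]
  refine tsum_congr fun r => ?_
  congr 3 <;>
  · funext a
    simp only [hrep, Equiv.subRight_apply, Pi.sub_apply, sub_neg_eq_add, Pi.smul_apply,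
      Pi.add_apply, smul_eq_mul]
    push_cast
    ring

/-- The integral `∫∫ V` over `ℝ³ × ℝ³`. -/
def potentialMass (V : (Fin 3 → ℝ) → (Fin 3 → ℝ) → ℝ) : ℝ≥0∞ :=
  ∫⁻ x, ∫⁻ y, ENNReal.ofReal (V x y)

theorem potentialMass_lt_top (hV : Continuous (Function.uncurry V))
    (hV_supp : HasCompactSupport (Function.uncurry V)) : potentialMass V < ⊤ := by
  have h1 := (hV.integrable_of_hasCompactSupport hV_supp (μ := volume)).lintegral_lt_top
  have h2 : potentialMass V
      = ∫⁻ p : (Fin 3 → ℝ) × (Fin 3 → ℝ), ENNReal.ofReal (Function.uncurry V p) :=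
    (lintegral_prod _ (hV.measurable.ennreal_ofReal.aemeasurable)).symm
  rw [h2]
  exact h1

/-- Unfolding the periodization turns the integral over the torus into one over `ℝ³ × ℝ³`, where the
scaling preserves the mass. The bound is therefore uniform in `N`. -/
theorem lintegral_scaledPotential_le (hV : Measurable (Function.uncurry V))
    (hV_supp : HasCompactSupport (Function.uncurry V)) (hV_nonneg : ∀ x y, 0 ≤ V x y)
    (hβ : 0 < β) (hN : 1 ≤ N) :
    ∫⁻ p : UnitAddTorus (Fin 3) × UnitAddTorus (Fin 3),
      ENNReal.ofReal (scaledPotential V β N p.1 p.2) ≤ potentialMass V := by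
  set s : ℝ := (N : ℝ) ^ β with hs
  have hs0 : 0 < s := lt_of_lt_of_le one_pos (one_le_natCast_rpow hβ hN)
  have hs6 : (N : ℝ) ^ (6 * β) = s ^ 6 := by
    rw [hs, mul_comm, Real.rpow_mul (by positivity)]
    norm_cast
  set G : (Fin 3 → ℝ) → (Fin 3 → ℝ) → ℝ≥0∞ := fun x y =>
    ENNReal.ofReal (s ^ 6 * V (s • x) (s • y)) with hG
  have hGm : Measurable (Function.uncurry G) := by
    have hm : Measurable fun p : (Fin 3 → ℝ) × (Fin 3 → ℝ) => (s • p.1, s • p.2) :=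
      (measurable_fst.const_smul s).prodMk (measurable_snd.const_smul s)
    exact ((hV.comp hm).const_mul (s ^ 6)).ennreal_ofReal
  set I : Set (Fin 3 → ℝ) := {x : Fin 3 → ℝ | ∀ i, x i ∈ Ioc (0 : ℝ) (0 + 1)} with hI
  have hpm := (measurable_scaledPotential hV hV_supp hβ hN).ennreal_ofReal
  have h1 : ∫⁻ p : UnitAddTorus (Fin 3) × UnitAddTorus (Fin 3),
      ENNReal.ofReal (scaledPotential V β N p.1 p.2) = ∫⁻ x in I, ∫⁻ y in I,
      ∑' (q : Fin 3 → ℤ) (r : Fin 3 → ℤ), G (x + fun a => (q a : ℝ)) (y + fun a => (r a : ℝ)) := by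
    rw [Measure.volume_eq_prod, lintegral_prod _ hpm.aemeasurable,
      UnitAddTorus.lintegral_preimage _ (fun _ => 0)]
    refine lintegral_congr fun x => ?_
    rw [UnitAddTorus.lintegral_preimage _ (fun _ => 0)]
    refine lintegral_congr fun y => ?_
    rw [ofReal_scaledPotential_coe hV_supp hV_nonneg hβ hN]
    simp only [hG, hs6, hs]
  have h2 : ∀ x, ∫⁻ y in I, ∑' (q : Fin 3 → ℤ) (r : Fin 3 → ℤ),
      G (x + fun a => (q a : ℝ)) (y + fun a => (r a : ℝ))
      ≤ ∑' q : Fin 3 → ℤ, ∫⁻ y, G (x + fun a => (q a : ℝ)) y := by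
    intro x
    rw [lintegral_tsum fun q => ?_]
    · exact ENNReal.tsum_le_tsum fun q =>
        lintegral_cube_tsum_le (hGm.comp (measurable_const.prodMk measurable_id))
    · refine (Measurable.tsum fun r => ?_).aemeasurable
      exact hGm.comp (measurable_const.prodMk (measurable_id.add_const _))
  rw [h1]
  calc _ ≤ ∫⁻ x in I, ∑' q : Fin 3 → ℤ, ∫⁻ y, G (x + fun a => (q a : ℝ)) y :=
        lintegral_mono fun x => h2 x
    _ ≤ ∫⁻ x, ∫⁻ y, G x y :=
        lintegral_cube_tsum_le (g := fun x => ∫⁻ y, G x y) (Measurable.lintegral_prod_right hGm)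
    _ = potentialMass V := by
        have hVm : ∀ x, Measurable fun y => ENNReal.ofReal (V x y) := fun x =>
          (hV.comp (measurable_const.prodMk measurable_id)).ennreal_ofReal
        -- Each of the two changes of variables in `ℝ³` absorbs a factor `s ^ 3` of the prefactor `s
        -- ^ 6`.
        have h3 : ∀ x, ∫⁻ y, G x y
            = ENNReal.ofReal (s ^ 3) * ∫⁻ y, ENNReal.ofReal (V (s • x) y) := by
          intro x
          simp only [hG]
          simp_rw [ENNReal.ofReal_mul (show (0 : ℝ) ≤ s ^ 6 by positivity)]
          have he : Measurable fun y : Fin 3 → ℝ => ENNReal.ofReal (V (s • x) (s • y)) :=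
            (hVm (s • x)).comp (measurable_const_smul s)
          rw [lintegral_const_mul _ he,
            lintegral_comp_smul_fin_three (hVm (s • x)) hs0, ← mul_assoc,
            ← ENNReal.ofReal_mul (by positivity)]
          congr 2
          field_simp
        have hm : Measurable fun x => ∫⁻ y, ENNReal.ofReal (V x y) :=
          Measurable.lintegral_prod_right hV.ennreal_ofReal
        have he : Measurable fun x : Fin 3 → ℝ => ∫⁻ y, ENNReal.ofReal (V (s • x) y) :=
          hm.comp (measurable_const_smul s)
        simp_rw [h3]
        rw [lintegral_const_mul _ he, lintegral_comp_smul_fin_three hm hs0, ← mul_assoc,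
          ← ENNReal.ofReal_mul (by positivity),
          mul_inv_cancel₀ (by positivity), ENNReal.ofReal_one, one_mul]
        rfl

/-- The interaction potential of the particles `i, j, l`. -/
def triplePotential (V : (Fin 3 → ℝ) → (Fin 3 → ℝ) → ℝ) (β : ℝ) (N : ℕ) (i j l : Fin N)
    (x : Config N) : ℝ :=
  scaledPotential V β N (pos x i - pos x j) (pos x i - pos x l)

/-- The relative positions of the particles `i, j, l`. -/
def relPos {N : ℕ} (i j l : Fin N) :
    Config N →+ UnitAddTorus (Fin 3) × UnitAddTorus (Fin 3) where
  toFun x := (pos x i - pos x j, pos x i - pos x l)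
  map_zero' := by ext <;> simp [pos]
  map_add' x y := by
    ext a
    · change x (i, a) + y (i, a) - (x (j, a) + y (j, a)) =
        x (i, a) - x (j, a) + (y (i, a) - y (j, a))
      abel
    · change x (i, a) + y (i, a) - (x (l, a) + y (l, a)) =
        x (i, a) - x (l, a) + (y (i, a) - y (l, a))
      abel

theorem continuous_relPos {N : ℕ} (i j l : Fin N) : Continuous (relPos i j l) := by
  change Continuous fun x : Config N => (pos x i - pos x j, pos x i - pos x l)
  have : ∀ i : Fin N, Continuous fun x : Config N => pos x i := fun i =>
    continuous_pi fun a => continuous_apply (i, a)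
  exact ((this i).sub (this j)).prodMk ((this i).sub (this l))

/-- A continuous surjective homomorphism between compact groups carries normalized Haar measure to
normalized Haar measure. -/
theorem measurePreserving_relPos {N : ℕ} {i j l : Fin N} (hij : i ≠ j) (hil : i ≠ l)
    (hjl : j ≠ l) : MeasurePreserving (relPos i j l) volume volume := by
  have : Measure.IsAddHaarMeasure (volume : Measure (UnitAddTorus (Fin 3))) :=
    inferInstanceAs (Measure.IsAddHaarMeasure (Measure.pi fun _ => volume))
  have : Measure.IsAddHaarMeasure
      (volume : Measure (UnitAddTorus (Fin 3) × UnitAddTorus (Fin 3))) :=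
    Measure.prod.instIsAddHaarMeasure _ _
  refine AddMonoidHom.measurePreserving (continuous_relPos i j l) (fun p => ?_) (by simp)
  -- A preimage: particle `i` at the origin, `j` at `-p.1`, `l` at `-p.2`.
  refine ⟨fun q => if q.1 = j then -p.1 q.2 else if q.1 = l then -p.2 q.2 else 0, ?_⟩
  ext a <;> simp [relPos, pos, hij, hil, hjl.symm]

variable {i j l : Fin N}

theorem triplePotential_nonneg (hV_nonneg : ∀ x y, 0 ≤ V x y) (x : Config N) :
    0 ≤ triplePotential V β N i j l x :=
  scaledPotential_nonneg hV_nonneg _ _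

theorem measurable_triplePotential (hV : Measurable (Function.uncurry V))
    (hV_supp : HasCompactSupport (Function.uncurry V)) (hβ : 0 < β) (hN : 1 ≤ N) :
    Measurable (triplePotential V β N i j l) :=
  (measurable_scaledPotential hV hV_supp hβ hN).comp (continuous_relPos i j l).measurable

theorem memLp_triplePotential (hV : Continuous (Function.uncurry V))
    (hV_supp : HasCompactSupport (Function.uncurry V)) (hV_nonneg : ∀ x y, 0 ≤ V x y)
    (hβ : 0 < β) (hN : 1 ≤ N) (i j l : Fin N) :
    MemLp (fun x => (triplePotential V β N i j l x : ℂ)) ∞ volume := by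
  obtain ⟨K, hK⟩ := exists_scaledPotential_le hV hV_supp hβ hN
  refine memLp_top_of_bound (Complex.measurable_ofReal.comp
    (measurable_triplePotential hV.measurable hV_supp hβ hN)).aestronglyMeasurable K
    (Eventually.of_forall fun x => ?_)
  rw [Complex.norm_real, Real.norm_of_nonneg (triplePotential_nonneg hV_nonneg x)]
  exact hK _ _

theorem integrable_triplePotential (hV : Continuous (Function.uncurry V))
    (hV_supp : HasCompactSupport (Function.uncurry V)) (hV_nonneg : ∀ x y, 0 ≤ V x y)
    (hβ : 0 < β) (hN : 1 ≤ N) :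
    Integrable (triplePotential V β N i j l) volume :=
  ((memLp_triplePotential hV hV_supp hV_nonneg hβ hN i j l).integrable le_top).re

theorem integral_triplePotential_le (hV : Continuous (Function.uncurry V))
    (hV_supp : HasCompactSupport (Function.uncurry V)) (hV_nonneg : ∀ x y, 0 ≤ V x y)
    (hβ : 0 < β) (hN : 1 ≤ N) (hij : i ≠ j) (hil : i ≠ l) (hjl : j ≠ l) :
    ∫ x, triplePotential V β N i j l x ≤ (potentialMass V).toReal := by
  rw [integral_eq_lintegral_of_nonneg_ae (Eventually.of_forall (triplePotential_nonneg hV_nonneg))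
    (measurable_triplePotential hV.measurable hV_supp hβ hN).aestronglyMeasurable]
  refine ENNReal.toReal_mono (potentialMass_lt_top hV hV_supp).ne ?_
  refine le_trans (le_of_eq ?_)
    (lintegral_scaledPotential_le hV.measurable hV_supp hV_nonneg hβ hN)
  rw [← (measurePreserving_relPos hij hil hjl).map_eq, lintegral_map
    (measurable_scaledPotential hV.measurable hV_supp hβ hN).ennreal_ofReal
    (continuous_relPos i j l).measurable]
  rfl

/-- Such an `h` either moves the three particles together or moves only the others. The two cases
yield momentum conservation and the absence of foreign frequencies. -/
theorem triplePotential_add (h : Config N) (hj : ∀ a, h (i, a) = h (j, a))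
    (hl : ∀ a, h (i, a) = h (l, a)) (x : Config N) :
    triplePotential V β N i j l (x + h) = triplePotential V β N i j l x := by
  have h1 : pos (x + h) i - pos (x + h) j = pos x i - pos x j := by
    funext a
    change x (i, a) + h (i, a) - (x (j, a) + h (j, a)) = x (i, a) - x (j, a)
    rw [hj]; abel
  have h2 : pos (x + h) i - pos (x + h) l = pos x i - pos x l := by
    funext a
    change x (i, a) + h (i, a) - (x (l, a) + h (l, a)) = x (i, a) - x (l, a)
    rw [hl]; abel
  rw [triplePotential, triplePotential, h1, h2]

theorem exists_fourier_ne_one {m : ℤ} (hm : m ≠ 0) : ∃ t : UnitAddCircle, fourier m t ≠ 1 := by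
  -- At `t = 1/(2m)` the character equals `e^{iπ} = -1`.
  refine ⟨((1 / 2 / m : ℝ) : UnitAddCircle), ?_⟩
  rw [fourier_coe_apply]
  have hm' : (m : ℂ) ≠ 0 := by exact_mod_cast hm
  have : 2 * Real.pi * Complex.I * m * ((1 / 2 / m : ℝ) : ℂ) / ((1 : ℝ) : ℂ)
      = Real.pi * Complex.I := by
    push_cast
    field_simp
  rw [this, Complex.exp_pi_mul_I]
  norm_num

/-- Frequencies of the potential of the particles `i, j, l`: they involve only these particles. -/
theorem mFourierCoeff_triplePotential_eq_zero_of_ne {q : Fin N × Fin 3 → ℤ} {p : Fin N}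
    {a : Fin 3} (hpi : p ≠ i) (hpj : p ≠ j) (hpl : p ≠ l) (hq : q (p, a) ≠ 0) :
    mFourierCoeff (fun x => (triplePotential V β N i j l x : ℂ)) q = 0 := by
  obtain ⟨t, ht⟩ := exists_fourier_ne_one hq
  refine mFourierCoeff_eq_zero_of_invariant (Pi.single (p, a) t) (fun x => ?_) ?_
  · rw [triplePotential_add] <;>
    · intro a'
      simp [hpi.symm, hpj.symm, hpl.symm]
  · have : mFourier q (Pi.single (p, a) t) = fourier (q (p, a)) t := by
      change ∏ r, fourier (q r) ((Pi.single (p, a) t : Config N) r) = _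
      rw [Finset.prod_eq_single (p, a)]
      · rw [Pi.single_eq_same]
      · intro r _ hr
        rw [Pi.single_eq_of_ne hr, fourier_eval_zero]
      · simp
    rwa [this]

/-- Frequencies of the potential of the particles `i, j, l`: the total momentum vanishes. -/
theorem mFourierCoeff_triplePotential_eq_zero_of_add_ne {q : Fin N × Fin 3 → ℤ} {a : Fin 3}
    (hij : i ≠ j) (hil : i ≠ l) (hjl : j ≠ l) (hq : q (i, a) + q (j, a) + q (l, a) ≠ 0) :
    mFourierCoeff (fun x => (triplePotential V β N i j l x : ℂ)) q = 0 := by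
  obtain ⟨t, ht⟩ := exists_fourier_ne_one hq
  set h : Config N := fun r => if r ∈ ({(i, a), (j, a), (l, a)} : Finset (Fin N × Fin 3))
    then t else 0 with hh
  refine mFourierCoeff_eq_zero_of_invariant h (fun x => ?_) ?_
  · rw [triplePotential_add] <;>
    · intro a'
      by_cases ha : a' = a <;> simp [hh, ha]
  · have : mFourier q h = fourier (q (i, a) + q (j, a) + q (l, a)) t := by
      change ∏ r, fourier (q r) (h r) = _
      rw [← Finset.prod_subset (Finset.subset_univ ({(i, a), (j, a), (l, a)} : Finset _))]
      · rw [Finset.prod_insert (by simp [hij, hil]), Finset.prod_insert (by simp [hjl]),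
          Finset.prod_singleton, fourier_add, fourier_add]
        simp [hh, mul_assoc]
      · intro r _ hr
        simp only [hh, if_neg hr, fourier_eval_zero]
    rwa [this]

end Potential

/-! ### Permutation symmetry in Fourier variables -/

noncomputable section Symmetry

variable {n : ℕ}

/-- The action of permutations of the particles on frequencies. -/
def permMode (σ : Equiv.Perm (Fin n)) : (Fin n × Fin 3 → ℤ) ≃ (Fin n × Fin 3 → ℤ) where
  toFun q p := q (σ p.1, p.2)
  invFun q p := q (σ⁻¹ p.1, p.2)
  left_inv q := by ext p; simp
  right_inv q := by ext p; simp

theorem mFourier_permConfig (σ : Equiv.Perm (Fin n)) (q : Fin n × Fin 3 → ℤ) (x : Config n) :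
    mFourier q (permConfig σ x) = mFourier (permMode σ⁻¹ q) x := by
  change ∏ p, fourier (q p) (x (σ p.1, p.2)) = ∏ p, fourier (q (σ⁻¹ p.1, p.2)) (x p)
  rw [← Equiv.prod_comp (Equiv.prodCongr σ (Equiv.refl (Fin 3)))
    fun p => fourier (q (σ⁻¹ p.1, p.2)) (x p)]
  refine Finset.prod_congr rfl fun p _ => ?_
  have : σ⁻¹ (σ p.1) = p.1 := by simp
  change fourier (q p) (x (σ p.1, p.2)) = fourier (q (σ⁻¹ (σ p.1), p.2)) (x (σ p.1, p.2))
  rw [this]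

theorem coeFn_permOp (σ : Equiv.Perm (Fin n)) (f : L2 n) :
    permOp σ f =ᵐ[volume] fun x => f (permConfig σ x) :=
  Lp.coeFn_compMeasurePreserving f (measurePreserving_permConfig σ)

theorem inner_permOp_permOp (σ : Equiv.Perm (Fin n)) (f g : L2 n) :
    inner ℂ (permOp σ f) (permOp σ g) = inner ℂ f g :=
  (Lp.compMeasurePreservingₗᵢ ℂ (permConfig σ) (measurePreserving_permConfig σ)).inner_map_map f g

theorem permOp_torusBasis (σ : Equiv.Perm (Fin n)) (q : Fin n × Fin 3 → ℤ) :
    permOp σ (torusBasis n q) = torusBasis n (permMode σ⁻¹ q) := by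
  apply Lp.ext
  have h1 : ∀ q, torusBasis n q =ᵐ[volume] mFourier q := fun q => by
    have := coeFn_mFourierLp (d := Fin n × Fin 3) 2 q
    rwa [← coe_mFourierBasis] at this
  filter_upwards [coeFn_permOp σ (torusBasis n q), h1 (permMode σ⁻¹ q),
    (measurePreserving_permConfig σ).quasiMeasurePreserving.ae_eq_comp (h1 q)] with x hx h2 h3
  rw [hx, h2, ← mFourier_permConfig]
  exact h3

theorem inner_torusBasis_permOp (σ : Equiv.Perm (Fin n)) (q : Fin n × Fin 3 → ℤ) (f : L2 n) :
    inner ℂ (torusBasis n q) (permOp σ f) = inner ℂ (torusBasis n (permMode σ q)) f := by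
  rw [← inner_permOp_permOp σ (torusBasis n (permMode σ q)) f, permOp_torusBasis]
  congr 2
  ext p
  simp [permMode]

theorem IsBosonic.inner_torusBasis_permMode {ψ : L2 n} (hψ : IsBosonic ψ)
    (σ : Equiv.Perm (Fin n)) (q : Fin n × Fin 3 → ℤ) :
    inner ℂ (torusBasis n (permMode σ q)) ψ = inner ℂ (torusBasis n q) ψ := by
  rw [← inner_torusBasis_permOp, hψ σ]

theorem HilbertBasis.clm_ext {ι H : Type*} [NormedAddCommGroup H] [InnerProductSpace ℂ H]
    (b : HilbertBasis ι ℂ H) {A B : H →L[ℂ] H}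
    (h : ∀ m n, inner ℂ (b m) (A (b n)) = inner ℂ (b m) (B (b n))) : A = B := by
  refine ContinuousLinearMap.ext_on (s := range b) ?_ ?_
  · rw [dense_iff_closure_eq, ← Submodule.topologicalClosure_coe, b.dense_span]; rfl
  · rintro _ ⟨n, rfl⟩
    apply b.repr.injective
    ext m
    simpa only [b.repr_apply_apply] using h m n

theorem isSymmetricOp_of_matrix {γ : L2 n →L[ℂ] L2 n}
    (h1 : ∀ (σ : Equiv.Perm (Fin n)) m m', inner ℂ (torusBasis n (permMode σ m))
      (γ (torusBasis n m')) = inner ℂ (torusBasis n m) (γ (torusBasis n m')))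
    (h2 : ∀ (σ : Equiv.Perm (Fin n)) m m', inner ℂ (torusBasis n m)
      (γ (torusBasis n (permMode σ m'))) = inner ℂ (torusBasis n m) (γ (torusBasis n m'))) :
    IsSymmetricOp γ := by
  refine fun σ => ⟨(torusBasis n).clm_ext fun m m' => ?_, (torusBasis n).clm_ext fun m m' => ?_⟩
  · rw [ContinuousLinearMap.comp_apply, inner_torusBasis_permOp, h1]
  · rw [ContinuousLinearMap.comp_apply, permOp_torusBasis, h2]

/-! ### Symmetry of the marginals and independence of the chosen particles -/

section Marginal

variable {N k : ℕ} (h : k ≤ N)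

/-- The splitting of `N` particles into the first `k` and the others. -/
def particleEquiv : Fin k ⊕ Fin (N - k) ≃ Fin N := finSumFinEquiv.trans (finCongr (by omega))

theorem particleEquiv_inl (j : Fin k) : particleEquiv h (Sum.inl j) = Fin.castLE h j := by
  ext
  simp [particleEquiv]

theorem joinEquiv_inl {α : Type*} (xz : (Fin k × Fin 3 → α) × (Fin (N - k) × Fin 3 → α))
    (j : Fin k) (a : Fin 3) : joinEquiv h α xz (particleEquiv h (Sum.inl j), a) = xz.1 (j, a) :=
  joinEquiv_coordEquiv_inl h xz (j, a)

theorem joinEquiv_inr {α : Type*} (xz : (Fin k × Fin 3 → α) × (Fin (N - k) × Fin 3 → α))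
    (j : Fin (N - k)) (a : Fin 3) :
    joinEquiv h α xz (particleEquiv h (Sum.inr j), a) = xz.2 (j, a) :=
  joinEquiv_coordEquiv_inr h xz (j, a)

theorem exists_joinEquiv_permMode (σ : Equiv.Perm (Fin k)) :
    ∃ σ' : Equiv.Perm (Fin N), ∀ m p,
      joinEquiv h ℤ (permMode σ m, p) = permMode σ' (joinEquiv h ℤ (m, p)) := by
  refine ⟨(particleEquiv h).permCongr (Equiv.sumCongr σ (Equiv.refl _)), fun m p => ?_⟩
  ext ⟨i, a⟩
  obtain ⟨j | j, rfl⟩ := (particleEquiv h).surjective i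
  · simp [permMode, joinEquiv_inl]
  · simp [permMode, joinEquiv_inr]

variable {ψ : L2 N}

include h in
theorem inner_marginal_permMode_left (hψ : IsBosonic ψ) (σ : Equiv.Perm (Fin k))
    (m n : Fin k × Fin 3 → ℤ) :
    inner ℂ (torusBasis k (permMode σ m)) (marginal k ψ (torusBasis k n))
      = inner ℂ (torusBasis k m) (marginal k ψ (torusBasis k n)) := by
  obtain ⟨σ', hσ'⟩ := exists_joinEquiv_permMode h σ
  refine (hasSum_marginal h ψ (permMode σ m) n).unique
    ((hasSum_marginal h ψ m n).congr_fun fun p => ?_)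
  rw [hσ', hψ.inner_torusBasis_permMode]

include h in
theorem inner_marginal_permMode_right (hψ : IsBosonic ψ) (σ : Equiv.Perm (Fin k))
    (m n : Fin k × Fin 3 → ℤ) :
    inner ℂ (torusBasis k m) (marginal k ψ (torusBasis k (permMode σ n)))
      = inner ℂ (torusBasis k m) (marginal k ψ (torusBasis k n)) := by
  obtain ⟨σ', hσ'⟩ := exists_joinEquiv_permMode h σ
  refine (hasSum_marginal h ψ m (permMode σ n)).unique
    ((hasSum_marginal h ψ m n).congr_fun fun p => ?_)
  rw [hσ', hψ.inner_torusBasis_permMode]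

theorem laplaceEigen_nonneg {n : ℕ} (q : Fin n × Fin 3 → ℤ) (j : Fin n) : 0 ≤ laplaceEigen q j :=
  Finset.sum_nonneg fun _ _ => sq_nonneg _

theorem laplaceEigen_joinEquiv_inl (mp : (Fin k × Fin 3 → ℤ) × (Fin (N - k) × Fin 3 → ℤ))
    (j : Fin k) : laplaceEigen (joinEquiv h ℤ mp) (particleEquiv h (Sum.inl j))
      = laplaceEigen mp.1 j := by
  simp only [laplaceEigen, joinEquiv_inl]

theorem laplaceEigen_joinEquiv_inr (mp : (Fin k × Fin 3 → ℤ) × (Fin (N - k) × Fin 3 → ℤ))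
    (j : Fin (N - k)) : laplaceEigen (joinEquiv h ℤ mp) (particleEquiv h (Sum.inr j))
      = laplaceEigen mp.2 j := by
  simp only [laplaceEigen, joinEquiv_inr]

theorem sum_laplaceEigen_joinEquiv (mp : (Fin k × Fin 3 → ℤ) × (Fin (N - k) × Fin 3 → ℤ)) :
    ∑ j, laplaceEigen (joinEquiv h ℤ mp) j
      = ∑ j, laplaceEigen mp.1 j + ∑ j, laplaceEigen mp.2 j := by
  rw [← (particleEquiv h).sum_comp, Fintype.sum_sum_type]
  simp only [laplaceEigen_joinEquiv_inl, laplaceEigen_joinEquiv_inr]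

theorem sobolevWeight_sq (m : Fin k × Fin 3 → ℤ) :
    sobolevWeight m ^ 2 = ∏ j, (1 + laplaceEigen m j) := by
  rw [sobolevWeight, ← Finset.prod_pow]
  exact Finset.prod_congr rfl fun j _ => Real.sq_sqrt (by linarith [laplaceEigen_nonneg m j])

include h in
/-- For bosons, the kinetic trace of the `k`-particle marginal can be computed with any `k`
particles. -/
theorem kineticTrace_marginal_of_injective (hψ : IsBosonic ψ) {f : Fin k → Fin N}
    (hf : Function.Injective f) : kineticTrace (marginal k ψ)
      = ∑' q : Fin N × Fin 3 → ℤ, ENNReal.ofReal ((∏ j, (1 + laplaceEigen q (f j)))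
        * ‖inner ℂ (torusBasis N q) ψ‖ ^ 2) := by
  -- `σ` extends the correspondence between the first `k` particles and those listed by `f`.
  -- Reindexing the frequencies by it leaves the coefficients of a bosonic state unchanged.
  obtain ⟨σ, hσ⟩ := Equiv.Perm.exists_extending_pair (Fin.castLE h) f (Fin.castLE_injective h) hf
  rw [kineticTrace_marginal h]
  have h1 : ∀ q : Fin N × Fin 3 → ℤ, ENNReal.ofReal ((∏ j, (1 + laplaceEigen q (f j)))
        * ‖inner ℂ (torusBasis N q) ψ‖ ^ 2)
      = ENNReal.ofReal ((∏ j, (1 + laplaceEigen (permMode σ q) (Fin.castLE h j)))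
        * ‖inner ℂ (torusBasis N (permMode σ q)) ψ‖ ^ 2) := by
    intro q
    rw [hψ.inner_torusBasis_permMode]
    congr 3
    funext j
    have : permMode σ q = fun p => q (σ p.1, p.2) := rfl
    simp only [this, laplaceEigen, hσ]
  simp_rw [h1]
  rw [(permMode σ).tsum_eq (fun q => ENNReal.ofReal ((∏ j, (1 + laplaceEigen q (Fin.castLE h j)))
    * ‖inner ℂ (torusBasis N q) ψ‖ ^ 2)), ← (joinEquiv h ℤ).tsum_eq]
  refine tsum_congr fun mp => ?_
  rw [sobolevWeight_sq]
  simp_rw [← particleEquiv_inl h, laplaceEigen_joinEquiv_inl]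

include h in
theorem sum_le_of_kineticTrace_le (hψ : IsBosonic ψ) {f : Fin k → Fin N}
    (hf : Function.Injective f) {B : ℝ≥0} (hB : kineticTrace (marginal k ψ) ≤ B)
    (S : Finset (Fin N × Fin 3 → ℤ)) : ∑ q ∈ S, (∏ j, (1 + laplaceEigen q (f j)))
        * ‖inner ℂ (torusBasis N q) ψ‖ ^ 2 ≤ B := by
  rw [kineticTrace_marginal_of_injective h hψ hf] at hB
  have h1 := (ENNReal.sum_le_tsum S).trans hB
  have h0 : ∀ q : Fin N × Fin 3 → ℤ, 0 ≤ (∏ j, (1 + laplaceEigen q (f j)))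
        * ‖inner ℂ (torusBasis N q) ψ‖ ^ 2 := fun q =>
    mul_nonneg (Finset.prod_nonneg fun j _ => by linarith [laplaceEigen_nonneg q (f j)])
      (sq_nonneg _)
  rw [← ENNReal.ofReal_sum_of_nonneg fun q _ => h0 q, ← ENNReal.ofReal_coe_nnreal] at h1
  exact (ENNReal.ofReal_le_ofReal_iff B.2).1 h1

end Marginal

/-! ### A lattice sum -/

/-- With `y = 1 + |2πξ|²`, write `y⁻²` as a product of three factors `y^{-2/3}` and keep one
coordinate in each. The one-dimensional sums behave like `∑ |t|^{-4/3}`, which converges; this is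
where dimension three enters. -/
theorem summable_lattice :
    Summable fun ξ : Fin 3 → ℤ => ((1 + ∑ a, (2 * Real.pi * (ξ a : ℝ)) ^ 2) ^ 2)⁻¹ := by
  set f : ℤ → ℝ := fun t => (1 + (2 * Real.pi * (t : ℝ)) ^ 2) ^ (-(2 / 3) : ℝ) with hf
  have hf0 : ∀ t, 0 ≤ f t := fun t => by positivity
  have hfs : Summable f := by
    have h1 := Real.summable_abs_int_rpow (show (1 : ℝ) < 4 / 3 by norm_num)
    have h2 : Summable fun t : ℤ => if t = 0 then (1 : ℝ) else 0 :=
      summable_of_ne_finset_zero (s := {0}) fun t ht => by simpa using ht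
    refine Summable.of_nonneg_of_le hf0 (fun t => ?_) (h1.add h2)
    by_cases ht : t = 0
    · simp [hf, ht]
    · rw [if_neg ht, add_zero, hf]
      have ht' : 0 < |(t : ℝ)| := abs_pos.2 (by exact_mod_cast ht)
      have e : |(t : ℝ)| ^ (-(4 / 3) : ℝ) = (|(t : ℝ)| ^ 2) ^ (-(2 / 3) : ℝ) := by
        rw [← Real.rpow_natCast, ← Real.rpow_mul ht'.le]
        norm_num
      rw [e]
      refine Real.rpow_le_rpow_of_nonpos (by positivity) ?_ (by norm_num)
      rw [sq_abs, mul_pow]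
      have : 1 ≤ (2 * Real.pi) ^ 2 := one_le_pow₀ (by linarith [Real.pi_gt_three])
      nlinarith [sq_nonneg (t : ℝ)]
  have hle : ∀ ξ : Fin 3 → ℤ,
      ((1 + ∑ a, (2 * Real.pi * (ξ a : ℝ)) ^ 2) ^ 2)⁻¹ ≤ ∏ a, f (ξ a) := by
    intro ξ
    set y : ℝ := 1 + ∑ a, (2 * Real.pi * (ξ a : ℝ)) ^ 2 with hy
    have hy0 : 0 < y := by positivity
    have h1 : ∀ a, y ^ (-(2 / 3) : ℝ) ≤ f (ξ a) := fun a => by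
      refine Real.rpow_le_rpow_of_nonpos (by positivity) ?_ (by norm_num)
      have := Finset.single_le_sum (f := fun a => (2 * Real.pi * (ξ a : ℝ)) ^ 2)
        (fun _ _ => sq_nonneg _) (Finset.mem_univ a)
      linarith
    have h2 : (y ^ 2)⁻¹ = ∏ _a : Fin 3, y ^ (-(2 / 3) : ℝ) := by
      rw [Finset.prod_const, Finset.card_univ, Fintype.card_fin, ← Real.rpow_natCast,
        ← Real.rpow_natCast, ← Real.rpow_mul hy0.le, ← Real.rpow_neg hy0.le]
      norm_num
    rw [h2]
    exact Finset.prod_le_prod (fun a _ => by positivity) fun a _ => h1 a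
  refine summable_of_sum_le (c := ∏ _a : Fin 3, ∑' t, f t) (fun ξ => by positivity) fun S => ?_
  have hsub : S ⊆ Fintype.piFinset fun a => S.image fun ξ => ξ a := fun ξ hξ =>
    Fintype.mem_piFinset.2 fun a => Finset.mem_image_of_mem _ hξ
  calc _ ≤ ∑ ξ ∈ S, ∏ a, f (ξ a) := Finset.sum_le_sum fun ξ _ => hle ξ
    _ ≤ ∑ ξ ∈ Fintype.piFinset fun a => S.image fun ξ => ξ a, ∏ a, f (ξ a) :=
        Finset.sum_le_sum_of_subset_of_nonneg hsub fun ξ _ _ => Finset.prod_nonneg fun a _ => hf0 _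
    _ = ∏ a : Fin 3, ∑ t ∈ S.image fun ξ => ξ a, f t := (Finset.prod_univ_sum _ _).symm
    _ ≤ _ := Finset.prod_le_prod (fun a _ => Finset.sum_nonneg fun _ _ => hf0 _) fun a _ =>
        hfs.sum_le_tsum _ fun _ _ => hf0 _

/-- `∑_ξ (1 + 4π²|ξ|²)^{-2}` over `ℤ³`. -/
def latticeSum : ℝ := ∑' ξ : Fin 3 → ℤ, ((1 + ∑ a, (2 * Real.pi * (ξ a : ℝ)) ^ 2) ^ 2)⁻¹

theorem latticeSum_nonneg : 0 ≤ latticeSum := tsum_nonneg fun _ => by positivity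

/-- The hypothesis says that the modes in `S` are determined by the momentum of particle `j`, so
each point of `ℤ³` is counted at most once. -/
theorem sum_laplaceEigen_le_latticeSum {n : ℕ} (j : Fin n) (S : Finset (Fin n × Fin 3 → ℤ))
    (hS : ∀ q ∈ S, ∀ q' ∈ S, (∀ a, q (j, a) = q' (j, a)) → q = q') :
    ∑ q ∈ S, ((1 + laplaceEigen q j) ^ 2)⁻¹ ≤ latticeSum := by
  classical
  have h1 : ∑ q ∈ S, ((1 + laplaceEigen q j) ^ 2)⁻¹
      = ∑ ξ ∈ S.image fun q a => q (j, a), ((1 + ∑ a, (2 * Real.pi * (ξ a : ℝ)) ^ 2) ^ 2)⁻¹ := by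
    rw [Finset.sum_image fun q hq q' hq' hqq' => hS q hq q' hq' fun a => congrFun hqq' a]
    rfl
  rw [h1]
  exact summable_lattice.sum_le_tsum _ fun _ _ => by positivity

end Symmetry

/-! ### Estimates on the three-body interaction -/

noncomputable section Interaction

variable {V : (Fin 3 → ℝ) → (Fin 3 → ℝ) → ℝ} {β : ℝ} {N : ℕ} {i j l : Fin N}

/-- The three-body potential is bounded by two derivatives on states with a fixed momentum of one
of the particles. -/
theorem integral_triplePotential_mul_le (hV : Continuous (Function.uncurry V))
    (hV_supp : HasCompactSupport (Function.uncurry V)) (hV_nonneg : ∀ x y, 0 ≤ V x y)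
    (hβ : 0 < β) (hN : 1 ≤ N) (hij : i ≠ j) (hil : i ≠ l) (hjl : j ≠ l) (f : L2 N)
    (μ : Fin 3 → ℤ) (hμ : ∀ q, inner ℂ (torusBasis N q) f ≠ 0 → ∀ a, q (i, a) = μ a) {B : ℝ}
    (hB : ∀ S : Finset (Fin N × Fin 3 → ℤ), ∑ q ∈ S, (1 + laplaceEigen q j)
      * (1 + laplaceEigen q l) * ‖inner ℂ (torusBasis N q) f‖ ^ 2 ≤ B) :
    ∫ x, triplePotential V β N i j l x * ‖f x‖ ^ 2
      ≤ (potentialMass V).toReal * latticeSum * B := by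
  classical
  set v := (potentialMass V).toReal with hv
  have hv0 : 0 ≤ v := ENNReal.toReal_nonneg
  have hVm := memLp_triplePotential hV hV_supp hV_nonneg hβ hN i j l
  -- The pairs of modes that the potential can connect once the momentum of `i` is frozen: the other
  -- particles are untouched and the momenta of `j` and `l` have a fixed sum.
  set R : (Fin N × Fin 3 → ℤ) → (Fin N × Fin 3 → ℤ) → Prop := fun q q' =>
    (∀ p, p ≠ j → p ≠ l → ∀ a, q (p, a) = q' (p, a)) ∧
      ∀ a, q (j, a) + q (l, a) = q' (j, a) + q' (l, a) with hR
  have h := norm_inner_le_of_schur (torusBasis N) (mulOp _ hVm) f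
    (Q := {q | ∀ a, q (i, a) = μ a}) (κ := fun q q' => if R q q' then v else 0)
    (wt := fun q => (1 + laplaceEigen q j) * (1 + laplaceEigen q l))
    (M := v * latticeSum) (B := B) ?_ ?_ (mul_nonneg hv0 latticeSum_nonneg) ?_ ?_ ?_ hB
  · rw [inner_potential_self, Complex.norm_real] at h
    exact (le_abs_self _).trans h
  · intro q hq
    by_contra hne
    exact hq (hμ q hne)
  · exact fun q => mul_pos (by linarith [laplaceEigen_nonneg q j])
      (by linarith [laplaceEigen_nonneg q l])
  · intro q hq q' hq'
    rw [inner_torusBasis_mulOp_torusBasis]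
    split_ifs with hqq
    · exact (norm_mFourierCoeff_le (fun x => triplePotential_nonneg hV_nonneg x)
        (integrable_triplePotential hV hV_supp hV_nonneg hβ hN) _).trans
        (integral_triplePotential_le hV hV_supp hV_nonneg hβ hN hij hil hjl)
    · rw [norm_le_zero_iff]
      by_contra hne
      refine hqq ⟨fun p hpj hpl a => ?_, fun a => ?_⟩
      · by_cases hpi : p = i
        · rw [hpi, hq a, hq' a]
        · by_contra hd
          refine hne (mFourierCoeff_triplePotential_eq_zero_of_ne hpi hpj hpl (a := a) ?_)
          exact sub_ne_zero.2 hd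
      · by_contra hd
        refine hne (mFourierCoeff_triplePotential_eq_zero_of_add_ne hij hil hjl (a := a) ?_)
        have h1 := hq a
        have h2 := hq' a
        simp only [Pi.sub_apply]
        omega
  · intro q q'
    have : R q q' ↔ R q' q := by
      constructor <;> exact fun h => ⟨fun p hj hl a => (h.1 p hj hl a).symm, fun a => (h.2 a).symm⟩
    simp only [this]
  · intro q _ S _
    have e : ∑ q' ∈ S, (if R q q' then v else 0) *
        ((1 + laplaceEigen q' j) * (1 + laplaceEigen q' l))⁻¹
        = v * ∑ q' ∈ S.filter (R q), ((1 + laplaceEigen q' j) * (1 + laplaceEigen q' l))⁻¹ := by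
      rw [Finset.mul_sum, Finset.sum_filter]
      exact Finset.sum_congr rfl fun q' _ => by split_ifs <;> simp
    rw [e]
    refine mul_le_mul_of_nonneg_left ?_ hv0
    have hext : ∀ q₁ ∈ S.filter (R q), ∀ q₂ ∈ S.filter (R q), ∀ p a, p ≠ j → p ≠ l →
        q₁ (p, a) = q₂ (p, a) := fun q₁ h₁ q₂ h₂ p a hj hl =>
      ((Finset.mem_filter.1 h₁).2.1 p hj hl a).symm.trans ((Finset.mem_filter.1 h₂).2.1 p hj hl a)
    have hadd : ∀ q₁ ∈ S.filter (R q), ∀ q₂ ∈ S.filter (R q), ∀ a,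
        q₁ (j, a) + q₁ (l, a) = q₂ (j, a) + q₂ (l, a) := fun q₁ h₁ q₂ h₂ a =>
      ((Finset.mem_filter.1 h₁).2.2 a).symm.trans ((Finset.mem_filter.1 h₂).2.2 a)
    -- Within a class of `R`, the momentum of `j` determines that of `l` and hence the mode;
    -- likewise with `j` and `l` exchanged.
    have hj := sum_laplaceEigen_le_latticeSum j (S.filter (R q)) fun q₁ h₁ q₂ h₂ h => by
      funext ⟨p, a⟩
      by_cases hpj : p = j
      · rw [hpj, h]
      by_cases hpl : p = l
      · have := hadd q₁ h₁ q₂ h₂ a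
        have := h a
        rw [hpl]
        omega
      · exact hext q₁ h₁ q₂ h₂ p a hpj hpl
    have hl := sum_laplaceEigen_le_latticeSum l (S.filter (R q)) fun q₁ h₁ q₂ h₂ h => by
      funext ⟨p, a⟩
      by_cases hpl : p = l
      · rw [hpl, h]
      by_cases hpj : p = j
      · have := hadd q₁ h₁ q₂ h₂ a
        have := h a
        rw [hpj]
        omega
      · exact hext q₁ h₁ q₂ h₂ p a hpj hpl
    -- The mixed weight is split by the arithmetic–geometric mean because each of the two squares is
    -- summable over the single free frequency.
    calc _ ≤ ∑ q' ∈ S.filter (R q), (((1 + laplaceEigen q' j) ^ 2)⁻¹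
          + ((1 + laplaceEigen q' l) ^ 2)⁻¹) / 2 := by
          refine Finset.sum_le_sum fun q' _ => ?_
          rw [mul_inv, ← inv_pow, ← inv_pow]
          nlinarith [sq_nonneg ((1 + laplaceEigen q' j)⁻¹ - (1 + laplaceEigen q' l)⁻¹)]
      _ ≤ latticeSum := by
          rw [← Finset.sum_div, Finset.sum_add_distrib]
          linarith

/-! ### The Hamiltonian -/

theorem interaction_eq (x : Config N) : interaction V β N x = 1 / (N : ℝ) ^ 2 *
    ∑ i, ∑ j, ∑ l, if i < j ∧ j < l then triplePotential V β N i j l x else 0 := rfl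

theorem interaction_nonneg (hV_nonneg : ∀ x y, 0 ≤ V x y) (x : Config N) :
    0 ≤ interaction V β N x := by
  refine mul_nonneg (by positivity) (Finset.sum_nonneg fun i _ => Finset.sum_nonneg fun j _ =>
    Finset.sum_nonneg fun l _ => ?_)
  split_ifs
  · exact scaledPotential_nonneg hV_nonneg _ _
  · exact le_rfl

theorem memLp_interaction (hV : Continuous (Function.uncurry V))
    (hV_supp : HasCompactSupport (Function.uncurry V)) (hV_nonneg : ∀ x y, 0 ≤ V x y)
    (hβ : 0 < β) (hN : 1 ≤ N) : MemLp (fun x => (interaction V β N x : ℂ)) ∞ volume := by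
  have h0 : ∀ i j l : Fin N, MemLp (fun x : Config N =>
      if i < j ∧ j < l then (triplePotential V β N i j l x : ℂ) else 0) ∞ volume := by
    intro i j l
    by_cases h : i < j ∧ j < l
    · simp only [h, and_self, if_true]
      exact memLp_triplePotential hV hV_supp hV_nonneg hβ hN i j l
    · simp only [h, if_false]
      exact MemLp.zero'
  have h1 : ∀ i j : Fin N, MemLp (fun x : Config N => ∑ l,
      if i < j ∧ j < l then (triplePotential V β N i j l x : ℂ) else 0) ∞ volume :=
    fun i j => memLp_finsetSum _ fun l _ => h0 i j l
  have h2 : ∀ i : Fin N, MemLp (fun x : Config N => ∑ j, ∑ l,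
      if i < j ∧ j < l then (triplePotential V β N i j l x : ℂ) else 0) ∞ volume :=
    fun i => memLp_finsetSum _ fun j _ => h1 i j
  have h3 : MemLp (fun x : Config N => ∑ i, ∑ j, ∑ l,
      if i < j ∧ j < l then (triplePotential V β N i j l x : ℂ) else 0) ∞ volume :=
    memLp_finsetSum _ fun i _ => h2 i
  refine (h3.const_mul ((1 / (N : ℝ) ^ 2 : ℝ) : ℂ)).ae_eq (Eventually.of_forall fun x => ?_)
  simp only [interaction_eq]
  push_cast
  congr 1
  refine Finset.sum_congr rfl fun i _ => Finset.sum_congr rfl fun j _ =>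
    Finset.sum_congr rfl fun l _ => ?_
  split_ifs <;> simp

theorem inner_interaction (hV : Continuous (Function.uncurry V))
    (hV_supp : HasCompactSupport (Function.uncurry V)) (hV_nonneg : ∀ x y, 0 ≤ V x y)
    (hβ : 0 < β) (hN : 1 ≤ N) (f g : L2 N) :
    inner ℂ f (mulOp _ (memLp_interaction hV hV_supp hV_nonneg hβ hN) g)
      = (1 / (N : ℝ) ^ 2 : ℝ) * ∑ i, ∑ j, ∑ l, if i < j ∧ j < l then
        inner ℂ f (mulOp _ (memLp_triplePotential hV hV_supp hV_nonneg hβ hN i j l) g) else 0 := by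
  have hint : ∀ i j l : Fin N, Integrable (fun x => if i < j ∧ j < l then
      starRingEnd ℂ (f x) * ((triplePotential V β N i j l x : ℂ) * g x) else 0) volume := by
    intro i j l
    split_ifs
    · exact integrable_mulOp (memLp_triplePotential hV hV_supp hV_nonneg hβ hN i j l) f g
    · exact integrable_zero _ _ _
  have e : ∀ i j l : Fin N, (if i < j ∧ j < l then
      inner ℂ f (mulOp _ (memLp_triplePotential hV hV_supp hV_nonneg hβ hN i j l) g) else 0)
      = ∫ x, if i < j ∧ j < l then
        starRingEnd ℂ (f x) * ((triplePotential V β N i j l x : ℂ) * g x) else 0 := by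
    intro i j l
    split_ifs
    · exact inner_mulOp _ _ _
    · simp
  simp_rw [e]
  rw [inner_mulOp]
  have e2 : ∀ i j, ∑ l, ∫ x, (if i < j ∧ j < l then
        starRingEnd ℂ (f x) * ((triplePotential V β N i j l x : ℂ) * g x) else 0)
      = ∫ x, ∑ l, if i < j ∧ j < l then
        starRingEnd ℂ (f x) * ((triplePotential V β N i j l x : ℂ) * g x) else 0 := fun i j =>
    (integral_finsetSum _ fun l _ => hint i j l).symm
  simp_rw [e2]
  have e3 : ∀ i, ∑ j, ∫ x, (∑ l, if i < j ∧ j < l then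
        starRingEnd ℂ (f x) * ((triplePotential V β N i j l x : ℂ) * g x) else 0)
      = ∫ x, ∑ j, ∑ l, if i < j ∧ j < l then
        starRingEnd ℂ (f x) * ((triplePotential V β N i j l x : ℂ) * g x) else 0 := fun i =>
    (integral_finsetSum _ fun j _ => integrable_finsetSum _ fun l _ => hint i j l).symm
  simp_rw [e3]
  rw [← integral_finsetSum _ fun i _ => integrable_finsetSum _ fun j _ =>
    integrable_finsetSum _ fun l _ => hint i j l, ← integral_const_mul]
  refine integral_congr_ae (Eventually.of_forall fun x => ?_)
  simp only [interaction_eq]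
  push_cast
  rw [mul_assoc, mul_left_comm, Finset.sum_mul, Finset.mul_sum]
  congr 1
  refine Finset.sum_congr rfl fun i _ => ?_
  rw [Finset.sum_mul, Finset.mul_sum]
  refine Finset.sum_congr rfl fun j _ => ?_
  rw [Finset.sum_mul, Finset.mul_sum]
  refine Finset.sum_congr rfl fun l _ => ?_
  split_ifs <;> simp

/-- The total kinetic energy of a Fourier mode. -/
def kineticEigen (q : Fin N × Fin 3 → ℤ) : ℝ := ∑ j, laplaceEigen q j

theorem kineticEigen_nonneg (q : Fin N × Fin 3 → ℤ) : 0 ≤ kineticEigen q :=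
  Finset.sum_nonneg fun _ _ => laplaceEigen_nonneg _ _

/-- For each fixed `N` the interaction is a bounded function, so the abstract dynamics applies. Its
bound depends on `N`, which is harmless: only exact identities are drawn from it. -/
theorem IsSchrodingerSolution.isWeakSolution (hV : Continuous (Function.uncurry V))
    (hV_supp : HasCompactSupport (Function.uncurry V)) (hV_nonneg : ∀ x y, 0 ≤ V x y)
    (hβ : 0 < β) (hN : 1 ≤ N) {ψ : ℝ → L2 N} (hψ : IsSchrodingerSolution V β N ψ) :
    IsWeakSolution (torusBasis N) kineticEigen
      (mulOp _ (memLp_interaction hV hV_supp hV_nonneg hβ hN)) ψ where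
  continuous := hψ.continuous
  equation q t := by
    simp only [inner_torusBasis]
    have h : mFourierCoeff (mulOp _ (memLp_interaction hV hV_supp hV_nonneg hβ hN) (ψ t)) q
        = mFourierCoeff (fun x => (interaction V β N x : ℂ) * ψ t x) q := by
      refine integral_congr_ae ?_
      filter_upwards [coeFn_mulOp (memLp_interaction hV hV_supp hV_nonneg hβ hN) (ψ t)] with x hx
      rw [hx]
    rw [h]
    exact hψ.equation q t

/-! ### Bounds from the energy -/

/-- By symmetry the one-particle bound controls the kinetic energy of every particle. Only
finiteness is retained, as energy conservation requires it at both times. -/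
theorem summable_kinetic_of_kineticTrace {ψ : L2 N} (hN : 1 ≤ N) (hψ : IsBosonic ψ) {B : ℝ≥0}
    (hB : kineticTrace (marginal 1 ψ) ≤ B) :
    Summable fun q : Fin N × Fin 3 → ℤ => kineticEigen q * ‖inner ℂ (torusBasis N q) ψ‖ ^ 2 := by
  simp_rw [kineticEigen, Finset.sum_mul]
  refine summable_sum fun j _ => ?_
  refine summable_of_sum_le (c := B)
    (fun q => mul_nonneg (laplaceEigen_nonneg q j) (sq_nonneg _)) fun S => ?_
  have h := sum_le_of_kineticTrace_le hN hψ (f := fun _ : Fin 1 => j)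
    (Function.injective_of_subsingleton _) hB S
  refine (Finset.sum_le_sum fun q _ => ?_).trans h
  rw [Finset.univ_unique, Finset.prod_singleton]
  exact mul_le_mul_of_nonneg_right (by linarith) (sq_nonneg _)

theorem kinetic_add_interaction_le_of_energy_le (hV : Continuous (Function.uncurry V))
    (hV_supp : HasCompactSupport (Function.uncurry V)) (hV_nonneg : ∀ x y, 0 ≤ V x y)
    (hβ : 0 < β) (hN : 1 ≤ N) {ψ : L2 N} {E : ℝ≥0} (hE : energy V β N ψ ≤ E) :
    (Summable fun q : Fin N × Fin 3 → ℤ => kineticEigen q * ‖inner ℂ (torusBasis N q) ψ‖ ^ 2) ∧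
    (∑' q : Fin N × Fin 3 → ℤ, kineticEigen q * ‖inner ℂ (torusBasis N q) ψ‖ ^ 2)
      + ∫ x, interaction V β N x * ‖ψ x‖ ^ 2 ≤ E := by
  have h0 : ∀ q : Fin N × Fin 3 → ℤ, 0 ≤ kineticEigen q * ‖inner ℂ (torusBasis N q) ψ‖ ^ 2 :=
    fun q => mul_nonneg (kineticEigen_nonneg q) (sq_nonneg _)
  have e1 : energy V β N ψ = (∑' q : Fin N × Fin 3 → ℤ,
      ENNReal.ofReal (kineticEigen q * ‖inner ℂ (torusBasis N q) ψ‖ ^ 2))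
      + ENNReal.ofReal (∫ x, interaction V β N x * ‖ψ x‖ ^ 2) := by
    rw [ofReal_integral_eq_lintegral_ofReal
      (integrable_potential (memLp_interaction hV hV_supp hV_nonneg hβ hN) ψ)
      (Eventually.of_forall fun x => mul_nonneg (interaction_nonneg hV_nonneg x) (sq_nonneg _))]
    simp only [inner_torusBasis]
    rfl
  have hs : Summable fun q : Fin N × Fin 3 → ℤ =>
      kineticEigen q * ‖inner ℂ (torusBasis N q) ψ‖ ^ 2 := by
    refine summable_of_sum_le (c := E) h0 fun S => ?_
    have h1 := (ENNReal.sum_le_tsum S).trans (le_self_add.trans (e1 ▸ hE))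
    rw [← ENNReal.ofReal_sum_of_nonneg fun q _ => h0 q, ← ENNReal.ofReal_coe_nnreal] at h1
    exact (ENNReal.ofReal_le_ofReal_iff E.2).1 h1
  refine ⟨hs, ?_⟩
  rw [e1, ← ENNReal.ofReal_tsum_of_nonneg h0 hs, ← ENNReal.ofReal_add (tsum_nonneg h0)
    (integral_nonneg fun x => mul_nonneg (interaction_nonneg hV_nonneg x) (sq_nonneg _)),
    ← ENNReal.ofReal_coe_nnreal] at hE
  exact (ENNReal.ofReal_le_ofReal_iff E.2).1 hE

/-- Relabelling the particles is a measure-preserving change of variables which does not affect a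
bosonic `ψ`. Hence all triples share the same expectation. -/
theorem integral_triplePotential_perm {ψ : L2 N} (hψ : IsBosonic ψ)
    (hV : Measurable (Function.uncurry V)) (hV_supp : HasCompactSupport (Function.uncurry V))
    (hβ : 0 < β) (hN : 1 ≤ N) (σ : Equiv.Perm (Fin N)) (i j l : Fin N) :
    ∫ x, triplePotential V β N (σ i) (σ j) (σ l) x * ‖ψ x‖ ^ 2
      = ∫ x, triplePotential V β N i j l x * ‖ψ x‖ ^ 2 := by
  have hm : AEStronglyMeasurable (fun x => triplePotential V β N i j l x * ‖ψ x‖ ^ 2) volume :=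
    (measurable_triplePotential hV hV_supp hβ hN).aestronglyMeasurable.mul
      ((Lp.aestronglyMeasurable ψ).norm.pow 2)
  have hp := measurePreserving_permConfig σ
  have h1 : ∫ x, triplePotential V β N i j l x * ‖ψ x‖ ^ 2
      = ∫ x, triplePotential V β N i j l (permConfig σ x) * ‖ψ (permConfig σ x)‖ ^ 2 := by
    have h2 : AEStronglyMeasurable (fun x => triplePotential V β N i j l x * ‖ψ x‖ ^ 2)
        (Measure.map (permConfig σ) volume) := by rwa [hp.map_eq]
    have h3 := integral_map hp.aemeasurable h2
    rw [← h3]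
    exact congrArg (fun ν => ∫ x, triplePotential V β N i j l x * ‖ψ x‖ ^ 2 ∂ν) hp.map_eq.symm
  rw [h1]
  refine integral_congr_ae ?_
  have h2 := coeFn_permOp σ ψ
  rw [hψ σ] at h2
  filter_upwards [h2] with x hx
  rw [← hx]
  rfl

/-- The expectation of the interaction of three bosons is controlled by the energy per particle. -/
theorem integral_triplePotential_le_of_energy {ψ : L2 N} (hψ : IsBosonic ψ)
    (hV : Continuous (Function.uncurry V))
    (hV_supp : HasCompactSupport (Function.uncurry V)) (hV_nonneg : ∀ x y, 0 ≤ V x y)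
    (hβ : 0 < β) (hN : 3 ≤ N) {E : ℝ}
    (hE : ∫ x, interaction V β N x * ‖ψ x‖ ^ 2 ≤ N * E) (hij : i ≠ j) (hil : i ≠ l) (hjl : j ≠ l) :
    ∫ x, triplePotential V β N i j l x * ‖ψ x‖ ^ 2 ≤ 125 * E := by
  have hN1 : 1 ≤ N := by omega
  set P := ∫ x, triplePotential V β N i j l x * ‖ψ x‖ ^ 2 with hP
  have hP0 : 0 ≤ P := integral_nonneg fun x =>
    mul_nonneg (triplePotential_nonneg hV_nonneg x) (sq_nonneg _)
  have hall : ∀ i' j' l' : Fin N, i' < j' → j' < l' →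
      ∫ x, triplePotential V β N i' j' l' x * ‖ψ x‖ ^ 2 = P := by
    intro i' j' l' h1 h2
    have inj : ∀ {a b c : Fin N}, a ≠ b → a ≠ c → b ≠ c → Function.Injective ![a, b, c] := by
      intro a b c hab hac hbc x y hxy
      fin_cases x <;> fin_cases y <;> simp_all
    obtain ⟨σ, hσ⟩ := Equiv.Perm.exists_extending_pair ![i, j, l] ![i', j', l'] (inj hij hil hjl)
      (inj h1.ne (h1.trans h2).ne h2.ne)
    have e0 := hσ 0
    have e1 := hσ 1
    have e2 := hσ 2
    simp only [Matrix.cons_val_zero, Matrix.cons_val_one, Matrix.cons_val] at e0 e1 e2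
    rw [← e0, ← e1, ← e2]
    exact integral_triplePotential_perm hψ hV.measurable hV_supp hβ hN1 σ i j l
  have hsum : ∫ x, interaction V β N x * ‖ψ x‖ ^ 2
      = 1 / (N : ℝ) ^ 2 * ∑ i' : Fin N, ∑ j' : Fin N, ∑ l' : Fin N,
        if i' < j' ∧ j' < l' then P else 0 := by
    have h1 := inner_interaction hV hV_supp hV_nonneg hβ hN1 ψ ψ
    rw [inner_potential_self] at h1
    have h2 : ∀ i' j' l' : Fin N, (if i' < j' ∧ j' < l' then inner ℂ ψ (mulOp _
        (memLp_triplePotential hV hV_supp hV_nonneg hβ hN1 i' j' l') ψ) else 0)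
        = (((if i' < j' ∧ j' < l' then P else 0 : ℝ)) : ℂ) := by
      intro i' j' l'
      split_ifs with h
      · rw [inner_potential_self, hall i' j' l' h.1 h.2]
      · simp
    simp_rw [h2] at h1
    exact_mod_cast h1
  -- Three consecutive blocks of `n` particles provide `n ^ 3` increasing triples, enough for a
  -- lower bound on their number.
  set n := N / 3 with hn
  let a : Fin 3 → Fin n → Fin N := fun s r => ⟨s * n + r, by
    have := s.2
    have := r.2
    have : s.1 * n ≤ 2 * n := Nat.mul_le_mul_right _ (by omega)
    omega⟩
  have hlow : (n : ℝ) ^ 3 * P ≤ ∑ i' : Fin N, ∑ j' : Fin N, ∑ l' : Fin N,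
        if i' < j' ∧ j' < l' then P else 0 := by
    have ha : ∀ s, Function.Injective (a s) := fun s r r' h => by
      have : s.1 * n + r.1 = s.1 * n + r'.1 := congrArg Fin.val h
      exact Fin.ext (by omega)
    have hsub : ∀ (s : Fin 3) (F : Fin N → ℝ), (∀ r, 0 ≤ F r) → ∑ r, F (a s r) ≤ ∑ r, F r := by
      intro s F hF
      rw [← Finset.sum_image (f := F) (s := Finset.univ) (g := a s) fun r _ r' _ h => ha s h]
      exact Finset.sum_le_sum_of_subset_of_nonneg (Finset.subset_univ _) fun r _ _ => hF r
    have hif : ∀ i' j' l' : Fin N, 0 ≤ if i' < j' ∧ j' < l' then P else 0 := fun i' j' l' => by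
      split_ifs <;> simp [hP0]
    calc (n : ℝ) ^ 3 * P = ∑ r : Fin n, ∑ r' : Fin n, ∑ r'' : Fin n,
          if a 0 r < a 1 r' ∧ a 1 r' < a 2 r'' then P else 0 := by
          have : ∀ r r' r'' : Fin n, a 0 r < a 1 r' ∧ a 1 r' < a 2 r'' := fun r r' r'' => by
            have := r.2
            have := r'.2
            constructor
            · change 0 * n + r.1 < 1 * n + r'.1
              omega
            · change 1 * n + r'.1 < 2 * n + r''.1
              omega
          simp_rw [if_pos (this _ _ _)]
          simp only [Finset.sum_const, Finset.card_univ, Fintype.card_fin,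
            nsmul_eq_mul]
          ring
      _ ≤ ∑ r : Fin n, ∑ r' : Fin n, ∑ l' : Fin N,
          if a 0 r < a 1 r' ∧ a 1 r' < l' then P else 0 :=
          Finset.sum_le_sum fun r _ => Finset.sum_le_sum fun r' _ =>
            hsub 2 (fun l' => if a 0 r < a 1 r' ∧ a 1 r' < l' then P else 0) fun _ => hif _ _ _
      _ ≤ ∑ r : Fin n, ∑ j' : Fin N, ∑ l' : Fin N, if a 0 r < j' ∧ j' < l' then P else 0 :=
          Finset.sum_le_sum fun r _ =>
            hsub 1 (fun j' => ∑ l' : Fin N, if a 0 r < j' ∧ j' < l' then P else 0) fun _ =>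
              Finset.sum_nonneg fun _ _ => hif _ _ _
      _ ≤ _ := hsub 0 (fun i' => ∑ j' : Fin N, ∑ l' : Fin N, if i' < j' ∧ j' < l' then P else 0)
          fun _ => Finset.sum_nonneg fun _ _ => Finset.sum_nonneg fun _ _ => hif _ _ _
  have hNpos : (0 : ℝ) < N := by exact_mod_cast hN1
  -- Uses `N ≥ 3`, with equality at `N = 5`. Cubing gives the constant `125`.
  have h5 : (N : ℝ) ≤ 5 * n := by
    have : N ≤ 5 * n := by omega
    exact_mod_cast this
  have hnpos : (0 : ℝ) < n := by linarith
  rw [hsum] at hE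
  have h6 : (n : ℝ) ^ 3 * P ≤ (N : ℝ) ^ 3 * E := by
    refine hlow.trans ?_
    rw [one_div, inv_mul_le_iff₀ (by positivity)] at hE
    calc _ ≤ _ := hE
      _ = _ := by ring
  have hE0 : 0 ≤ E := by
    by_contra hneg
    have : (N : ℝ) ^ 3 * E < 0 := mul_neg_of_pos_of_neg (by positivity) (not_le.1 hneg)
    have : 0 ≤ (n : ℝ) ^ 3 * P := by positivity
    linarith
  have h7 : (N : ℝ) ^ 3 ≤ 125 * (n : ℝ) ^ 3 := by
    calc (N : ℝ) ^ 3 ≤ (5 * n) ^ 3 := pow_le_pow_left₀ hNpos.le h5 3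
      _ = _ := by ring
  have h8 : (n : ℝ) ^ 3 * P ≤ (n : ℝ) ^ 3 * (125 * E) := by
    calc _ ≤ _ := h6
      _ ≤ 125 * (n : ℝ) ^ 3 * E := mul_le_mul_of_nonneg_right h7 hE0
      _ = _ := by ring
  exact le_of_mul_le_mul_left h8 (by positivity)

end Interaction

/-! ### The evolution of the marginals -/

noncomputable section Evolution

variable {N k : ℕ} (h : k ≤ N)

theorem joinEquiv_sub (a b : (Fin k × Fin 3 → ℤ) × (Fin (N - k) × Fin 3 → ℤ)) :
    joinEquiv h ℤ (a - b) = joinEquiv h ℤ a - joinEquiv h ℤ b := by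
  ext p
  simp only [joinEquiv, Equiv.coe_fn_mk, Pi.sub_apply, Prod.fst_sub, Prod.snd_sub]
  split_ifs <;> rfl

/-- The projection to the modes at which the first `k` particles have momenta `m`. -/
def modeProj (m : Fin k × Fin 3 → ℤ) : L2 N →L[ℂ] L2 N :=
  diagOp (torusBasis N) (fun q => if ((joinEquiv h ℤ).symm q).1 = m then 1 else 0) fun q => by
    split_ifs <;> simp

theorem inner_modeProj (m : Fin k × Fin 3 → ℤ) (f : L2 N) (q : Fin N × Fin 3 → ℤ) :
    inner ℂ (torusBasis N q) (modeProj h m f)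
      = if ((joinEquiv h ℤ).symm q).1 = m then inner ℂ (torusBasis N q) f else 0 := by
  rw [modeProj, inner_diagOp]
  split_ifs <;> simp

theorem norm_inner_modeProj_le (m : Fin k × Fin 3 → ℤ) (f : L2 N) (q : Fin N × Fin 3 → ℤ) :
    ‖inner ℂ (torusBasis N q) (modeProj h m f)‖ ≤ ‖inner ℂ (torusBasis N q) f‖ := by
  rw [inner_modeProj]
  split_ifs <;> simp

/-- The operator `|e_n⟩⟨e_m| ⊗ 1`, where the first factor acts on the first `k` particles. -/
def transition (m n : Fin k × Fin 3 → ℤ) : L2 N →L[ℂ] L2 N :=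
  shiftOp (joinEquiv h ℤ (n - m, 0)) ∘L modeProj h m

theorem inner_transition (m n : Fin k × Fin 3 → ℤ) (f : L2 N)
    (q : (Fin k × Fin 3 → ℤ) × (Fin (N - k) × Fin 3 → ℤ)) :
    inner ℂ (torusBasis N (joinEquiv h ℤ q)) (transition h m n f)
      = if q.1 = n then inner ℂ (torusBasis N (joinEquiv h ℤ (m, q.2))) f else 0 := by
  rw [transition, ContinuousLinearMap.comp_apply, inner_torusBasis_shiftOp, ← joinEquiv_sub,
    inner_modeProj, Equiv.symm_apply_apply]
  obtain ⟨q₁, q₂⟩ := q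
  simp only [Prod.mk_sub_mk, sub_zero]
  by_cases hq : q₁ = n
  · subst hq
    simp
  · rw [if_neg hq, if_neg]
    intro h1
    apply hq
    rw [sub_eq_iff_eq_add] at h1
    rw [h1]
    abel

theorem hasSum_transition (m n : Fin k × Fin 3 → ℤ) (f g : L2 N) :
    HasSum (fun p => starRingEnd ℂ (inner ℂ (torusBasis N (joinEquiv h ℤ (n, p))) f)
      * inner ℂ (torusBasis N (joinEquiv h ℤ (m, p))) g) (inner ℂ f (transition h m n g)) := by
  have h1 := (joinEquiv h ℤ).hasSum_iff.2 ((torusBasis N).hasSum_conj_mul f (transition h m n g))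
  have hinj : Function.Injective fun p : Fin (N - k) × Fin 3 → ℤ => (n, p) :=
    Prod.mk_right_injective n
  rw [← hinj.hasSum_iff] at h1
  · refine h1.congr_fun fun p => ?_
    rw [Function.comp_apply, Function.comp_apply, inner_transition, if_pos rfl]
  · rintro ⟨q₁, q₂⟩ hq
    have hq1 : q₁ ≠ n := fun hq1 => hq ⟨q₂, by rw [hq1]⟩
    rw [Function.comp_apply, inner_transition, if_neg hq1, mul_zero]

/-- The adjoint of `|e_n⟩⟨e_m| ⊗ 1` is `|e_m⟩⟨e_n| ⊗ 1`. It moves the observable to the left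
argument, so that the potential stands between two explicit vectors. -/
theorem inner_transition_left (m n : Fin k × Fin 3 → ℤ) (f g : L2 N) :
    inner ℂ (transition h m n f) g = inner ℂ f (transition h n m g) := by
  rw [← inner_conj_symm]
  refine (Complex.hasSum_conj'.2 (hasSum_transition h m n g f)).unique
    ((hasSum_transition h n m f g).congr_fun fun p => ?_)
  rw [map_mul, Complex.conj_conj, mul_comm]

theorem inner_transition_self (m n : Fin k × Fin 3 → ℤ) (ψ : L2 N) :
    inner ℂ ψ (transition h m n ψ)
      = inner ℂ (torusBasis k m) (marginal k ψ (torusBasis k n)) :=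
  (hasSum_transition h m n ψ ψ).unique (hasSum_marginal h ψ m n)

/-- Only the first `k` momenta change, so the energies of the other particles cancel and the phase
does not depend on the mode. -/
theorem transition_freeProp (m n : Fin k × Fin 3 → ℤ) (t : ℝ) (f : L2 N) :
    transition h m n (freeProp (torusBasis N) kineticEigen t f)
      = Complex.exp (((kineticEigen n - kineticEigen m) * t : ℝ) * Complex.I)
        • freeProp (torusBasis N) kineticEigen t (transition h m n f) := by
  refine (torusBasis N).ext_inner fun q => ?_
  obtain ⟨⟨q₁, q₂⟩, rfl⟩ := (joinEquiv h ℤ).surjective q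
  rw [inner_smul_right, inner_freeProp, inner_transition, inner_transition, inner_freeProp]
  split_ifs with hq
  · change q₁ = n at hq
    subst hq
    rw [← mul_assoc, ← Complex.exp_add]
    congr 2
    simp only [kineticEigen, sum_laplaceEigen_joinEquiv]
    push_cast
    ring
  · simp

variable {V : (Fin 3 → ℝ) → (Fin 3 → ℝ) → ℝ} {β : ℝ} {i j l : Fin N}

/-- The interaction of the other particles commutes with operators on the first `k` particles. -/
theorem transition_triplePotential
    (hv : MemLp (fun x => (triplePotential V β N i j l x : ℂ)) ∞ volume)
    (hi : k ≤ i) (hj : k ≤ j) (hl : k ≤ l) (m n : Fin k × Fin 3 → ℤ) (f : L2 N) :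
    transition h m n (mulOp _ hv f) = mulOp _ hv (transition h m n f) := by
  have h1 : modeProj h m ∘L mulOp _ hv = mulOp _ hv ∘L modeProj h m := by
    refine (torusBasis N).clm_ext fun q q' => ?_
    have e : modeProj h m (torusBasis N q')
        = (if ((joinEquiv h ℤ).symm q').1 = m then (1 : ℂ) else 0) • torusBasis N q' := by
      refine (torusBasis N).ext_inner fun r => ?_
      rw [inner_modeProj, inner_smul_right]
      by_cases hr : r = q'
      · rw [hr]
        split_ifs <;> simp
      · rw [(torusBasis N).orthonormal.2 hr]
        simp
    rw [ContinuousLinearMap.comp_apply, ContinuousLinearMap.comp_apply, inner_modeProj, e, map_smul,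
      inner_smul_right, inner_torusBasis_mulOp_torusBasis]
    -- The projection is diagonal and sees only the first `k` momenta, which a potential of the
    -- remaining particles preserves.
    by_cases hqq : ((joinEquiv h ℤ).symm q).1 = ((joinEquiv h ℤ).symm q').1
    · rw [hqq]
      split_ifs <;> simp
    · suffices h0 : mFourierCoeff (fun x => (triplePotential V β N i j l x : ℂ)) (q - q') = 0 by
        simp [h0]
      obtain ⟨⟨p, a⟩, hp⟩ := Function.ne_iff.1 hqq
      change q (Fin.castLE h p, a) ≠ q' (Fin.castLE h p, a) at hp
      have hne : ∀ s : Fin N, k ≤ s → Fin.castLE h p ≠ s := fun s hs hps => by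
        have := p.2
        rw [← hps] at hs
        simp only [Fin.val_castLE] at hs
        omega
      exact mFourierCoeff_triplePotential_eq_zero_of_ne (hne i hi) (hne j hj) (hne l hl) (a := a)
        (sub_ne_zero.2 hp)
  have h2 := congrArg (fun A => A f) h1
  simp only [ContinuousLinearMap.comp_apply] at h2
  rw [transition, ContinuousLinearMap.comp_apply, ContinuousLinearMap.comp_apply, h2, shiftOp,
    mulOp_comm]

/-- After the projection, the transition multiplies by a unimodular character, which commutes with
the potential and is isometric. Expectations thus see only `modeProj`. -/
theorem integral_potential_transition {v : Config N → ℝ}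
    (hv : MemLp (fun x => (v x : ℂ)) ∞ volume) (m n : Fin k × Fin 3 → ℤ) (f : L2 N) :
    ∫ x, v x * ‖transition h m n f x‖ ^ 2 = ∫ x, v x * ‖modeProj h m f x‖ ^ 2 := by
  have h1 := inner_potential_self hv (transition h m n f)
  rw [transition, ContinuousLinearMap.comp_apply] at h1
  have h2 : mulOp _ hv (shiftOp (joinEquiv h ℤ (n - m, 0)) (modeProj h m f))
      = shiftOp (joinEquiv h ℤ (n - m, 0)) (mulOp _ hv (modeProj h m f)) := mulOp_comm _ _ _
  rw [h2, inner_shiftOp_shiftOp, inner_potential_self] at h1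
  exact_mod_cast h1.symm

/-- The contribution of one three-body potential to the evolution of the marginals. -/
theorem norm_commutator_transition_le (hV : Continuous (Function.uncurry V))
    (hV_supp : HasCompactSupport (Function.uncurry V)) (hV_nonneg : ∀ x y, 0 ≤ V x y)
    (hβ : 0 < β) (hN : 1 ≤ N) (hij : i ≠ j) (hil : i ≠ l) (hjl : j ≠ l) (hi : i.1 < k) (ψ : L2 N)
    {B D : ℝ} (hB : ∀ S : Finset (Fin N × Fin 3 → ℤ), ∑ q ∈ S, (1 + laplaceEigen q j)
      * (1 + laplaceEigen q l) * ‖inner ℂ (torusBasis N q) ψ‖ ^ 2 ≤ B)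
    (hD : ∫ x, triplePotential V β N i j l x * ‖ψ x‖ ^ 2 ≤ D) (m n : Fin k × Fin 3 → ℤ) :
    ‖inner ℂ ψ (mulOp _ (memLp_triplePotential hV hV_supp hV_nonneg hβ hN i j l)
        (transition h m n ψ))
      - inner ℂ (transition h n m ψ)
        (mulOp _ (memLp_triplePotential hV hV_supp hV_nonneg hβ hN i j l) ψ)‖
      ≤ D + (potentialMass V).toReal * latticeSum * B := by
  have hm : ∀ m n : Fin k × Fin 3 → ℤ,
      ∫ x, triplePotential V β N i j l x * ‖transition h m n ψ x‖ ^ 2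
        ≤ (potentialMass V).toReal * latticeSum * B := fun m n => by
    rw [integral_potential_transition h (memLp_triplePotential hV hV_supp hV_nonneg hβ hN i j l)]
    -- Since `i < k`, the projection fixes the momentum of particle `i` to its entry in `m`, as the
    -- Schur estimate requires. The projection only decreases the weighted sums.
    refine integral_triplePotential_mul_le hV hV_supp hV_nonneg hβ hN hij hil hjl _
      (fun a => m (⟨i.1, hi⟩, a)) (fun q hq a => ?_) fun S => ?_
    · rw [inner_modeProj] at hq
      have h1 : ((joinEquiv h ℤ).symm q).1 = m := by
        by_contra h1
        exact hq (if_neg h1)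
      rw [← h1]
      rfl
    · refine (Finset.sum_le_sum fun q _ => ?_).trans (hB S)
      have h1 := laplaceEigen_nonneg q j
      have h2 := laplaceEigen_nonneg q l
      exact mul_le_mul_of_nonneg_left
        (pow_le_pow_left₀ (norm_nonneg _) (norm_inner_modeProj_le h m ψ q) 2) (by positivity)
  have hv := memLp_triplePotential hV hV_supp hV_nonneg hβ hN i j l
  have hv0 : ∀ x, 0 ≤ triplePotential V β N i j l x := fun x => triplePotential_nonneg hV_nonneg x
  have h1 := norm_inner_potential_le hv hv0 ψ (transition h m n ψ)
  have h2 := norm_inner_potential_le hv hv0 (transition h n m ψ) ψ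
  -- Each of the two terms contributes half of `D` and half of the Schur bound.
  refine (norm_sub_le _ _).trans ((add_le_add h1 h2).trans ?_)
  linarith [hm m n, hm n m]

end Evolution

/-! ### Equicontinuity of the marginals -/

noncomputable section Lipschitz

variable {V : (Fin 3 → ℝ) → (Fin 3 → ℝ) → ℝ} {β : ℝ} {N k : ℕ}

/-- As `i` is the smallest index of a triple, `k ≤ i` places the whole triple among the traced-out
particles and its commutator vanishes. The triples with `i < k` number at most `k N²`, which the
prefactor `N⁻²` cancels. -/
theorem norm_commutator_interaction_le (h : k ≤ N) (hV : Continuous (Function.uncurry V))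
    (hV_supp : HasCompactSupport (Function.uncurry V)) (hV_nonneg : ∀ x y, 0 ≤ V x y)
    (hβ : 0 < β) (hN : 1 ≤ N) (ψ : L2 N) {B D : ℝ}
    (hB : ∀ j l : Fin N, j ≠ l → ∀ S : Finset (Fin N × Fin 3 → ℤ), ∑ q ∈ S,
      (1 + laplaceEigen q j) * (1 + laplaceEigen q l) * ‖inner ℂ (torusBasis N q) ψ‖ ^ 2 ≤ B)
    (hB0 : 0 ≤ B) (hD0 : 0 ≤ D) (hD : ∀ i j l : Fin N, i ≠ j → i ≠ l → j ≠ l →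
      ∫ x, triplePotential V β N i j l x * ‖ψ x‖ ^ 2 ≤ D) (m n : Fin k × Fin 3 → ℤ) :
    ‖inner ℂ (mulOp _ (memLp_interaction hV hV_supp hV_nonneg hβ hN) ψ) (transition h m n ψ)
      - inner ℂ ψ (transition h m n (mulOp _ (memLp_interaction hV hV_supp hV_nonneg hβ hN) ψ))‖
      ≤ k * (D + (potentialMass V).toReal * latticeSum * B) := by
  set K := D + (potentialMass V).toReal * latticeSum * B with hK
  have hK0 : 0 ≤ K := by
    have := latticeSum_nonneg
    have : 0 ≤ (potentialMass V).toReal := ENNReal.toReal_nonneg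
    positivity
  rw [inner_potential_left, ← inner_transition_left,
    inner_interaction hV hV_supp hV_nonneg hβ hN, inner_interaction hV hV_supp hV_nonneg hβ hN,
    ← mul_sub, ← Finset.sum_sub_distrib]
  simp_rw [← Finset.sum_sub_distrib]
  have hterm : ∀ i j l : Fin N, ‖(if i < j ∧ j < l then
        inner ℂ ψ (mulOp _ (memLp_triplePotential hV hV_supp hV_nonneg hβ hN i j l)
          (transition h m n ψ)) else 0) - (if i < j ∧ j < l then
        inner ℂ (transition h n m ψ)
          (mulOp _ (memLp_triplePotential hV hV_supp hV_nonneg hβ hN i j l) ψ) else 0)‖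
      ≤ if i.1 < k then K else 0 := by
    intro i j l
    by_cases hijl : i < j ∧ j < l
    · obtain ⟨hij, hjl⟩ := hijl
      rw [if_pos ⟨hij, hjl⟩, if_pos ⟨hij, hjl⟩]
      split_ifs with hi
      · exact norm_commutator_transition_le h hV hV_supp hV_nonneg hβ hN hij.ne (hij.trans hjl).ne
          hjl.ne hi ψ (hB j l hjl.ne) (hD i j l hij.ne (hij.trans hjl).ne hjl.ne) m n
      · have hi' : k ≤ i := not_lt.1 hi
        have hj : k ≤ j := hi'.trans (Fin.le_def.1 hij.le)
        rw [inner_transition_left, transition_triplePotential h _ hi' hj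
          (hj.trans (Fin.le_def.1 hjl.le)), sub_self, norm_zero]
    · rw [if_neg hijl, if_neg hijl, sub_self, norm_zero]
      split_ifs
      · exact hK0
      · exact le_rfl
  have hNpos : (0 : ℝ) < N := by exact_mod_cast hN
  rw [norm_mul, Complex.norm_real, Real.norm_of_nonneg (by positivity), one_div,
    inv_mul_le_iff₀ (by positivity)]
  calc _ ≤ ∑ i : Fin N, ∑ _j : Fin N, ∑ _l : Fin N, (if i.1 < k then K else 0) :=
        (norm_sum_le _ _).trans (Finset.sum_le_sum fun i _ =>
          (norm_sum_le _ _).trans (Finset.sum_le_sum fun j _ =>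
            (norm_sum_le _ _).trans (Finset.sum_le_sum fun l _ => hterm i j l)))
    _ = (N : ℝ) ^ 2 * (k * K) := by
        simp only [Finset.sum_const, Finset.card_univ, Fintype.card_fin, nsmul_eq_mul,
          ← Finset.mul_sum]
        rw [← Finset.sum_filter, Finset.sum_const, Fin.card_filter_val_lt, min_eq_right h,
          nsmul_eq_mul]
        ring

/-- Every matrix element of the `k`-particle marginal is Lipschitz in time, uniformly in the number
of particles. -/
theorem norm_matrix_marginal_sub_le (h : k ≤ N) (hV : Continuous (Function.uncurry V))
    (hV_supp : HasCompactSupport (Function.uncurry V)) (hV_nonneg : ∀ x y, 0 ≤ V x y)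
    (hβ : 0 < β) (hN : 3 ≤ N) {ψ : ℝ → L2 N} (hψ : IsSchrodingerSolution V β N ψ)
    (hsymm : ∀ t, IsBosonic (ψ t)) (hnorm : ∀ t, ‖ψ t‖ = 1) {T : ℝ} (hT : 0 ≤ T) {B₁ B₂ E : ℝ≥0}
    (hB₁ : ∀ t ∈ Icc 0 T, kineticTrace (marginal 1 (ψ t)) ≤ B₁)
    (hB₂ : ∀ t ∈ Icc 0 T, kineticTrace (marginal 2 (ψ t)) ≤ B₂)
    (hE : energy V β N (ψ 0) ≤ (N * E : ℝ≥0)) (m n : Fin k × Fin 3 → ℤ) {s t : ℝ}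
    (hs : s ∈ Icc 0 T) (ht : t ∈ Icc 0 T) :
    ‖inner ℂ (torusBasis k m) (marginal k (ψ t) (torusBasis k n))
      - inner ℂ (torusBasis k m) (marginal k (ψ s) (torusBasis k n))‖
      ≤ (|kineticEigen n - kineticEigen m|
        + k * (125 * E + (potentialMass V).toReal * latticeSum * B₂)) * ‖t - s‖ := by
  have hN1 : 1 ≤ N := by omega
  have hw := hψ.isWeakSolution hV hV_supp hV_nonneg hβ hN1
  have hsum : ∀ t ∈ Icc 0 T, Summable fun q : Fin N × Fin 3 → ℤ =>
      kineticEigen q * ‖inner ℂ (torusBasis N q) (ψ t)‖ ^ 2 := fun t ht =>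
    summable_kinetic_of_kineticTrace hN1 (hsymm t) (hB₁ t ht)
  -- Only the energy at time `0` is assumed bounded. Conservation carries the bound to time `t`, and
  -- the nonnegative kinetic part is dropped.
  have hint : ∀ t ∈ Icc 0 T, ∫ x, interaction V β N x * ‖ψ t x‖ ^ 2 ≤ N * E := by
    intro t ht
    have h0 : (0 : ℝ) ∈ Icc 0 T := ⟨le_rfl, hT⟩
    have h1 := (kinetic_add_interaction_le_of_energy_le hV hV_supp hV_nonneg hβ hN1 hE).2
    have h2 := hw.energy_const kineticEigen_nonneg (inner_potential_left _) (hsum 0 h0) (hsum t ht)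
    rw [inner_potential_self, inner_potential_self, Complex.ofReal_re, Complex.ofReal_re] at h2
    have h3 : 0 ≤ ∑' q : Fin N × Fin 3 → ℤ,
        kineticEigen q * ‖inner ℂ (torusBasis N q) (ψ t)‖ ^ 2 :=
      tsum_nonneg fun q => mul_nonneg (kineticEigen_nonneg q) (sq_nonneg _)
    push_cast at h1
    linarith
  have hd := hw.hasDerivAt_expectation (c := kineticEigen n - kineticEigen m)
    (A := transition h m n) fun t x => transition_freeProp h m n t x
  simp_rw [← inner_transition_self h m n]
  refine (convex_Icc 0 T).norm_image_sub_le_of_norm_hasDerivWithin_le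
    (fun r _ => (hd r).hasDerivWithinAt) (fun r hr => ?_) hs ht
  rw [norm_mul, Complex.norm_I, one_mul, add_sub_assoc]
  refine (norm_add_le _ _).trans (add_le_add ?_ ?_)
  -- The kinetic commutator is the frequency difference times a matrix element of a subdensity, of
  -- modulus at most one.
  · rw [norm_mul, inner_transition_self, Complex.norm_real, Real.norm_eq_abs]
    refine mul_le_of_le_one_right (abs_nonneg _) ?_
    refine ((isSubdensity_marginal h (ψ r) (hnorm r).le).norm_inner_le _ _).trans ?_
    rw [(torusBasis k).orthonormal.1, (torusBasis k).orthonormal.1, one_mul]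
  · refine norm_commutator_interaction_le h hV hV_supp hV_nonneg hβ hN1 (ψ r)
      (fun j l hjl S => ?_) B₂.coe_nonneg (by positivity) (fun i j l hij hil hjl =>
        integral_triplePotential_le_of_energy (hsymm r) hV hV_supp hV_nonneg hβ hN (hint r hr)
          hij hil hjl) m n
    have hinj : Function.Injective ![j, l] := by
      intro x y hxy
      fin_cases x <;> fin_cases y <;> simp_all
    have h1 := sum_le_of_kineticTrace_le (by omega : 2 ≤ N) (hsymm r) hinj (hB₂ r hr) S
    simpa only [Fin.prod_univ_two, Matrix.cons_val_zero, Matrix.cons_val_one] using h1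

theorem continuous_matrix_marginal (h : k ≤ N) {ψ : ℝ → L2 N} (hψ : Continuous ψ)
    (m n : Fin k × Fin 3 → ℤ) :
    Continuous fun t => inner ℂ (torusBasis k m) (marginal k (ψ t) (torusBasis k n)) := by
  simp_rw [← inner_transition_self h m n]
  exact hψ.inner ((transition h m n).continuous.comp hψ)

end Lipschitz

/-! ### Compactness of the sequence of marginals -/

noncomputable section Compactness

/-- Arzelà–Ascoli, transported from bounded continuous functions through the isometry available on a
compact domain. -/
theorem isCompact_closure_range_of_equicontinuous {X Y ι : Type*} [TopologicalSpace X]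
    [CompactSpace X] [MetricSpace Y] {F : ι → C(X, Y)} {K : Set Y} (hK : IsCompact K)
    (hF : ∀ i x, F i x ∈ K) (he : Equicontinuous fun i => (F i : X → Y)) :
    IsCompact (closure (range F)) := by
  set e := (ContinuousMap.isometryEquivBoundedOfCompact X Y).toHomeomorph
  have h1 : IsCompact (closure (range fun i => e (F i))) := by
    refine BoundedContinuousFunction.arzela_ascoli K hK _ ?_ ?_
    · rintro _ x ⟨i, rfl⟩
      exact hF i x
    · intro x U hU
      filter_upwards [he x U hU] with y hy
      rintro ⟨_, i, rfl⟩
      exact hy i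
  have h2 : closure (range F) = e ⁻¹' closure (range fun i => e (F i)) := by
    rw [e.preimage_closure]
    congr 1
    ext f
    simp
  rw [h2]
  exact e.isCompact_preimage.2 h1

/-- The a priori bound starts only at some `N₀`. The finitely many earlier functions are continuous,
which suffices for equicontinuity of the whole sequence. -/
theorem equicontinuous_of_eventually_lipschitz {X : Type*} [PseudoMetricSpace X] {f : ℕ → X → ℂ}
    (hf : ∀ N, Continuous (f N)) {N₀ : ℕ} {L : ℝ}
    (hL : ∀ N, N₀ ≤ N → ∀ x y, ‖f N x - f N y‖ ≤ L * dist x y) : Equicontinuous f := by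
  intro x
  rw [Metric.equicontinuousAt_iff_right]
  intro ε hε
  have h1 : ∀ᶠ y in 𝓝 x, L * dist x y < ε := by
    have : Tendsto (fun y => L * dist x y) (𝓝 x) (𝓝 (L * dist x x)) :=
      Continuous.tendsto (by fun_prop) x
    rw [dist_self, mul_zero] at this
    exact this.eventually (gt_mem_nhds hε)
  have h2 : ∀ᶠ y in 𝓝 x, ∀ N ∈ Finset.range N₀, dist (f N x) (f N y) < ε := by
    rw [eventually_all_finset]
    intro N _
    have : Tendsto (fun y => dist (f N x) (f N y)) (𝓝 x) (𝓝 (dist (f N x) (f N x))) :=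
      (continuous_const.dist (hf N)).tendsto x
    rw [dist_self] at this
    exact this.eventually (gt_mem_nhds hε)
  filter_upwards [h1, h2] with y hy1 hy2 N
  by_cases hN : N₀ ≤ N
  · rw [dist_eq_norm]
    exact (hL N hN x y).trans_lt hy1
  · exact hy2 N (Finset.mem_range.2 (not_le.1 hN))

/-! ### From matrix elements to paths of operators -/

section TraceClassOp

variable {ι : Type*} {H : Type*} [NormedAddCommGroup H] [InnerProductSpace ℂ H] [CompleteSpace H]
  {b : HilbertBasis ι ℂ H} {J : TestFamily H} {X : Type*} [TopologicalSpace X]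

theorem equicontinuous_of_matrix {α : Type*} {F : α → X → TraceClassOp b J}
    (hF : ∀ i x, IsSubdensity b (F i x).op)
    (h : ∀ m n, Equicontinuous fun i x => inner ℂ (b m) ((F i x).op (b n))) :
    Equicontinuous F := by
  intro x
  rw [Metric.equicontinuousAt_iff_right]
  intro ε hε
  -- The filter `⊤ ×ˢ 𝓝 x` encodes uniformity over the family, so that equicontinuity becomes an
  -- instance of `tendsto_dist_of_matrix`.
  have h1 : Tendsto (fun p : α × X => dist (F p.1 x) (F p.1 p.2)) (⊤ ×ˢ 𝓝 x) (𝓝 0) := by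
    refine tendsto_dist_of_matrix (fun p => hF p.1 x) (fun p => hF p.1 p.2) fun m n => ?_
    rw [Metric.tendsto_nhds]
    intro δ hδ
    have h2 := Metric.equicontinuousAt_iff_right.1 (h m n x) δ hδ
    refine (h2.prod_inr ⊤).mono fun p hp => ?_
    rw [dist_zero_right, ← dist_eq_norm]
    exact hp p.1
  have h3 := h1.eventually (gt_mem_nhds hε)
  obtain ⟨p, hp, q, hq, hpq⟩ := eventually_prod_iff.1 h3
  filter_upwards [hq] with y hy i
  exact hpq (eventually_top.1 hp i) hy

theorem continuous_of_matrix {F : X → TraceClassOp b J} (hF : ∀ x, IsSubdensity b (F x).op)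
    (h : ∀ m n, Continuous fun x => inner ℂ (b m) ((F x).op (b n))) : Continuous F := by
  rw [continuous_iff_continuousAt]
  intro x
  rw [ContinuousAt, tendsto_iff_dist_tendsto_zero]
  refine tendsto_dist_of_matrix hF (fun _ => hF x) fun m n => ?_
  have h1 := ((h m n).tendsto x).sub_const (inner ℂ (b m) ((F x).op (b n)))
  rwa [sub_self] at h1

end TraceClassOp

/-- Testing finite partial sums turns the bound into closed conditions on finitely many matrix
elements each. This is how it survives weak limits, in the manner of Fatou. -/
theorem kineticTrace_le_iff {k : ℕ} {γ : L2 k →L[ℂ] L2 k} (hγ : γ.IsPositive) {B : ℝ≥0} :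
    kineticTrace γ ≤ B ↔ ∀ S : Finset (Fin k × Fin 3 → ℤ), ∑ m ∈ S,
      sobolevWeight m ^ 2 * (inner ℂ (torusBasis k m) (γ (torusBasis k m))).re ≤ B := by
  have h0 : ∀ m : Fin k × Fin 3 → ℤ,
      0 ≤ sobolevWeight m ^ 2 * (inner ℂ (torusBasis k m) (γ (torusBasis k m))).re := fun m =>
    mul_nonneg (sq_nonneg _) (hγ.re_inner_nonneg_right _)
  have h1 : ∀ m : Fin k × Fin 3 → ℤ, (inner ℂ ((sobolevWeight m : ℂ) • torusBasis k m)
      (γ ((sobolevWeight m : ℂ) • torusBasis k m))).re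
      = sobolevWeight m ^ 2 * (inner ℂ (torusBasis k m) (γ (torusBasis k m))).re := fun m => by
    rw [map_smul, inner_smul_left, inner_smul_right, Complex.conj_ofReal, ← mul_assoc,
      ← Complex.ofReal_mul, Complex.re_ofReal_mul, sq]
  simp_rw [kineticTrace, h1]
  have h2 : ∀ S : Finset (Fin k × Fin 3 → ℤ), ∑ m ∈ S, ENNReal.ofReal
      (sobolevWeight m ^ 2 * (inner ℂ (torusBasis k m) (γ (torusBasis k m))).re) ≤ B ↔
      ∑ m ∈ S, sobolevWeight m ^ 2 * (inner ℂ (torusBasis k m) (γ (torusBasis k m))).re ≤ B := by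
    intro S
    rw [← ENNReal.ofReal_sum_of_nonneg fun m _ => h0 m, ← ENNReal.ofReal_coe_nnreal,
      ENNReal.ofReal_le_ofReal_iff B.coe_nonneg]
  rw [ENNReal.tsum_eq_iSup_sum, iSup_le_iff]
  exact forall_congr' h2

/-- The matrices of symmetric operators whose kinetic trace is at most `B`. -/
def admissibleMatrices (k : ℕ) (B : ℝ≥0) :
    Set ((Fin k × Fin 3 → ℤ) → (Fin k × Fin 3 → ℤ) → ℂ) :=
  {a | (∀ σ m n, a (permMode σ m) n = a m n) ∧ (∀ σ m n, a m (permMode σ n) = a m n) ∧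
    ∀ S : Finset (Fin k × Fin 3 → ℤ), ∑ m ∈ S, sobolevWeight m ^ 2 * (a m m).re ≤ B}

theorem isClosed_admissibleMatrices (k : ℕ) (B : ℝ≥0) : IsClosed (admissibleMatrices k B) := by
  have hc : ∀ m n, Continuous fun a : (Fin k × Fin 3 → ℤ) → (Fin k × Fin 3 → ℤ) → ℂ => a m n :=
    fun m n => continuous_apply_apply m n
  have e : admissibleMatrices k B = (⋂ σ, ⋂ m, ⋂ n, {a | a (permMode σ m) n = a m n}) ∩
      ((⋂ σ, ⋂ m, ⋂ n, {a | a m (permMode σ n) = a m n}) ∩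
        ⋂ S : Finset (Fin k × Fin 3 → ℤ),
          {a | ∑ m ∈ S, sobolevWeight m ^ 2 * (a m m).re ≤ (B : ℝ)}) := by
    ext a
    simp only [admissibleMatrices, mem_inter_iff, mem_iInter, mem_ofPred_eq]
  rw [e]
  refine IsClosed.inter ?_ (IsClosed.inter ?_ ?_)
  · exact isClosed_iInter fun σ => isClosed_iInter fun m => isClosed_iInter fun n =>
      isClosed_eq (hc _ _) (hc _ _)
  · exact isClosed_iInter fun σ => isClosed_iInter fun m => isClosed_iInter fun n =>
      isClosed_eq (hc _ _) (hc _ _)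
  · exact isClosed_iInter fun S => isClosed_le (continuous_finsetSum _ fun m _ =>
      continuous_const.mul (Complex.continuous_re.comp (hc m m))) continuous_const

end Compactness

/-! ### Assembly: Arzelà–Ascoli for each `k`, Tychonoff over `k`, and closed constraints at limit
points -/

theorem mainTheorem9
    (V : (Fin 3 → ℝ) → (Fin 3 → ℝ) → ℝ)
    (hV_smooth : ContDiff ℝ ∞ (Function.uncurry V))
    (hV_supp : HasCompactSupport (Function.uncurry V))
    (hV_nonneg : ∀ x y, 0 ≤ V x y)
    (hV_symm : ∀ x y, V x y = V y x)
    (β : ℝ) (hβ : 0 < β) (T : ℝ) (hT : 0 < T)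
    (J : ∀ k : ℕ+, TestFamily (L2 k))
    (ψ : ∀ N : ℕ, ℝ → L2 N)
    (hψ : ∀ N, 1 ≤ N → IsSchrodingerSolution V β N (ψ N))
    (hψ_symm : ∀ N, 1 ≤ N → ∀ t, IsBosonic (ψ N t))
    (hψ_norm : ∀ N, 1 ≤ N → ‖ψ N 0‖ = 1)
    (C : ℝ≥0)
    (h_apriori : ∀ k : ℕ+, ∃ N₀ : ℕ, ∀ N : ℕ, N₀ ≤ N → (k : ℕ) ≤ N → ∀ t ∈ Icc (0 : ℝ) T,
      kineticTrace (marginal (k : ℕ) (ψ N t)) ≤ (C : ℝ≥0∞) ^ (k : ℕ))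
    (E : ℝ≥0)
    (h_energy : ∀ N : ℕ, 1 ≤ N → (N : ℝ≥0∞)⁻¹ * energy V β N (ψ N 0) ≤ E) :
    ∃ Γ : ℕ → HierarchySpace T J,
      (∀ (N : ℕ) (k : ℕ+) (t : Icc (0 : ℝ) T),
        (Γ N k t).op = if (k : ℕ) ≤ N then marginal (k : ℕ) (ψ N t) else 0) ∧
      IsCompact (closure (range Γ)) ∧
      ∀ Γ_lim : HierarchySpace T J, MapClusterPt Γ_lim atTop Γ →
        ∀ (k : ℕ+) (t : Icc (0 : ℝ) T),
          IsSymmetricOp (Γ_lim k t).op ∧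
          (Γ_lim k t).op.IsPositive ∧
          IsTraceClass (torusBasis k) (Γ_lim k t).op ∧
          ‖opTrace (torusBasis k) (Γ_lim k t).op‖ ≤ 1 ∧
          kineticTrace (Γ_lim k t).op ≤ (C : ℝ≥0∞) ^ (k : ℕ) := by
  have hV := hV_smooth.continuous
  have hnorm : ∀ N, 1 ≤ N → ∀ t, ‖ψ N t‖ = 1 := fun N hN t => by
    rw [← hψ_norm N hN]
    exact ((hψ N hN).isWeakSolution hV hV_supp hV_nonneg hβ hN).norm_const
      (inner_potential_left _) t 0
  have hap : ∀ k : ℕ, 0 < k → ∃ N₀ : ℕ, ∀ N : ℕ, N₀ ≤ N → k ≤ N → ∀ t ∈ Icc (0 : ℝ) T,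
      kineticTrace (marginal k (ψ N t)) ≤ ((C ^ k : ℝ≥0) : ℝ≥0∞) := fun k hk => by
    rw [ENNReal.coe_pow]
    exact h_apriori ⟨k, hk⟩
  let G : ℕ → ∀ k : ℕ+, Icc (0 : ℝ) T → (L2 k →L[ℂ] L2 k) := fun N k t =>
    if (k : ℕ) ≤ N then marginal (k : ℕ) (ψ N t) else 0
  have hG1 : ∀ N (k : ℕ+) t, (k : ℕ) ≤ N → G N k t = marginal (k : ℕ) (ψ N t) :=
    fun N k t hk => if_pos hk
  have hG0 : ∀ N (k : ℕ+) t, ¬ (k : ℕ) ≤ N → G N k t = 0 := fun N k t hk => if_neg hk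
  have hsub : ∀ N (k : ℕ+) t, IsSubdensity (torusBasis k) (G N k t) := by
    intro N k t
    by_cases hk : (k : ℕ) ≤ N
    · rw [hG1 N k t hk]
      -- The assumptions on `ψ N` concern `N ≥ 1`, which follows from `1 ≤ k ≤ N`.
      exact isSubdensity_marginal hk _ (hnorm N (Nat.le_trans k.pos hk) t).le
    · rw [hG0 N k t hk]
      exact isSubdensity_zero _
  let F : ℕ → ∀ k : ℕ+, Icc (0 : ℝ) T → TraceClassSpace k (J k) := fun N k t =>
    ⟨G N k t, (hsub N k t).isTraceClass⟩
  have hmat : ∀ N (k : ℕ+) m n, Continuous fun t =>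
      inner ℂ (torusBasis k m) (G N k t (torusBasis k n)) := by
    intro N k m n
    by_cases hk : (k : ℕ) ≤ N
    · simp only [hG1 N k _ hk]
      exact (continuous_matrix_marginal hk (hψ N (Nat.le_trans k.pos hk)).continuous m n).comp
        continuous_subtype_val
    · simp only [hG0 N k _ hk, zero_apply, inner_zero_right]
      exact continuous_const
  let Γ : ℕ → HierarchySpace T J := fun N k =>
    ⟨F N k, continuous_of_matrix (hsub N k) (hmat N k)⟩
  have heq : ∀ k : ℕ+, Equicontinuous fun N => F N k := by
    intro k
    refine equicontinuous_of_matrix (fun N => hsub N k) fun m n => ?_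
    obtain ⟨N₁, h₁⟩ := hap 1 one_pos
    obtain ⟨N₂, h₂⟩ := hap 2 two_pos
    -- The threshold collects the a priori bounds for one and two particles, `k ≤ N`, and `3 ≤ N` so
    -- that increasing triples exist.
    refine equicontinuous_of_eventually_lipschitz (fun N => hmat N k m n)
      (N₀ := max (max N₁ N₂) (max k 3)) (L := |kineticEigen n - kineticEigen m| +
        (k : ℕ) * (125 * E + (potentialMass V).toReal * latticeSum * (C ^ 2 : ℝ≥0)))
      fun N hN s t => ?_
    simp only [max_le_iff] at hN
    obtain ⟨⟨hN₁, hN₂⟩, hk, hN3⟩ := hN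
    have hN1 : 1 ≤ N := by omega
    have hE : energy V β N (ψ N 0) ≤ (N * E : ℝ≥0) := by
      have h1 := (ENNReal.inv_mul_le_iff (Nat.cast_ne_zero.2 (by omega))
        (ENNReal.natCast_ne_top N)).1 (h_energy N hN1)
      exact_mod_cast h1
    change ‖inner ℂ (torusBasis k m) (G N k s (torusBasis k n))
      - inner ℂ (torusBasis k m) (G N k t (torusBasis k n))‖ ≤ _
    rw [hG1 N k s hk, hG1 N k t hk, Subtype.dist_eq, dist_eq_norm]
    exact norm_matrix_marginal_sub_le hk hV hV_supp hV_nonneg hβ hN3 (hψ N hN1) (hψ_symm N hN1)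
      (hnorm N hN1) hT.le (h₁ N hN₁ hN1) (h₂ N hN₂ (by omega)) hE m n t.2 s.2
  refine ⟨Γ, fun N k t => rfl, ?_, fun Γ_lim hΓ k t => ?_⟩
  · have hk : ∀ k : ℕ+, IsCompact (closure (range fun N => Γ N k)) := fun k =>
      isCompact_closure_range_of_equicontinuous
        (isCompact_subdensity (torusBasis k) (J k) isClosed_univ)
        (fun N t => ⟨hsub N k t, mem_univ _⟩) (heq k)
    -- By Tychonoff the product of the componentwise closures is compact, and it contains the
    -- closure of the range.
    refine (isCompact_univ_pi hk).of_isClosed_subset isClosed_closure ?_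
    refine closure_minimal ?_ (isClosed_set_pi fun k _ => isClosed_closure)
    rintro _ ⟨N, rfl⟩ k _
    exact subset_closure ⟨N, rfl⟩
  · obtain ⟨N₀, hN₀⟩ := hap k k.2
    -- A compact set in a metric space is closed, so it contains every cluster point of a sequence
    -- that eventually lies in it.
    have hcl := (isCompact_subdensity (torusBasis k) (J k)
      (isClosed_admissibleMatrices k (C ^ (k : ℕ)))).isClosed
    have hcont : Continuous fun Γ' : HierarchySpace T J => Γ' k t :=
      (ContinuousEvalConst.continuous_eval_const t).comp (continuous_apply k)
    have hmem := hcl.mem_of_mapClusterPt (hΓ.continuousAt_comp hcont.continuousAt) (by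
      filter_upwards [eventually_ge_atTop (max N₀ k)] with N hN
      have hk : (k : ℕ) ≤ N := (le_max_right _ _).trans hN
      have hs := hψ_symm N (Nat.le_trans k.pos hk) t
      have e : (Γ N k t).op = marginal (k : ℕ) (ψ N t) := hG1 N k t hk
      refine ⟨hsub N k t, ?_⟩
      change (fun m n => inner ℂ (torusBasis k m) ((Γ N k t).op (torusBasis k n))) ∈ _
      rw [e]
      exact ⟨inner_marginal_permMode_left hk hs, inner_marginal_permMode_right hk hs,
        (kineticTrace_le_iff (isPositive_marginal hk _)).1
          (hN₀ N ((le_max_left _ _).trans hN) hk t t.2)⟩)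
    obtain ⟨hd, h1, h2, h3⟩ := hmem
    refine ⟨isSymmetricOp_of_matrix h1 h2, hd.1, hd.isTraceClass, ?_, ?_⟩
    -- The trace is the pairing with the identity, which is bounded though not compact;
    -- `IsSubdensity.pairing_le` needs no compactness.
    · have h4 := (hd.pairing_le (ContinuousLinearMap.id ℂ _)).2
      rw [ContinuousLinearMap.id_comp] at h4
      exact h4.trans ContinuousLinearMap.norm_id_le
    · have h4 := (kineticTrace_le_iff hd.1).2 h3
      rwa [ENNReal.coe_pow] at h4
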